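/- Let $d\ge 0$, and let $e_1,\dots,e_d$ be the standard basis of $\mathbb{R}^d$. For $J\subseteq[d]=\{1,\dots,d\}$ let $\mathbb{R}^J$ be the span of the $e_j$, $j\in J$. A polytope is a non-empty compact intersection of finitely many half-spaces. Its faces are $\emptyset$ and the sets of maximizers over it of linear functionals, with $\dim\emptyset=-1$. A flag of $P$ is a chain $F_{-1}\subsetneq F_0\subsetneq\dots\subsetneq F_{\dim P}$ of faces of $P$ with $\dim F_i=i$. A polytope $P\subset\mathbb{R}^d$ is called locally anti-blocking if for every $J\subseteq[d]$ the orthogonal projection of $P$ onto $\mathbb{R}^J$ equals $P\cap\mathbb{R}^J$; normalized if $\max_{x\in P}\langle x,\pm e_i\rangle=1$ for all $i\in[d]$ and both signs; and flag-minimizing if it has exactly $2^d\cdot d!$ flags. Let $P\subset\mathbb{R}^d$ be a flag-minimizing normalized locally anti-blocking polytope. Then: (1) For all $i\ne j$, the section $P\cap\mathbb{R}^{\{i,j\}}$ is either axis-aligned, that is, a product of two segments $[a_1,b_1]\times[a_2,b_2]$ in the coordinate axes with $a_1,a_2<0<b_1,b_2$, or a diamond, that is, the convex hull of two such segments. Thus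 the graph $G(P)$ on the vertex set $[d]$, in which $\{i,j\}$ is an edge if and only if $P\cap\mathbb{R}^{\{i,j\}}$ is axis-aligned, is defined. (2) $P=\operatorname{conv}\{1_D\}$, where $D$ runs over all cones positively spanned by a subset $J_D\subseteq\{\pm e_1,\dots,\pm e_d\}$ that does not contain both $e_i$ and $-e_i$ for any $i$, such that $D\subseteq\mathbb{R}^J$ for some (possibly empty) clique $J\subseteq[d]$ of $G(P)$, and where $1_D=\sum_{v\in J_D}v$. (3) $P$ is determined by $G(P)$: if $Q\subset\mathbb{R}^d$ is another flag-minimizing normalized locally anti-blocking polytope with $G(Q)=G(P)$, then $Q=P$. (4) All vertices of $P$ lie in $\{0,1,-1\}^d$. -/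

import Mathlib

open scoped RealInnerProductSpace

noncomputable section

namespace FlagPolytope

/-- Euclidean space `ℝ^d`; its coordinates are indexed by `Fin d`. -/
abbrev E (d : ℕ) : Type := EuclideanSpace ℝ (Fin d)

/-- The standard basis vector `e_i`. -/
def e {d : ℕ} (i : Fin d) : E d := EuclideanSpace.single i 1

/-- The coordinate subspace `ℝ^J`, spanned by the `e_j` with `j ∈ J`. -/
def coordSubspace {d : ℕ} (J : Set (Fin d)) : Submodule ℝ (E d) :=
  Submodule.span ℝ (e '' J)

/-- A polyhedron is the intersection of finitely many closed half-spaces. -/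
def IsPolyhedron {d : ℕ} (P : Set (E d)) : Prop :=
  ∃ H : Finset (E d × ℝ), P = {x | ∀ h ∈ H, ⟪h.1, x⟫ ≤ h.2}

/-- A polytope is a (non-empty) compact polyhedron. -/
structure IsPolytope {d : ℕ} (P : Set (E d)) : Prop where
  nonempty : P.Nonempty
  isCompact : IsCompact P
  isPolyhedron : IsPolyhedron P

/-- `P` is locally anti-blocking: for every coordinate subspace `H`, the orthogonal projection
of `P` onto `H` is equal to `P ∩ H`. -/
def IsLocallyAntiBlocking {d : ℕ} (P : Set (E d)) : Prop :=
  ∀ J : Set (Fin d),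
    (fun x => (coordSubspace J).starProjection x) '' P = P ∩ (coordSubspace J : Set (E d))

/-- `P` is normalized: `max_{x ∈ P} ⟪x, ± e_i⟫ = 1` for all `i` and both signs. -/
def IsNormalized {d : ℕ} (P : Set (E d)) : Prop :=
  ∀ i : Fin d, IsGreatest ((fun x => ⟪x, e i⟫) '' P) 1 ∧ IsGreatest ((fun x => ⟪x, -e i⟫) '' P) 1

/-- The faces of `P`: the empty set, and the sets of maximizers over `P` of a linear functional
(the zero functional gives `P` itself). -/
def faces {d : ℕ} (P : Set (E d)) : Set (Set (E d)) :=
  {F | IsExposed ℝ P F}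

open Classical in
/-- The dimension of the affine span of a set, with the convention that `∅` has dimension `-1`. -/
def dim {d : ℕ} (F : Set (E d)) : ℤ :=
  if F = ∅ then -1 else (Module.finrank ℝ (vectorSpan ℝ F) : ℤ)

/-- The `k`-dimensional faces of `P`. -/
def facesOfDim {d : ℕ} (P : Set (E d)) (k : ℤ) : Set (Set (E d)) :=
  {F | F ∈ faces P ∧ dim F = k}

/-- The (full) flags `F_{-1} ⊊ F_0 ⊊ ⋯ ⊊ F_{dim P}` of `P`, where `F_i` is an
`i`-dimensional face of `P`. -/
def flags {d : ℕ} (P : Set (E d)) : Set (Set.Icc (-1 : ℤ) (dim P) → Set (E d)) :=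
  {F | (∀ i : Set.Icc (-1 : ℤ) (dim P), F i ∈ facesOfDim P i) ∧ StrictMono F}

/-- `P ⊆ ℝ^d` has exactly `2^d · d!` flags. -/
def IsFlagMinimizing {d : ℕ} (P : Set (E d)) : Prop :=
  (flags P).ncard = 2 ^ d * d.factorial

/-- The vertices of `P`, i.e. the points that form a zero-dimensional face of `P`. -/
def vertices {d : ℕ} (P : Set (E d)) : Set (E d) :=
  {v | {v} ∈ facesOfDim P 0}

/-- The section of `P` by the coordinate plane `ℝ^{i,j}` is a product `[a₁,b₁] × [a₂,b₂]` of two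
segments in the coordinate axes with `0` in their relative interiors. -/
def IsAxisAligned {d : ℕ} (P : Set (E d)) (i j : Fin d) : Prop :=
  ∃ a₁ b₁ a₂ b₂ : ℝ, a₁ < 0 ∧ 0 < b₁ ∧ a₂ < 0 ∧ 0 < b₂ ∧
    P ∩ (coordSubspace {i, j} : Set (E d)) =
      {x | ∃ s ∈ Set.Icc a₁ b₁, ∃ t ∈ Set.Icc a₂ b₂, x = s • e i + t • e j}

/-- The section of `P` by the coordinate plane `ℝ^{i,j}` is the convex hull of two
segments in the coordinate axes with `0` in their relative interiors. -/
def IsDiamond {d : ℕ} (P : Set (E d)) (i j : Fin d) : Prop :=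
  ∃ a₁ b₁ a₂ b₂ : ℝ, a₁ < 0 ∧ 0 < b₁ ∧ a₂ < 0 ∧ 0 < b₂ ∧
    P ∩ (coordSubspace {i, j} : Set (E d)) =
      convexHull ℝ ({x | ∃ s ∈ Set.Icc a₁ b₁, x = s • e i} ∪ {x | ∃ t ∈ Set.Icc a₂ b₂, x = t • e j})

theorem IsAxisAligned.symm {d : ℕ} {P : Set (E d)} {i j : Fin d} (h : IsAxisAligned P i j) :
    IsAxisAligned P j i := by
  obtain ⟨a₁, b₁, a₂, b₂, h1, h2, h3, h4, h5⟩ := h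
  refine ⟨a₂, b₂, a₁, b₁, h3, h4, h1, h2, ?_⟩
  rw [Set.pair_comm, h5]
  ext x
  constructor
  · rintro ⟨s, hs, t, ht, rfl⟩
    exact ⟨t, ht, s, hs, add_comm _ _⟩
  · rintro ⟨s, hs, t, ht, rfl⟩
    exact ⟨t, ht, s, hs, add_comm _ _⟩

/-- The condition under which the graph of `P` is defined: each section by a coordinate plane
is axis-aligned or a diamond. -/
def HasGraph {d : ℕ} (P : Set (E d)) : Prop :=
  ∀ i j : Fin d, i ≠ j → IsAxisAligned P i j ∨ IsDiamond P i j

/-- The graph `G(P)` on the coordinate indices: `{i, j}` is an edge if and only if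
the section of `P` by `ℝ^{i,j}` is axis-aligned. -/
def graph {d : ℕ} (P : Set (E d)) : SimpleGraph (Fin d) where
  Adj i j := i ≠ j ∧ IsAxisAligned P i j
  symm := ⟨fun _ _ h => ⟨h.1.symm, h.2.symm⟩⟩
  loopless := ⟨fun _ h => h.1 rfl⟩

/-- The cones of the standard fan, positively spanned by a set of vectors `± e_i` which
does not contain both `e_i` and `-e_i` for any `i`. Such a set is encoded by `s : Fin d → {0, 1, -1}`:
it consists of the vectors `s i • e_i` with `s i ≠ 0`. -/
def orthantCone {d : ℕ} (s : Fin d → SignType) : PointedCone ℝ (E d) :=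
  PointedCone.hull ℝ {v | ∃ i, s i ≠ 0 ∧ v = (s i : ℝ) • e i}

/-- The vector `1_D`, the sum of the generators `± e_i` of the orthant cone `D`
(a zero sign contributes nothing). -/
def oneVec {d : ℕ} (s : Fin d → SignType) : E d :=
  ∑ i, (s i : ℝ) • e i

/-- The convex hull `C(G)` of the vectors `1_D` over all orthant cones `D` that are contained in
`ℝ^J` for some clique `J` of `G`. -/
def cliqueHull {d : ℕ} (G : SimpleGraph (Fin d)) : Set (E d) :=
  convexHull ℝ {v | ∃ s : Fin d → SignType,
    (∃ J : Set (Fin d), G.IsClique J ∧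
      (orthantCone s : Set (E d)) ⊆ (coordSubspace J : Set (E d))) ∧ v = oneVec s}

end FlagPolytope

end

/-!
A coordinate `k` has a sign on a face of `P` that is neither parallel to the axis of `e_k` nor
contained in its coordinate hyperplane, and the sign `0` on the other faces. Hence the chain of the
proper faces of a flag has a square sign matrix. Weight the flag by the determinant of this matrix
and by its orientation. Expanding the determinants along the last column, the terms of flags that
differ in a single face cancel, and the remaining ones reduce to the section of `P` with the last
coordinate hyperplane; so the weights add up to `± 2^d d!`. On the other hand, sign matrices are
interval matrices up to the signs of their columns, so the weights are at most `1` in absolute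
value. If `P` has only `2^d d!` flags, then no sign matrix is singular, and the same holds for the
sections of `P` with coordinate subspaces.

A singular sign matrix arises whenever a vertex and the normal of a facet through it share two
coordinates in their supports. Its absence forces the non-zero coordinates of a vertex to be
extremal in `P`. It then makes every planar section a square or a diamond, and puts the sum of the
vectors `± e_k` over a clique into `P` by induction on the size of the clique.
-/

namespace FlagPolytope

section FaceAt

variable {V : Type*} [AddCommGroup V] [Module ℝ V] {P F : Set V} {y z : V}

/-- The direction `u` is feasible at `z` for `P`: a short enough step from `z` along `u` ends
in `P`. -/
def IsFeasibleDir (P : Set V) (z u : V) : Prop :=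
  ∃ ε > (0 : ℝ), z + ε • u ∈ P

/-- The smallest face of a convex set `P` that contains `z`, encoded as the set of the points
`y ∈ P` such that the segment from `y` to `z` can be prolonged beyond `z` inside `P`. -/
def faceAt (P : Set V) (z : V) : Set V :=
  {y ∈ P | IsFeasibleDir P z (z - y)}

theorem mem_faceAt_self (hz : z ∈ P) : z ∈ faceAt P z :=
  ⟨hz, 1, one_pos, by simpa using hz⟩

theorem mem_openSegment_add_smul_sub {ε : ℝ} (hε : 0 < ε) :
    z ∈ openSegment ℝ y (z + ε • (z - y)) := by
  refine ⟨ε / (1 + ε), 1 / (1 + ε), by positivity, by positivity, by field_simp; ring, ?_⟩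
  match_scalars <;> field_simp
  ring

theorem faceAt_subset_of_isExtreme (hF : IsExtreme ℝ P F) (hz : z ∈ F) : faceAt P z ⊆ F := by
  rintro y ⟨hy, ε, hε, hyε⟩
  exact hF.left_mem_of_mem_openSegment hy hyε hz (mem_openSegment_add_smul_sub hε)

end FaceAt

section LinearInequalities

variable {V : Type*} [NormedAddCommGroup V] [InnerProductSpace ℝ V] {H : Finset (V × ℝ)}
  {a b u y z : V}

/-- The polyhedron cut out by finitely many linear inequalities `⟪h.1, x⟫ ≤ h.2`. -/
def polyhedron (H : Finset (V × ℝ)) : Set V :=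
  {x | ∀ h ∈ H, ⟪h.1, x⟫ ≤ h.2}

open Classical in
/-- The inequalities of the system `H` that hold with equality at `z`. -/
noncomputable def activeAt (H : Finset (V × ℝ)) (z : V) : Finset (V × ℝ) :=
  {h ∈ H | ⟪h.1, z⟫ = h.2}

theorem mem_activeAt {h : V × ℝ} : h ∈ activeAt H z ↔ h ∈ H ∧ ⟪h.1, z⟫ = h.2 := by
  simp [activeAt]

theorem convex_polyhedron (H : Finset (V × ℝ)) : Convex ℝ (polyhedron H) := by
  have : polyhedron H = ⋂ h ∈ H, {x | ⟪h.1, x⟫ ≤ h.2} := by ext; simp [polyhedron]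
  rw [this]
  exact convex_iInter₂ fun h _ => convex_halfSpace_le (innerSL ℝ h.1).isLinear h.2

theorem isFeasibleDir_of_forall_activeAt (hz : z ∈ polyhedron H)
    (hu : ∀ h ∈ activeAt H z, ⟪h.1, u⟫ ≤ 0) : IsFeasibleDir (polyhedron H) z u := by
  have key : ∀ᶠ ε in nhdsWithin (0 : ℝ) (Set.Ioi 0), ∀ h ∈ H, ⟪h.1, z + ε • u⟫ ≤ h.2 := by
    rw [Filter.eventually_all_finset]
    intro h hh
    rcases (hz h hh).eq_or_lt with heq | hlt
    · filter_upwards [self_mem_nhdsWithin] with ε hε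
      rw [inner_add_right, inner_smul_right, heq]
      have := mul_nonpos_of_nonneg_of_nonpos (le_of_lt hε) (hu h (mem_activeAt.2 ⟨hh, heq⟩))
      linarith
    · have hcont : Continuous fun ε : ℝ => ⟪h.1, z + ε • u⟫ := by fun_prop
      have hlim : Filter.Tendsto (fun ε : ℝ => ⟪h.1, z + ε • u⟫) (nhds 0) (nhds ⟪h.1, z⟫) := by
        simpa using hcont.tendsto 0
      exact nhdsWithin_le_nhds ((hlim.eventually (gt_mem_nhds hlt)).mono fun _ => le_of_lt)
  obtain ⟨ε, hε, hpos⟩ := (key.and self_mem_nhdsWithin).exists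
  exact ⟨ε, hpos, hε⟩

theorem mem_faceAt_polyhedron (hz : z ∈ polyhedron H) :
    y ∈ faceAt (polyhedron H) z ↔ y ∈ polyhedron H ∧ activeAt H z ⊆ activeAt H y := by
  constructor
  · rintro ⟨hy, ε, hε, hyε⟩
    refine ⟨hy, fun h hh => ?_⟩
    obtain ⟨hhH, hhz⟩ := mem_activeAt.1 hh
    have hprolonged := hyε h hhH
    rw [inner_add_right, inner_smul_right, inner_sub_right, hhz] at hprolonged
    refine mem_activeAt.2 ⟨hhH, (hy h hhH).antisymm ?_⟩
    exact sub_nonpos.1 (nonpos_of_mul_nonpos_right (by linarith) hε)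
  · rintro ⟨hy, hsub⟩
    refine ⟨hy, isFeasibleDir_of_forall_activeAt hz fun h hh => ?_⟩
    rw [inner_sub_right, (mem_activeAt.1 hh).2, (mem_activeAt.1 (hsub hh)).2, sub_self]

theorem isExposed_faceAt_polyhedron (hz : z ∈ polyhedron H) :
    IsExposed ℝ (polyhedron H) (faceAt (polyhedron H) z) := by
  intro _
  have hl : ∀ x, innerSL ℝ (∑ h ∈ activeAt H z, h.1) x = ∑ h ∈ activeAt H z, ⟪h.1, x⟫ := by
    simp
  have hle : ∀ x ∈ polyhedron H, ∀ h ∈ activeAt H z, ⟪h.1, x⟫ ≤ ⟪h.1, z⟫ := fun x hx h hh =>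
    (mem_activeAt.1 hh).2 ▸ hx h (mem_activeAt.1 hh).1
  refine ⟨innerSL ℝ (∑ h ∈ activeAt H z, h.1), ?_⟩
  ext y
  rw [mem_faceAt_polyhedron hz]
  refine and_congr_right fun hy => ⟨fun hsub x hx => ?_, fun hmax h hh => ?_⟩
  · rw [hl, hl]
    refine Finset.sum_le_sum fun h hh => ?_
    exact (hle x hx h hh).trans_eq ((mem_activeAt.1 hh).2.trans (mem_activeAt.1 (hsub hh)).2.symm)
  · have hge := hmax z hz
    rw [hl, hl] at hge
    have heq := (Finset.sum_eq_sum_iff_of_le (hle y hy)).1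
      (le_antisymm (Finset.sum_le_sum (hle y hy)) hge) h hh
    exact mem_activeAt.2 ⟨(mem_activeAt.1 hh).1, heq.trans (mem_activeAt.1 hh).2⟩

theorem activeAt_midpoint_subset_left (hy : y ∈ polyhedron H) (hz : z ∈ polyhedron H) :
    activeAt H (midpoint ℝ y z) ⊆ activeAt H y := by
  intro h hh
  obtain ⟨hhH, hmid⟩ := mem_activeAt.1 hh
  rw [midpoint_eq_smul_add, invOf_eq_inv, inner_smul_right, inner_add_right] at hmid
  have hyh := hy h hhH
  have hzh := hz h hhH
  exact mem_activeAt.2 ⟨hhH, by linarith⟩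

/-- A point of `G` with the fewest active inequalities works, since the midpoint with any other
point of `G` has only those inequalities active that are active at both ends. -/
theorem exists_eq_faceAt_polyhedron {G : Set V} (hG : IsExtreme ℝ (polyhedron H) G)
    (hconv : Convex ℝ G) (hne : G.Nonempty) : ∃ z ∈ G, G = faceAt (polyhedron H) z := by
  obtain ⟨z, hzG, hmin⟩ := exists_minimalFor_of_wellFoundedLT (· ∈ G)
    (fun x => (activeAt H x).card) hne
  refine ⟨z, hzG, subset_antisymm (fun y hy => ?_) (faceAt_subset_of_isExtreme hG hzG)⟩
  have hyP := hG.subset hy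
  have hzP := hG.subset hzG
  have hsub : activeAt H (midpoint ℝ z y) ⊆ activeAt H z := activeAt_midpoint_subset_left hzP hyP
  have heq : activeAt H (midpoint ℝ z y) = activeAt H z :=
    Finset.eq_of_subset_of_card_le hsub
      ((le_total _ _).elim id fun h => hmin (hconv.midpoint_mem hzG hy) h)
  refine (mem_faceAt_polyhedron hzP).2 ⟨hyP, ?_⟩
  rw [← heq, midpoint_comm]
  exact activeAt_midpoint_subset_left hyP hzP

/-- The first inequality active at `a` that the ray from `b` violates. -/
theorem exists_first_blocking_inequality (ha : a ∈ polyhedron H) (hb : b ∈ polyhedron H)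
    (hu : ¬ IsFeasibleDir (polyhedron H) a u) :
    ∃ s ≥ (0 : ℝ), (∃ k ∈ activeAt H a, 0 < ⟪k.1, u⟫ ∧ ⟪k.1, b + s • u⟫ = k.2) ∧
      ∀ h ∈ activeAt H a, ⟪h.1, b + s • u⟫ ≤ h.2 := by
  classical
  set K := (activeAt H a).filter fun h => 0 < ⟪h.1, u⟫
  have hKne : K.Nonempty := by
    by_contra hempty
    rw [Finset.not_nonempty_iff_eq_empty, Finset.filter_eq_empty_iff] at hempty
    exact hu (isFeasibleDir_of_forall_activeAt ha fun h hh => not_lt.1 (hempty hh))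
  obtain ⟨k, hkK, hmin⟩ := K.exists_min_image (fun h => (h.2 - ⟪h.1, b⟫) / ⟪h.1, u⟫) hKne
  obtain ⟨hka, hku⟩ := Finset.mem_filter.1 hkK
  set s := (k.2 - ⟪k.1, b⟫) / ⟪k.1, u⟫ with hs
  have hs0 : 0 ≤ s := div_nonneg (sub_nonneg.2 (hb k (mem_activeAt.1 hka).1)) hku.le
  refine ⟨s, hs0, ⟨k, hka, hku, ?_⟩, fun h hh => ?_⟩
  · rw [inner_add_right, inner_smul_right, hs, div_mul_cancel₀ _ hku.ne']
    ring
  · rw [inner_add_right, inner_smul_right]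
    rcases le_or_gt ⟪h.1, u⟫ 0 with hle | hlt
    · have := mul_nonpos_of_nonneg_of_nonpos hs0 hle
      have := hb h (mem_activeAt.1 hh).1
      linarith
    · have := hmin h (Finset.mem_filter.2 ⟨hh, hlt⟩)
      rw [le_div_iff₀ hlt] at this
      linarith

/-- The last point of the ray from `b` that satisfies the inequalities active at `a` is moved
towards `a` until it lies in the polyhedron. -/
theorem exists_ray_exit (ha : a ∈ polyhedron H) (hb : b ∈ polyhedron H)
    (hu : ¬ IsFeasibleDir (polyhedron H) a u) :
    ∃ s ≥ (0 : ℝ), ∃ t > (0 : ℝ), ∃ z ∈ polyhedron H, z = a + t • (b + s • u - a) ∧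
      ¬ IsFeasibleDir (polyhedron H) z u ∧ a ∈ faceAt (polyhedron H) z ∧
      ∀ r : ℝ, b + r • u ∈ polyhedron H → r ≤ s := by
  obtain ⟨s, hs, ⟨k, hka, hku, hks⟩, hle⟩ := exists_first_blocking_inequality ha hb hu
  set w := b + s • u - a with hw
  obtain ⟨hkH, hka⟩ := mem_activeAt.1 hka
  have hkw : ⟪k.1, w⟫ = 0 := by rw [hw, inner_sub_right, hks, hka, sub_self]
  obtain ⟨t, ht, htw⟩ : IsFeasibleDir (polyhedron H) a w :=
    isFeasibleDir_of_forall_activeAt ha fun h hh => by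
      rw [hw, inner_sub_right, (mem_activeAt.1 hh).2]
      exact sub_nonpos.2 (hle h hh)
  have hmid : a + (t / 2) • w = midpoint ℝ a (a + t • w) := by
    rw [midpoint_eq_smul_add, invOf_eq_inv]
    module
  have hmem : a + (t / 2) • w ∈ polyhedron H :=
    hmid ▸ (convex_polyhedron H).midpoint_mem ha htw
  refine ⟨s, hs, t / 2, half_pos ht, _, hmem, rfl, ?_, ⟨ha, 1, one_pos, ?_⟩, fun r hr => ?_⟩
  · rintro ⟨ε, hε, hmem'⟩
    have := hmem' k hkH
    simp only [inner_add_right, inner_smul_right, hkw, hka] at this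
    have := mul_pos hε hku
    linarith
  · convert htw using 1
    module
  · have := hr k hkH
    rw [← hks, inner_add_right, inner_add_right, inner_smul_right, inner_smul_right] at this
    exact le_of_mul_le_mul_right (by linarith) hku

end LinearInequalities

section Exposed

variable {V : Type*} [AddCommGroup V] [TopologicalSpace V] [Module ℝ V] {P F : Set V}

theorem exists_support_of_isExposed (hF : IsExposed ℝ P F) (hne : F.Nonempty) :
    ∃ (l : StrongDual ℝ V) (M : ℝ), (∀ x ∈ P, l x ≤ M) ∧ F = {x ∈ P | l x = M} := by
  obtain ⟨l, hl⟩ := hF hne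
  obtain ⟨z, hz⟩ := hne
  have hz' := hl ▸ hz
  refine ⟨l, l z, hz'.2, ?_⟩
  rw [hl]
  ext x
  exact and_congr_right fun hx =>
    ⟨fun hmax => le_antisymm (hz'.2 x hx) (hmax z hz'.1), fun he y hy => he ▸ hz'.2 y hy⟩

theorem isExposed_of_forall_le (l : StrongDual ℝ V) {M : ℝ} (hl : ∀ x ∈ P, l x ≤ M) :
    IsExposed ℝ P {x ∈ P | l x = M} := by
  rintro ⟨z, hz, hzM⟩
  refine ⟨l, ?_⟩
  ext x
  exact and_congr_right fun hx =>
    ⟨fun he y hy => (hl y hy).trans_eq he.symm, fun hmax => (hl x hx).antisymm (hzM ▸ hmax z hz)⟩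

/-- The dimension of the affine hull of a set (`0` for the empty set). -/
noncomputable def affDim (F : Set V) : ℕ := Module.finrank ℝ (vectorSpan ℝ F)

theorem affDim_lt_of_ssubset [FiniteDimensional ℝ V] {A B : Set V} (hA : IsExposed ℝ P A)
    (hB : B ⊆ P) (hne : A.Nonempty) (hAB : A ⊂ B) : affDim A < affDim B := by
  refine Submodule.finrank_lt_finrank_of_lt
    ((vectorSpan_mono ℝ hAB.subset).lt_of_ne fun heq => ?_)
  obtain ⟨l, M, -, rfl⟩ := exists_support_of_isExposed hA hne
  obtain ⟨b, hb, hbA⟩ := Set.exists_of_ssubset hAB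
  obtain ⟨a, ha⟩ := hne
  have hker : vectorSpan ℝ {x ∈ P | l x = M} ≤ LinearMap.ker (l : V →ₗ[ℝ] ℝ) := by
    rw [vectorSpan_def, Submodule.span_le]
    rintro _ ⟨x, hx, y, hy, rfl⟩
    simp [hx.2, hy.2]
  have hba := hker (heq ▸ vsub_mem_vectorSpan ℝ hb (hAB.subset ha))
  simp only [vsub_eq_sub, LinearMap.mem_ker, ContinuousLinearMap.coe_coe, map_sub, ha.2] at hba
  exact hbA ⟨hB hb, by linarith⟩

end Exposed

theorem exists_last_on_ray {V : Type*} [NormedAddCommGroup V] [NormedSpace ℝ V] {P : Set V}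
    (hP : IsCompact P) {b u : V} (hb : b ∈ P) (hu : u ≠ 0) :
    ∃ s ≥ (0 : ℝ), b + s • u ∈ P ∧ ∀ r : ℝ, b + r • u ∈ P → r ≤ s := by
  have hK : IsCompact {r : ℝ | b + r • u ∈ P} :=
    ((Homeomorph.addLeft b).isClosedEmbedding.comp
      (isClosedEmbedding_smul_left hu)).isCompact_preimage hP
  have hzero : (0 : ℝ) ∈ {r : ℝ | b + r • u ∈ P} := by simpa using hb
  obtain ⟨s, hs, hmax⟩ := hK.exists_isGreatest ⟨0, hzero⟩
  exact ⟨s, hmax hzero, hs, fun r hr => hmax hr⟩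

variable {d n : ℕ}

namespace IsPolyhedron

variable {P G : Set (E d)}

theorem convex (hP : IsPolyhedron P) : Convex ℝ P := by
  obtain ⟨H, rfl⟩ := hP
  exact convex_polyhedron H

theorem isExposed_faceAt (hP : IsPolyhedron P) {z : E d} (hz : z ∈ P) :
    IsExposed ℝ P (faceAt P z) := by
  obtain ⟨H, rfl⟩ := hP
  exact isExposed_faceAt_polyhedron hz

theorem exists_eq_faceAt (hP : IsPolyhedron P) (hG : IsExtreme ℝ P G) (hconv : Convex ℝ G)
    (hne : G.Nonempty) : ∃ z ∈ G, G = faceAt P z := by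
  obtain ⟨H, rfl⟩ := hP
  exact exists_eq_faceAt_polyhedron hG hconv hne

theorem exists_eq_faceAt_of_isExposed (hP : IsPolyhedron P) (hG : IsExposed ℝ P G)
    (hne : G.Nonempty) : ∃ z ∈ G, G = faceAt P z :=
  hP.exists_eq_faceAt hG.isExtreme (hG.convex hP.convex) hne

theorem isExposed_of_isExtreme (hP : IsPolyhedron P) (hG : IsExtreme ℝ P G)
    (hconv : Convex ℝ G) : IsExposed ℝ P G := by
  rcases G.eq_empty_or_nonempty with rfl | hne
  · exact isExposed_empty
  obtain ⟨z, hz, heq⟩ := hP.exists_eq_faceAt hG hconv hne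
  exact heq ▸ hP.isExposed_faceAt (hG.subset hz)

theorem finite_isExposed (hP : IsPolyhedron P) : {F | IsExposed ℝ P F}.Finite := by
  have hP' := hP
  obtain ⟨H, rfl⟩ := hP
  let f : Finset (E d × ℝ) → Set (E d) := fun A => {x ∈ polyhedron H | A ⊆ activeAt H x}
  refine ((H.powerset.finite_toSet.image f).union (Set.finite_singleton ∅)).subset fun F hF => ?_
  rcases F.eq_empty_or_nonempty with rfl | hne
  · exact Or.inr rfl
  obtain ⟨z, hz, heq⟩ := hP'.exists_eq_faceAt_of_isExposed hF hne
  refine Or.inl ⟨activeAt H z, Finset.mem_powerset.2 fun h hh => (mem_activeAt.1 hh).1, ?_⟩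
  rw [heq]
  ext y
  exact (mem_faceAt_polyhedron (hF.subset hz)).symm

theorem exists_ray_exit (hP : IsPolyhedron P) {a b u : E d} (ha : a ∈ P) (hb : b ∈ P)
    (hu : ¬ IsFeasibleDir P a u) :
    ∃ s ≥ (0 : ℝ), ∃ t > (0 : ℝ), ∃ z ∈ P, z = a + t • (b + s • u - a) ∧
      ¬ IsFeasibleDir P z u ∧ a ∈ faceAt P z ∧ ∀ r : ℝ, b + r • u ∈ P → r ≤ s := by
  obtain ⟨H, rfl⟩ := hP
  exact FlagPolytope.exists_ray_exit ha hb hu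

end IsPolyhedron

section FaceLattice

variable {d : ℕ} {P A B C : Set (E d)} {a b y z : E d}

theorem mem_iff_mem_of_eq_add_smul (hC : IsExposed ℝ P C) (ha : a ∈ C) (hy : y ∈ C) (hb : b ∈ P)
    (hz : z ∈ P) {s t : ℝ} (ht : t ≠ 0) (hzdef : z = a + t • (b + s • (a - y) - a)) :
    z ∈ C ↔ b ∈ C := by
  obtain ⟨l, M, -, rfl⟩ := exists_support_of_isExposed hC ⟨a, ha⟩
  have hlz : l z = M + t * (l b - M) := by
    simp only [hzdef, map_add, map_smul, map_sub, ha.2, hy.2, smul_eq_mul]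
    ring
  simp [hz, hb, hlz, ht, sub_eq_zero]

theorem IsPolyhedron.faceAt_subset_faceAt (hP : IsPolyhedron P) (hz : z ∈ P)
    (ha : a ∈ faceAt P z) : faceAt P a ⊆ faceAt P z :=
  faceAt_subset_of_isExtreme (hP.isExposed_faceAt hz).isExtreme ha

theorem IsPolyhedron.exists_faceAt_notMem (hP : IsPolyhedron P) (ha : a ∈ P) (hb : b ∈ P)
    (hy : y ∈ P) (hya : y ∉ faceAt P a) :
    ∃ s ≥ (0 : ℝ), ∃ t > (0 : ℝ), ∃ z ∈ P, z = a + t • (b + s • (a - y) - a) ∧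
      faceAt P a ⊆ faceAt P z ∧ y ∉ faceAt P z := by
  obtain ⟨s, hs, t, ht, z, hz, hzdef, hnot, haz, -⟩ := hP.exists_ray_exit ha hb
    fun hfeas => hya ⟨hy, hfeas⟩
  refine ⟨s, hs, t, ht, z, hz, hzdef, hP.faceAt_subset_faceAt hz haz, ?_⟩
  rintro ⟨-, ε, hε, hmem⟩
  refine hnot ⟨ε / (1 + ε), by positivity, ?_⟩
  convert hP.convex hmem ha (a := 1 / (1 + ε)) (b := ε / (1 + ε)) (by positivity) (by positivity)
    (by field_simp) using 1
  match_scalars <;> field_simp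

theorem exists_notMem_faceAt_of_ne (hP : IsCompact P) (hb : b ∈ P) (hby : b ≠ y) :
    ∃ s : ℝ, b + s • (b - y) ∈ P ∧ y ∉ faceAt P (b + s • (b - y)) := by
  obtain ⟨s, hs, hz, hmax⟩ := exists_last_on_ray hP hb (sub_ne_zero.2 hby)
  refine ⟨s, hz, ?_⟩
  rintro ⟨-, ε, hε, hmem⟩
  have := hmax (s + ε * (1 + s)) (by convert hmem using 1; module)
  have : 0 < ε * (1 + s) := by positivity
  linarith

theorem exists_isExposed_ssubset_ne (hPc : IsCompact P) (hP : IsPolyhedron P)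
    (hC : IsExposed ℝ P C) (hne : B.Nonempty) (hBC : B ⊂ C) :
    ∃ W, IsExposed ℝ P W ∧ W.Nonempty ∧ W ⊂ C ∧ W ≠ B := by
  obtain ⟨b, hbC, hbB⟩ := Set.exists_of_ssubset hBC
  obtain ⟨y, hy⟩ := hne
  have hyC := hBC.subset hy
  obtain ⟨s, hz, hyz⟩ := exists_notMem_faceAt_of_ne hPc (hC.subset hbC)
    fun h : b = y => hbB (h ▸ hy)
  have hzC : b + s • (b - y) ∈ C := by
    obtain ⟨l, M, -, rfl⟩ := exists_support_of_isExposed hC ⟨b, hbC⟩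
    exact ⟨hz, by simp [hbC.2, hyC.2]⟩
  exact ⟨_, hP.isExposed_faceAt hz, ⟨_, mem_faceAt_self hz⟩,
    (faceAt_subset_of_isExtreme hC.isExtreme hzC).ssubset_of_ne fun h => hyz (h ▸ hyC),
    fun h => hyz (h ▸ hy)⟩

/-- The face is rotated about `A`, from a point of `C` off `B`, until it leaves a point of `B`. -/
theorem exists_isExposed_between_ne_of_nonempty (hP : IsPolyhedron P) (hA : IsExposed ℝ P A)
    (hB : IsExposed ℝ P B) (hC : IsExposed ℝ P C) (hne : A.Nonempty) (hAB : A ⊂ B)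
    (hBC : B ⊂ C) : ∃ W, IsExposed ℝ P W ∧ A ⊂ W ∧ W ⊂ C ∧ W ≠ B := by
  obtain ⟨b, hbC, hbB⟩ := Set.exists_of_ssubset hBC
  obtain ⟨y, hyB, hyA⟩ := Set.exists_of_ssubset hAB
  obtain ⟨a, haA, rfl⟩ := hP.exists_eq_faceAt_of_isExposed hA hne
  have haB := hAB.subset haA
  have hbP := hC.subset hbC
  obtain ⟨s, -, t, ht, z, hz, hzdef, hAz, hyz⟩ :=
    hP.exists_faceAt_notMem (hA.subset haA) hbP (hB.subset hyB) hyA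
  have hzC : z ∈ C := (mem_iff_mem_of_eq_add_smul hC (hBC.subset haB) (hBC.subset hyB) hbP hz
    ht.ne' hzdef).2 hbC
  have hzB : z ∉ B := (mem_iff_mem_of_eq_add_smul hB haB hyB hbP hz ht.ne' hzdef).not.2 hbB
  exact ⟨_, hP.isExposed_faceAt hz,
    hAz.ssubset_of_ne fun h => hzB (hAB.subset (h ▸ mem_faceAt_self hz)),
    (faceAt_subset_of_isExtreme hC.isExtreme hzC).ssubset_of_ne
      fun h => hyz (h ▸ hBC.subset hyB),
    fun h => hyz (h ▸ hyB)⟩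

theorem exists_isExposed_between_ne (hPc : IsCompact P) (hP : IsPolyhedron P)
    (hA : IsExposed ℝ P A) (hB : IsExposed ℝ P B) (hC : IsExposed ℝ P C) (hAB : A ⊂ B)
    (hBC : B ⊂ C) : ∃ W, IsExposed ℝ P W ∧ A ⊂ W ∧ W ⊂ C ∧ W ≠ B := by
  rcases A.eq_empty_or_nonempty with rfl | hne
  · obtain ⟨W, hW, hWne, hWC, hWB⟩ :=
      exists_isExposed_ssubset_ne hPc hP hC (Set.nonempty_of_ssubset' hAB) hBC
    exact ⟨W, hW, Set.empty_ssubset.2 hWne, hWC, hWB⟩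
  · exact exists_isExposed_between_ne_of_nonempty hP hA hB hC hne hAB hBC

/-- Rotating about `A` from `b` towards any `y ∈ B` ends in a face between `A` and `B`, which must
be `A` itself; then `y` lies on a line through `b` and a point of the affine hull of `A`. -/
theorem vectorSpan_le_of_forall_not_between (hP : IsPolyhedron P) (hB : IsExposed ℝ P B)
    (haA : a ∈ faceAt P a) (hAB : faceAt P a ⊂ B) (hbB : b ∈ B) (hbA : b ∉ faceAt P a)
    (hno : ∀ W, IsExposed ℝ P W → faceAt P a ⊂ W → ¬ W ⊂ B) :
    vectorSpan ℝ B ≤ Submodule.span ℝ {b - a} ⊔ vectorSpan ℝ (faceAt P a) := by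
  have haP : a ∈ P := haA.1
  have hbP := hB.subset hbB
  rw [vectorSpan_eq_span_vsub_set_right ℝ (hAB.subset haA), Submodule.span_le]
  rintro _ ⟨y, hy, rfl⟩
  by_cases hyA : y ∈ faceAt P a
  · exact Submodule.mem_sup_right (vsub_mem_vectorSpan ℝ hyA haA)
  obtain ⟨s, -, t, ht, z, hz, hzdef, hAz, hyz⟩ :=
    hP.exists_faceAt_notMem haP hbP (hB.subset hy) hyA
  have hzB : z ∈ B := (mem_iff_mem_of_eq_add_smul hB (hAB.subset haA) hy hbP hz ht.ne' hzdef).2 hbB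
  have hzA : z ∈ faceAt P a := by
    by_contra hzA
    exact hno _ (hP.isExposed_faceAt hz) (hAz.ssubset_of_ne fun h => hzA (h ▸ mem_faceAt_self hz))
      ((faceAt_subset_of_isExtreme hB.isExtreme hzB).ssubset_of_ne fun h => hyz (h ▸ hy))
  have hs : s ≠ 0 := by
    rintro rfl
    exact hbA ((mem_iff_mem_of_eq_add_smul (s := 0) (hP.isExposed_faceAt haP) haA haA hbP hz ht.ne'
      (by simpa using hzdef)).1 hzA)
  have hya : y - a = s⁻¹ • (b - a) - (t * s)⁻¹ • (z - a) := by
    rw [hzdef]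
    match_scalars <;> field_simp <;> ring
  change y - a ∈ _
  rw [hya]
  exact Submodule.sub_mem _
    (Submodule.mem_sup_left (Submodule.smul_mem _ _ (Submodule.mem_span_singleton_self _)))
    (Submodule.mem_sup_right (Submodule.smul_mem _ _ (vsub_mem_vectorSpan ℝ hzA haA)))

theorem exists_isExposed_between (hP : IsPolyhedron P) (hA : IsExposed ℝ P A)
    (hB : IsExposed ℝ P B) (hne : A.Nonempty) (hAB : A ⊂ B) (hdim : affDim A + 2 ≤ affDim B) :
    ∃ W, IsExposed ℝ P W ∧ A ⊂ W ∧ W ⊂ B := by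
  by_contra! hno
  obtain ⟨a, haA, rfl⟩ := hP.exists_eq_faceAt_of_isExposed hA hne
  obtain ⟨b, hbB, hbA⟩ := Set.exists_of_ssubset hAB
  have hle := Submodule.finrank_mono
    (vectorSpan_le_of_forall_not_between hP hB haA hAB hbB hbA hno)
  have hadd := Submodule.finrank_add_le_finrank_add_finrank (Submodule.span ℝ {b - a})
    (vectorSpan ℝ (faceAt P a))
  have hline : Module.finrank ℝ (Submodule.span ℝ {b - a}) ≤ 1 := by
    simpa using finrank_span_le_card (R := ℝ) ({b - a} : Set (E d))
  unfold affDim at hdim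
  omega

theorem exists_isExposed_affDim_add_one (hP : IsPolyhedron P) (hB : IsExposed ℝ P B)
    (hA : IsExposed ℝ P A) (hne : A.Nonempty) (hAB : A ⊂ B) :
    ∃ W, IsExposed ℝ P W ∧ A ⊆ W ∧ W ⊂ B ∧ affDim W + 1 = affDim B := by
  induction hk : affDim B - affDim A using Nat.strong_induction_on generalizing A with
  | _ k ih =>
    have hlt := affDim_lt_of_ssubset hA hB.subset hne hAB
    by_cases h : affDim A + 1 = affDim B
    · exact ⟨A, hA, subset_rfl, hAB, h⟩
    obtain ⟨W, hW, hAW, hWB⟩ := exists_isExposed_between hP hA hB hne hAB (by omega)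
    have hAW_lt := affDim_lt_of_ssubset hA hW.subset hne hAW
    obtain ⟨V, hV, hWV, hVB, hdim⟩ := ih _ (by omega) hW (hne.mono hAW.subset) hWB rfl
    exact ⟨V, hV, hAW.subset.trans hWV, hVB, hdim⟩

end FaceLattice

/-- A strictly increasing sequence of `n + 1` non-empty exposed faces of `P`. When `n = dim P`,
this is a flag of `P` without its empty face. -/
@[ext]
structure FaceChain {V : Type*} [AddCommGroup V] [TopologicalSpace V] [Module ℝ V] (n : ℕ)
    (P : Set V) where
  face : Fin (n + 1) → Set V
  exposed : ∀ j, IsExposed ℝ P (face j)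
  nonempty_zero : (face 0).Nonempty
  strictMono : StrictMono face

namespace FaceChain

section General

variable {V : Type*} [AddCommGroup V] [TopologicalSpace V] [Module ℝ V] {n : ℕ} {P : Set V}

theorem nonempty (F : FaceChain n P) (j : Fin (n + 1)) : (F.face j).Nonempty :=
  F.nonempty_zero.mono (F.strictMono.monotone (Fin.zero_le j))

theorem subset (F : FaceChain n P) (j : Fin (n + 1)) : F.face j ⊆ P := (F.exposed j).subset

theorem face_castSucc_ssubset (F : FaceChain n P) (m : Fin n) :
    F.face m.castSucc ⊂ F.face m.succ :=
  F.strictMono Fin.castSucc_lt_succ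

theorem face_castSucc_ssubset_top (F : FaceChain n P) (m : Fin n) : F.face m.castSucc ⊂ P :=
  (F.face_castSucc_ssubset m).trans_subset (F.subset _)

theorem affDim_strictMono [FiniteDimensional ℝ V] (F : FaceChain n P) :
    StrictMono fun j => affDim (F.face j) :=
  fun i j hij => affDim_lt_of_ssubset (F.exposed i) (F.subset j) (F.nonempty i)
    (F.strictMono hij)

theorem le_affDim [FiniteDimensional ℝ V] (F : FaceChain n P) (j : Fin (n + 1)) :
    (j : ℕ) ≤ affDim (F.face j) := by
  induction j using Fin.induction with
  | zero => simp
  | succ i ih =>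
    have := F.affDim_strictMono (Fin.castSucc_lt_succ (i := i))
    simp only [Fin.val_castSucc, Fin.val_succ] at ih this ⊢
    omega

theorem affDim_add_le [FiniteDimensional ℝ V] (F : FaceChain n P) (j : Fin (n + 1)) :
    affDim (F.face j) + (n - j) ≤ affDim (F.face (Fin.last n)) := by
  induction j using Fin.reverseInduction with
  | last => simp
  | cast i ih =>
    have := F.affDim_strictMono (Fin.castSucc_lt_succ (i := i))
    simp only [Fin.val_castSucc, Fin.val_succ] at ih this ⊢
    omega

theorem affDim_face [FiniteDimensional ℝ V] (hdim : affDim P ≤ n) (F : FaceChain n P)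
    (j : Fin (n + 1)) : affDim (F.face j) = j := by
  have hlow := F.le_affDim j
  have hhigh := F.affDim_add_le j
  have htop : affDim (F.face (Fin.last n)) ≤ affDim P :=
    Submodule.finrank_mono (vectorSpan_mono ℝ (F.subset _))
  omega

theorem face_last [FiniteDimensional ℝ V] (hdim : affDim P ≤ n) (F : FaceChain n P) :
    F.face (Fin.last n) = P := by
  by_contra hne
  have hlt := affDim_lt_of_ssubset (F.exposed (Fin.last n)) subset_rfl (F.nonempty _)
    ((F.subset _).ssubset_of_ne hne)
  have hlow := F.le_affDim (Fin.last n)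
  rw [Fin.val_last] at hlow
  omega

/-- The one-term chain. -/
def single (A : Set V) (hA : IsExposed ℝ P A) (hne : A.Nonempty) : FaceChain 0 P where
  face _ := A
  exposed _ := hA
  nonempty_zero := hne
  strictMono := Subsingleton.strictMono (α := Fin 1) _

/-- The chain prolonged by a larger face. -/
def snoc (F : FaceChain n P) (B : Set V) (hB : IsExposed ℝ P B)
    (hlt : F.face (Fin.last n) ⊂ B) : FaceChain (n + 1) P where
  face := Fin.snoc (α := fun _ => Set V) F.face B
  exposed j := by
    induction j using Fin.lastCases with
    | last => simpa using hB
    | cast j => simpa using F.exposed j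
  nonempty_zero := by
    rw [← Fin.castSucc_zero, Fin.snoc_castSucc]
    exact F.nonempty_zero
  strictMono := by
    rw [Fin.strictMono_iff_lt_succ]
    intro i
    rw [Fin.snoc_castSucc]
    induction i using Fin.lastCases with
    | last => rwa [Fin.succ_last, Fin.snoc_last]
    | cast i =>
      rw [Fin.succ_castSucc, Fin.snoc_castSucc]
      exact F.face_castSucc_ssubset i

section Snoc

variable (F : FaceChain n P) {B : Set V} (hB : IsExposed ℝ P B) (hlt : F.face (Fin.last n) ⊂ B)

theorem snoc_face_castSucc (j : Fin (n + 1)) : (F.snoc B hB hlt).face j.castSucc = F.face j :=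
  Fin.snoc_castSucc (α := fun _ => Set V) ..

theorem snoc_face_zero : (F.snoc B hB hlt).face 0 = F.face 0 :=
  F.snoc_face_castSucc hB hlt 0

theorem snoc_face_last : (F.snoc B hB hlt).face (Fin.last (n + 1)) = B :=
  Fin.snoc_last (α := fun _ => Set V) ..

end Snoc

open Classical in
/-- The chain with its `m`-th face replaced by `W`. -/
def replace (F : FaceChain n P) (m : Fin n) (W : Set V) (hW : IsExposed ℝ P W)
    (hne : W.Nonempty) (hlt : ∀ i < m.castSucc, F.face i ⊂ W) (hgt : W ⊂ F.face m.succ) :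
    FaceChain n P where
  face := Function.update F.face m.castSucc W
  exposed j := by
    rcases eq_or_ne j m.castSucc with rfl | h
    · simpa using hW
    · simpa [h] using F.exposed j
  nonempty_zero := by
    rcases eq_or_ne 0 m.castSucc with h | h
    · rw [h]
      simpa using hne
    · simpa [h] using F.nonempty_zero
  strictMono := by
    intro i j hij
    rcases eq_or_ne i m.castSucc with rfl | hi
    · rw [Function.update_self, Function.update_of_ne hij.ne']
      exact hgt.trans_le (F.strictMono.monotone (Fin.castSucc_lt_iff_succ_le.1 hij))
    · rcases eq_or_ne j m.castSucc with rfl | hj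
      · rw [Function.update_self, Function.update_of_ne hi]
        exact hlt i hij
      · rw [Function.update_of_ne hi, Function.update_of_ne hj]
        exact F.strictMono hij

theorem exists_isExposed_predecessor (F : FaceChain n P) (m : Fin n) :
    ∃ A, IsExposed ℝ P A ∧ A ⊂ F.face m.castSucc ∧ ∀ i < m.castSucc, F.face i ⊆ A := by
  rcases Fin.eq_zero_or_eq_succ m.castSucc with hm | ⟨p, hp⟩
  · exact ⟨∅, isExposed_empty, Set.empty_ssubset.2 (F.nonempty _),
      fun i hi => absurd (hm ▸ hi) (Fin.not_lt_zero i)⟩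
  · refine ⟨F.face p.castSucc, F.exposed _, hp ▸ F.face_castSucc_ssubset p, fun i hi => ?_⟩
    rw [hp, ← Fin.le_castSucc_iff] at hi
    exact F.strictMono.monotone hi

theorem exists_mem_face_notMem (F : FaceChain n P) (j : Fin (n + 1)) :
    ∃ x ∈ F.face j, ∀ i < j, x ∉ F.face i := by
  rcases Fin.eq_zero_or_eq_succ j with rfl | ⟨p, rfl⟩
  · obtain ⟨x, hx⟩ := F.nonempty_zero
    exact ⟨x, hx, fun i hi => absurd hi (Fin.not_lt_zero i)⟩
  · obtain ⟨x, hx, hxp⟩ := Set.exists_of_ssubset (F.face_castSucc_ssubset p)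
    exact ⟨x, hx, fun i hi hxi => hxp (F.strictMono.monotone (Fin.le_castSucc_iff.2 hi) hxi)⟩

end General

section Polyhedron

variable {d n : ℕ} {P : Set (E d)}

theorem finite (hP : IsPolyhedron P) : Finite (FaceChain n P) := by
  have := hP.finite_isExposed.to_subtype
  let f : FaceChain n P → Fin (n + 1) → {F | IsExposed ℝ P F} := fun F j => ⟨F.face j, F.exposed j⟩
  refine Finite.of_injective f fun F G h => FaceChain.ext (funext fun j => ?_)
  exact congrArg Subtype.val (congrFun h j)

theorem exists_adjacent (hPc : IsCompact P) (hP : IsPolyhedron P) (F : FaceChain n P)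
    (m : Fin n) : ∃ G : FaceChain n P, G.face m.castSucc ≠ F.face m.castSucc ∧
      ∀ j ≠ m.castSucc, G.face j = F.face j := by
  obtain ⟨A, hA, hAm, hAge⟩ := F.exists_isExposed_predecessor m
  obtain ⟨W, hW, hAW, hWm, hne⟩ := exists_isExposed_between_ne hPc hP hA (F.exposed m.castSucc)
    (F.exposed m.succ) hAm (F.face_castSucc_ssubset m)
  refine ⟨F.replace m W hW (Set.nonempty_of_ssubset' hAW)
    (fun i hi => (hAge i hi).trans_ssubset hAW) hWm, ?_, fun j hj => Function.update_of_ne hj ..⟩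
  exact ne_of_eq_of_ne (Function.update_self ..) hne

theorem exists_face_zero_eq_face_last_eq (hP : IsPolyhedron P) {A : Set (E d)}
    (hA : IsExposed ℝ P A) (hne : A.Nonempty) : ∀ (k : ℕ) {B : Set (E d)}, IsExposed ℝ P B →
    A ⊆ B → affDim B = affDim A + k →
      ∃ F : FaceChain k P, F.face 0 = A ∧ F.face (Fin.last k) = B
  | 0, B, hB, hAB, hdim => by
    have heq : A = B := by
      by_contra h
      have := affDim_lt_of_ssubset hA hB.subset hne (hAB.ssubset_of_ne h)
      omega
    exact ⟨single A hA hne, rfl, heq⟩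
  | k + 1, B, hB, hAB, hdim => by
    have hAB' : A ⊂ B := hAB.ssubset_of_ne (by rintro rfl; omega)
    obtain ⟨W, hW, hAW, hWB, hWdim⟩ := exists_isExposed_affDim_add_one hP hB hA hne hAB'
    obtain ⟨F, hF0, hFl⟩ := exists_face_zero_eq_face_last_eq hP hA hne k hW hAW (by omega)
    exact ⟨F.snoc B hB (hFl ▸ hWB), by rw [snoc_face_zero, hF0], snoc_face_last ..⟩

end Polyhedron

end FaceChain

section Coordinates

variable {d : ℕ} {k j : Fin d} {P : Set (E d)} {x : E d}

theorem e_apply (k j : Fin d) : (e k : E d) j = if j = k then 1 else 0 := by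
  simp [e]

theorem e_apply_self (k : Fin d) : (e k : E d) k = 1 := by simp [e_apply]

theorem e_apply_of_ne (h : j ≠ k) : (e k : E d) j = 0 := by simp [e_apply, h]

theorem inner_e_left (k : Fin d) (x : E d) : ⟪e k, x⟫ = x k := by
  simp [e, EuclideanSpace.inner_single_left]

theorem linearIndependent_e : LinearIndependent ℝ (e : Fin d → E d) := by
  have he : (e : Fin d → E d) = (EuclideanSpace.basisFun (Fin d) ℝ).toBasis := by
    ext k
    simp [e]
  rw [he]
  exact Module.Basis.linearIndependent _

theorem eq_sum_smul_e (x : E d) : x = ∑ k, x k • e k := by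
  ext j
  simp [e_apply]

theorem map_eq_sum (l : StrongDual ℝ (E d)) (x : E d) : l x = ∑ k, x k * l (e k) := by
  conv_lhs => rw [eq_sum_smul_e x]
  simp

/-- The orthogonal projection along the `k`-th coordinate axis. -/
noncomputable def coordProj (k : Fin d) (x : E d) : E d := x - x k • e k

theorem coordProj_apply_self (k : Fin d) (x : E d) : coordProj k x k = 0 := by
  simp [coordProj, e_apply]

theorem coordProj_apply_of_ne (h : j ≠ k) (x : E d) : coordProj k x j = x j := by
  simp [coordProj, e_apply, h]

theorem coordProj_of_eq_zero (h : x k = 0) : coordProj k x = x := by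
  simp [coordProj, h]

theorem coordProj_add_smul_e (hx : x k = 0) (r : ℝ) : coordProj k (x + r • e k) = x := by
  simp [coordProj, e_apply_self, hx]

theorem coordProj_comm (j k : Fin d) (x : E d) :
    coordProj j (coordProj k x) = coordProj k (coordProj j x) := by
  rcases eq_or_ne j k with rfl | h
  · rfl
  · rw [coordProj, coordProj_apply_of_ne h, coordProj, coordProj, coordProj_apply_of_ne h.symm,
      coordProj]
    abel

theorem map_coordProj (l : StrongDual ℝ (E d)) (k : Fin d) (x : E d) :
    l (coordProj k x) = l x - x k * l (e k) := by
  simp [coordProj]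

theorem sub_sum_smul_e_mem (hP : ∀ j, Set.MapsTo (coordProj j) P P) (hx : x ∈ P)
    (S : Finset (Fin d)) : x - ∑ k ∈ S, x k • e k ∈ P := by
  classical
  induction S using Finset.induction_on with
  | empty => simpa using hx
  | insert a S ha ih =>
    have hxa : (x - ∑ k ∈ S, x k • e k) a = x a := by simp [e_apply, ha]
    have hproj := hP a ih
    rw [coordProj, hxa] at hproj
    rwa [Finset.sum_insert ha, add_comm, ← sub_sub]

theorem sum_smul_e_mem (hP : ∀ j, Set.MapsTo (coordProj j) P P) (hx : x ∈ P)
    (S : Finset (Fin d)) : ∑ k ∈ S, x k • e k ∈ P := by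
  classical
  have hsplit : x - ∑ k ∈ Sᶜ, x k • e k = ∑ k ∈ S, x k • e k := by
    rw [sub_eq_iff_eq_add, Finset.sum_add_sum_compl]
    exact eq_sum_smul_e x
  exact hsplit ▸ sub_sum_smul_e_mem hP hx Sᶜ

theorem IsPolyhedron.inter_coord (hP : IsPolyhedron P) (i : Fin d) :
    IsPolyhedron (P ∩ {x | x i = 0}) := by
  classical
  obtain ⟨H, rfl⟩ := hP
  refine ⟨insert (e i, 0) (insert (-e i, 0) H), ?_⟩
  ext x
  simp only [Set.mem_inter_iff, Set.mem_ofPred_eq, Finset.mem_insert, forall_eq_or_imp,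
    inner_neg_left, inner_e_left, neg_nonpos, le_antisymm_iff]
  tauto

end Coordinates

/-- A locally anti-blocking polytope that spans the coordinate subspace with coordinates `ι k` and
has the origin in its relative interior. -/
structure IsAntiBlockingAlong {d n : ℕ} (ι : Fin n → Fin d) (P : Set (E d)) : Prop where
  injective : Function.Injective ι
  isCompact : IsCompact P
  isPolyhedron : IsPolyhedron P
  nonempty : P.Nonempty
  apply_eq_zero : ∀ x ∈ P, ∀ j, j ∉ Set.range ι → x j = 0
  mapsTo_coordProj : ∀ j, Set.MapsTo (coordProj j) P P
  exists_pos : ∀ k, ∃ x ∈ P, 0 < x (ι k)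
  exists_neg : ∀ k, ∃ x ∈ P, x (ι k) < 0

namespace IsAntiBlockingAlong

section Basic

variable {d n : ℕ} {ι : Fin n → Fin d} {P : Set (E d)} {x : E d}

theorem smul_e_mem (hP : IsAntiBlockingAlong ι P) (hx : x ∈ P) (k : Fin d) : x k • e k ∈ P := by
  simpa using sum_smul_e_mem hP.mapsTo_coordProj hx {k}

theorem zero_mem (hP : IsAntiBlockingAlong ι P) : (0 : E d) ∈ P := by
  simpa using sum_smul_e_mem hP.mapsTo_coordProj hP.nonempty.some_mem ∅

theorem map_eq_sum (hP : IsAntiBlockingAlong ι P) (l : StrongDual ℝ (E d)) (hx : x ∈ P) :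
    l x = ∑ k, x (ι k) * l (e (ι k)) := by
  classical
  rw [FlagPolytope.map_eq_sum, ← Finset.sum_image (f := fun j => x j * l (e j))
    (s := Finset.univ) (g := ι) hP.injective.injOn]
  refine (Finset.sum_subset (Finset.subset_univ _) fun j _ hj => ?_).symm
  rw [hP.apply_eq_zero x hx j (by simpa using hj), zero_mul]

theorem map_eq_zero_of_nonpos (hP : IsAntiBlockingAlong ι P) {l : StrongDual ℝ (E d)}
    (hl : ∀ x ∈ P, l x ≤ 0) (hx : ∀ j, j ∉ Set.range ι → x j = 0) : l x = 0 := by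
  have hle : ∀ k, l (e (ι k)) = 0 := by
    intro k
    obtain ⟨y, hy, hyk⟩ := hP.exists_pos k
    obtain ⟨z, hz, hzk⟩ := hP.exists_neg k
    have hly := hl _ (hP.smul_e_mem hy (ι k))
    have hlz := hl _ (hP.smul_e_mem hz (ι k))
    rw [map_smul, smul_eq_mul] at hly hlz
    exact le_antisymm (nonpos_of_mul_nonpos_right hly hyk) (nonneg_of_mul_nonpos_right hlz hzk)
  rw [FlagPolytope.map_eq_sum]
  refine Finset.sum_eq_zero fun k _ => ?_
  by_cases hk : k ∈ Set.range ι
  · obtain ⟨k, rfl⟩ := hk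
    rw [hle, mul_zero]
  · rw [hx k hk, zero_mul]

theorem pos_of_ssubset (hP : IsAntiBlockingAlong ι P) {l : StrongDual ℝ (E d)} {M : ℝ}
    (hl : ∀ x ∈ P, l x ≤ M) (hlt : {x ∈ P | l x = M} ⊂ P) : 0 < M := by
  have hM : 0 ≤ M := map_zero l ▸ hl 0 hP.zero_mem
  refine hM.lt_of_ne fun h => hlt.ne ?_
  subst h
  exact Set.sep_eq_self_iff_mem_true.2 fun x hx =>
    hP.map_eq_zero_of_nonpos hl (hP.apply_eq_zero x hx)

theorem exists_smul_mem (hP : IsAntiBlockingAlong ι P) {w : E d}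
    (hw : ∀ j, j ∉ Set.range ι → w j = 0) : ∃ η > (0 : ℝ), η • w ∈ P := by
  obtain ⟨H, hH⟩ := hP.isPolyhedron
  have hmem : ∀ {x}, x ∈ P ↔ x ∈ polyhedron H := by simp [hH, polyhedron]
  obtain ⟨η, hη, hηw⟩ := isFeasibleDir_of_forall_activeAt (u := w) (hmem.1 hP.zero_mem)
    fun h hh => by
      obtain ⟨hhH, hh0⟩ := mem_activeAt.1 hh
      refine (hP.map_eq_zero_of_nonpos (l := innerSL ℝ h.1) (fun x hx => ?_) hw).le
      exact (hmem.1 hx h hhH).trans_eq (hh0 ▸ inner_zero_right _)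
  exact ⟨η, hη, hmem.2 (by simpa using hηw)⟩

theorem affDim_eq (hP : IsAntiBlockingAlong ι P) : affDim P = n := by
  have hspan : vectorSpan ℝ P = Submodule.span ℝ (Set.range (e ∘ ι)) := by
    rw [vectorSpan_eq_span_vsub_set_right ℝ hP.zero_mem]
    refine le_antisymm (Submodule.span_le.2 ?_) (Submodule.span_le.2 ?_)
    · rintro _ ⟨x, hx, rfl⟩
      change x - 0 ∈ _
      rw [sub_zero, eq_sum_smul_e x]
      refine Submodule.sum_mem _ fun j _ => ?_
      by_cases hj : j ∈ Set.range ι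
      · obtain ⟨k, rfl⟩ := hj
        exact Submodule.smul_mem _ _ (Submodule.subset_span ⟨k, rfl⟩)
      · rw [hP.apply_eq_zero x hx j hj, zero_smul]
        exact Submodule.zero_mem _
    · rintro _ ⟨k, rfl⟩
      obtain ⟨x, hx, hxk⟩ := hP.exists_pos k
      exact (Submodule.smul_mem_iff _ hxk.ne').1
        (Submodule.subset_span ⟨_, hP.smul_e_mem hx (ι k), sub_zero _⟩)
  rw [affDim, hspan, finrank_span_eq_card (linearIndependent_e.comp ι hP.injective),
    Fintype.card_fin]

end Basic

theorem inter_coord {d n : ℕ} {ι : Fin (n + 1) → Fin d} {P : Set (E d)}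
    (hP : IsAntiBlockingAlong ι P) :
    IsAntiBlockingAlong (ι ∘ Fin.castSucc) (P ∩ {x | x (ι (Fin.last n)) = 0}) where
  injective := hP.injective.comp (Fin.castSucc_injective n)
  isCompact := hP.isCompact.inter_right (isClosed_eq (by fun_prop) continuous_const)
  isPolyhedron := hP.isPolyhedron.inter_coord _
  nonempty := ⟨0, hP.zero_mem, by simp⟩
  apply_eq_zero := by
    rintro x ⟨hx, hx0⟩ j hj
    by_cases hjr : j ∈ Set.range ι
    · obtain ⟨k, rfl⟩ := hjr
      induction k using Fin.lastCases with
      | last => exact hx0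
      | cast k => exact absurd ⟨k, rfl⟩ hj
    · exact hP.apply_eq_zero x hx j hjr
  mapsTo_coordProj := by
    rintro j x ⟨hx, hx0⟩
    refine ⟨hP.mapsTo_coordProj j hx, ?_⟩
    rcases eq_or_ne (ι (Fin.last n)) j with rfl | h
    · exact coordProj_apply_self _ _
    · exact (coordProj_apply_of_ne h x).trans hx0
  exists_pos k := by
    obtain ⟨x, hx, hxk⟩ := hP.exists_pos k.castSucc
    exact ⟨_, ⟨hP.mapsTo_coordProj _ hx, coordProj_apply_self _ _⟩,
      hxk.trans_eq (coordProj_apply_of_ne (hP.injective.ne (Fin.castSucc_ne_last k)) x).symm⟩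
  exists_neg k := by
    obtain ⟨x, hx, hxk⟩ := hP.exists_neg k.castSucc
    exact ⟨_, ⟨hP.mapsTo_coordProj _ hx, coordProj_apply_self _ _⟩,
      (coordProj_apply_of_ne (hP.injective.ne (Fin.castSucc_ne_last k)) x).trans_lt hxk⟩

end IsAntiBlockingAlong

section FaceSign

variable {d : ℕ} {k : Fin d} {P F G : Set (E d)} {x y z : E d}

/-- `F` is parallel to the `k`-th coordinate axis. For a face `F` of a polytope that is stable
under `coordProj k`, one point of `F` suffices to see this. -/
def IsHigh (k : Fin d) (F : Set (E d)) : Prop := ∃ x ∈ F, x k ≠ 0 ∧ coordProj k x ∈ F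

/-- `F` is contained in the `k`-th coordinate hyperplane. -/
def IsLow (k : Fin d) (F : Set (E d)) : Prop := ∀ x ∈ F, x k = 0

open Classical in
/-- The sign of the `k`-th coordinate on `F` if `F` is neither contained in the coordinate
hyperplane nor parallel to the coordinate axis, and `0` otherwise. -/
noncomputable def faceSign (k : Fin d) (F : Set (E d)) : ℤ :=
  if h : (∃ x ∈ F, x k ≠ 0) ∧ ¬ IsHigh k F then (SignType.sign (h.1.choose k) : ℤ) else 0

theorem IsHigh.mono (h : IsHigh k F) (hFG : F ⊆ G) : IsHigh k G := by
  obtain ⟨x, hx, hxk, hproj⟩ := h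
  exact ⟨x, hFG hx, hxk, hFG hproj⟩

theorem IsLow.mono (h : IsLow k G) (hFG : F ⊆ G) : IsLow k F := fun x hx => h x (hFG hx)

theorem sign_cast_ne_zero {r : ℝ} (h : r ≠ 0) : (SignType.sign r : ℤ) ≠ 0 := by
  rcases lt_or_gt_of_ne h with h | h <;> simp [h]

theorem sign_cast_eq_of_mul_pos {a b : ℝ} (h : 0 < a * b) :
    (SignType.sign a : ℤ) = SignType.sign b := by
  rcases pos_and_pos_or_neg_and_neg_of_mul_pos h with ⟨h1, h2⟩ | ⟨h1, h2⟩ <;> simp [h1, h2]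

theorem exists_of_faceSign_ne_zero (h : faceSign k F ≠ 0) :
    ∃ x ∈ F, x k ≠ 0 ∧ faceSign k F = SignType.sign (x k) ∧ ¬ IsHigh k F := by
  unfold faceSign at h ⊢
  split_ifs at h ⊢ with h'
  · exact ⟨_, h'.1.choose_spec.1, h'.1.choose_spec.2, rfl, h'.2⟩
  · exact absurd rfl h

theorem faceSign_eq_zero_iff : faceSign k F = 0 ↔ IsHigh k F ∨ IsLow k F := by
  constructor
  · intro h
    by_contra! ⟨hhigh, hlow⟩
    have hex : ∃ x ∈ F, x k ≠ 0 := by simpa [IsLow] using hlow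
    rw [faceSign, dif_pos ⟨hex, hhigh⟩] at h
    exact sign_cast_ne_zero hex.choose_spec.2 h
  · intro h
    by_contra hne
    obtain ⟨x, hx, hxk, -, hhigh⟩ := exists_of_faceSign_ne_zero hne
    exact hxk (h.resolve_left hhigh x hx)

theorem faceSign_of_isHigh (h : IsHigh k F) : faceSign k F = 0 := faceSign_eq_zero_iff.2 (.inl h)

theorem faceSign_of_isLow (h : IsLow k F) : faceSign k F = 0 := faceSign_eq_zero_iff.2 (.inr h)

theorem faceSign_mul_self (h : faceSign k F ≠ 0) : faceSign k F * faceSign k F = 1 := by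
  obtain ⟨x, -, hxk, hsign, -⟩ := exists_of_faceSign_ne_zero h
  rw [hsign]
  rcases lt_or_gt_of_ne hxk with h | h <;> simp [h]

theorem IsHigh.map_eq_zero {l : StrongDual ℝ (E d)} {M : ℝ} (h : IsHigh k {x ∈ P | l x = M}) :
    l (e k) = 0 := by
  obtain ⟨x, hx, hxk, hproj⟩ := h
  have heq := hproj.2
  rw [map_coordProj, hx.2, sub_eq_self] at heq
  exact (mul_eq_zero.1 heq).resolve_left hxk

theorem IsHigh.coordProj_mem_iff (hF : IsExposed ℝ P F) (h : IsHigh k F) (hx : x ∈ P)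
    (hproj : coordProj k x ∈ P) : coordProj k x ∈ F ↔ x ∈ F := by
  obtain ⟨l, M, -, rfl⟩ := exists_support_of_isExposed hF (h.imp fun _ => And.left)
  simp [hx, hproj, map_coordProj, h.map_eq_zero]

theorem mul_map_e_pos (hP : Set.MapsTo (coordProj k) P P) {l : StrongDual ℝ (E d)} {M : ℝ}
    (hl : ∀ x ∈ P, l x ≤ M) (h : ¬ IsHigh k {x ∈ P | l x = M}) (hx : x ∈ {x ∈ P | l x = M})
    (hxk : x k ≠ 0) : 0 < x k * l (e k) := by
  have hle := hl _ (hP hx.1)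
  have hne : l (coordProj k x) ≠ M := fun heq => h ⟨x, hx, hxk, hP hx.1, heq⟩
  have hlt := hle.lt_of_ne hne
  rw [map_coordProj, hx.2] at hlt
  linarith

theorem mul_pos_of_not_isHigh (hP : Set.MapsTo (coordProj k) P P) (hF : IsExposed ℝ P F)
    (h : ¬ IsHigh k F) (hx : x ∈ F) (hy : y ∈ F) (hxk : x k ≠ 0) (hyk : y k ≠ 0) :
    0 < x k * y k := by
  obtain ⟨l, M, hl, rfl⟩ := exists_support_of_isExposed hF ⟨x, hx⟩
  have hpos := mul_pos (mul_map_e_pos hP hl h hx hxk) (mul_map_e_pos hP hl h hy hyk)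
  rw [mul_mul_mul_comm] at hpos
  exact pos_of_mul_pos_left hpos (mul_self_nonneg _)

theorem coordProj_notMem_of_mul_pos (hP : Set.MapsTo (coordProj k) P P) (hF : IsExposed ℝ P F)
    (h : ¬ IsHigh k F) (hx : x ∈ P) (hz : z ∈ F) (hxz : 0 < x k * z k) : coordProj k x ∉ F := by
  intro hproj
  obtain ⟨l, M, hl, rfl⟩ := exists_support_of_isExposed hF ⟨z, hz⟩
  have hzl := mul_map_e_pos hP hl h hz fun h0 => by simp [h0] at hxz
  have hxl : x k * l (e k) ≤ 0 := by
    have := hproj.2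
    rw [map_coordProj] at this
    linarith [hl x hx]
  have hl0 : l (e k) ≠ 0 := right_ne_zero_of_mul hzl.ne'
  have hpos : 0 < x k * z k * (l (e k) * l (e k)) := mul_pos hxz (mul_self_pos.2 hl0)
  nlinarith

theorem faceSign_eq_sign (hP : Set.MapsTo (coordProj k) P P) (hF : IsExposed ℝ P F)
    (h : ¬ IsHigh k F) (hx : x ∈ F) (hxk : x k ≠ 0) : faceSign k F = SignType.sign (x k) := by
  obtain ⟨y, hy, hyk, hsign, -⟩ := exists_of_faceSign_ne_zero (k := k) (F := F) fun h0 =>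
    (faceSign_eq_zero_iff.1 h0).elim h fun hlow => hxk (hlow x hx)
  exact hsign.trans (sign_cast_eq_of_mul_pos (mul_pos_of_not_isHigh hP hF h hy hx hyk hxk))

theorem faceSign_eq_of_subset (hP : Set.MapsTo (coordProj k) P P) (hG : IsExposed ℝ P G)
    (hFG : F ⊆ G) (hF0 : faceSign k F ≠ 0) (hG0 : faceSign k G ≠ 0) :
    faceSign k F = faceSign k G := by
  obtain ⟨x, hx, hxk, hsign, -⟩ := exists_of_faceSign_ne_zero hF0
  obtain ⟨-, -, -, -, hhigh⟩ := exists_of_faceSign_ne_zero hG0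
  rw [hsign, faceSign_eq_sign hP hG hhigh (hFG hx) hxk]

end FaceSign

namespace FaceChain

section Transversal

variable {V : Type*} [AddCommGroup V] [TopologicalSpace V] [Module ℝ V] {n : ℕ} {P : Set V}
  {F G : FaceChain n P} {m : Fin n} {c : Fin (n + 1) → V} {x y : V}

/-- A sequence of points `c j`, one in each successive difference of the faces of the chain: its
determinant in homogeneous coordinates orients the chain. -/
def IsTransversal (F : FaceChain n P) (c : Fin (n + 1) → V) : Prop :=
  ∀ i j, c j ∈ F.face i ↔ j ≤ i

theorem exists_isTransversal (F : FaceChain n P) : ∃ c, F.IsTransversal c := by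
  choose c hc hlt using F.exists_mem_face_notMem
  refine ⟨c, fun i j => ⟨fun h => ?_, fun h => F.strictMono.monotone h (hc j)⟩⟩
  by_contra! hij
  exact hlt j i hij h

theorem exists_mem_notMem_of_face_ne [FiniteDimensional ℝ V] (hdim : affDim P ≤ n)
    {j : Fin (n + 1)} (hne : F.face j ≠ G.face j) : ∃ x ∈ F.face j, x ∉ G.face j := by
  by_contra! hsub
  have hlt := affDim_lt_of_ssubset (F.exposed j) (G.subset j) (F.nonempty j)
    (LE.le.ssubset_of_ne hsub hne)
  rw [F.affDim_face hdim, G.affDim_face hdim] at hlt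
  exact lt_irrefl _ hlt

/-- The segment between `F.face m \ G.face m` and `G.face m \ F.face m` crosses from one chain to
the other inside their common next face, so that its midpoint serves both transversals. -/
theorem isTransversal_update_midpoint [IsTopologicalAddGroup V] [ContinuousSMul ℝ V]
    (hP : Convex ℝ P) (hFG : ∀ j ≠ m.castSucc, G.face j = F.face j)
    (hc : ∀ i ≠ m.castSucc, ∀ j ≠ m.castSucc, c j ∈ F.face i ↔ j ≤ i)
    (hxF : x ∈ F.face m.castSucc) (hxG : x ∉ G.face m.castSucc) (hyG : y ∈ G.face m.castSucc)
    (hyF : y ∉ F.face m.castSucc) : F.IsTransversal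
      (Function.update (Function.update c m.succ (midpoint ℝ x y)) m.castSucc x) := by
  have hlt : m.castSucc < m.succ := Fin.castSucc_lt_succ
  have hmid : midpoint ℝ x y ∈ F.face m.succ :=
    ((F.exposed _).convex hP).midpoint_mem ((F.face_castSucc_ssubset m).subset hxF)
      (hFG _ hlt.ne' ▸ (G.face_castSucc_ssubset m).subset hyG)
  have hmid_not : midpoint ℝ x y ∉ F.face m.castSucc := fun h =>
    hyF ((F.exposed _).isExtreme.right_mem_of_mem_openSegment (F.subset _ hxF) (G.subset _ hyG) h
      ⟨1 / 2, 1 / 2, by norm_num, by norm_num, by norm_num, by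
        rw [midpoint_eq_smul_add, smul_add, one_div, invOf_eq_inv]⟩)
  intro i j
  rcases eq_or_ne j m.castSucc with rfl | hj
  · rw [Function.update_self]
    refine ⟨fun h => ?_, fun h => F.strictMono.monotone h hxF⟩
    by_contra! hi
    exact hxG (G.strictMono.monotone hi.le (hFG i hi.ne ▸ h))
  rw [Function.update_of_ne hj]
  rcases eq_or_ne j m.succ with rfl | hj'
  · rw [Function.update_self]
    refine ⟨fun h => ?_, fun h => F.strictMono.monotone h hmid⟩
    by_contra! hi
    exact hmid_not (F.strictMono.monotone (Fin.le_castSucc_iff.2 hi) h)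
  rw [Function.update_of_ne hj']
  rcases eq_or_ne i m.castSucc with rfl | hi
  · constructor <;> intro h
    · have hle := (hc _ hlt.ne' j hj).1 ((F.face_castSucc_ssubset m).subset h)
      exact Fin.le_castSucc_iff.2 (hle.lt_of_ne hj')
    · exact F.strictMono.monotone h ((hc j hj j hj).2 le_rfl)
  · exact hc i hi j hj

end Transversal

end FaceChain

section PointMatrix

variable {d n : ℕ}

/-- The homogeneous coordinates of a point with respect to the coordinates `ι k`. -/
def homog (ι : Fin n → Fin d) (x : E d) : Fin (n + 1) → ℝ := Fin.cons 1 fun k => x (ι k)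

/-- The matrix of the homogeneous coordinates of a sequence of points. -/
def pointMatrix (ι : Fin n → Fin d) (c : Fin (n + 1) → E d) :
    Matrix (Fin (n + 1)) (Fin (n + 1)) ℝ := Matrix.of fun j => homog ι (c j)

theorem pointMatrix_update (ι : Fin n → Fin d) (c : Fin (n + 1) → E d) (j : Fin (n + 1))
    (x : E d) :
    pointMatrix ι (Function.update c j x) = (pointMatrix ι c).updateRow j (homog ι x) := by
  ext i k
  rcases eq_or_ne i j with rfl | h
  · simp [pointMatrix]
  · simp [pointMatrix, h]

theorem homog_add_homog (ι : Fin n → Fin d) (x y : E d) :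
    homog ι x + homog ι y = (2 : ℝ) • homog ι (midpoint ℝ x y) := by
  ext k
  refine Fin.cases ?_ (fun k => ?_) k
  · simp only [homog, Pi.add_apply, Pi.smul_apply, Fin.cons_zero, smul_eq_mul]
    norm_num
  · simp only [homog, midpoint_eq_smul_add, Pi.add_apply, Pi.smul_apply, Fin.cons_succ,
      PiLp.add_apply, PiLp.smul_apply, smul_eq_mul, mul_inv_cancel_left₀, invOf_eq_inv, ne_eq,
      OfNat.ofNat_ne_zero, not_false_eq_true]

theorem det_pointMatrix_update_eq_neg (ι : Fin n → Fin d) {c : Fin (n + 1) → E d}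
    {i j : Fin (n + 1)} (hij : i ≠ j) {x y : E d} (hi : c i = midpoint ℝ x y) :
    (pointMatrix ι (Function.update c j y)).det =
      -(pointMatrix ι (Function.update c j x)).det := by
  have hzero : ((pointMatrix ι c).updateRow j (homog ι (midpoint ℝ x y))).det = 0 :=
    hi ▸ Matrix.det_updateRow_eq_zero hij
  rw [eq_neg_iff_add_eq_zero, pointMatrix_update, pointMatrix_update, ← Matrix.det_updateRow_add,
    add_comm (homog ι y), homog_add_homog, Matrix.det_updateRow_smul, hzero, mul_zero]

end PointMatrix

namespace FaceChain

section Orientation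

variable {d n : ℕ} {ι : Fin n → Fin d} {P : Set (E d)} {F G : FaceChain n P} {m : Fin n}

theorem exists_homog_dotProduct_pos (hP : IsAntiBlockingAlong ι P) (F : FaceChain n P)
    (j : Fin (n + 1)) :
    ∃ y : Fin (n + 1) → ℝ, (∀ i < j, ∀ x ∈ F.face i, homog ι x ⬝ᵥ y = 0) ∧
      ∀ x ∈ P, (∀ i < j, x ∉ F.face i) → 0 < homog ι x ⬝ᵥ y := by
  rcases Fin.eq_zero_or_eq_succ j with rfl | ⟨p, rfl⟩
  · refine ⟨Fin.cons 1 0, fun i hi => absurd hi (Fin.not_lt_zero i), fun x _ _ => ?_⟩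
    simp [homog, dotProduct, Fin.sum_univ_succ]
  · obtain ⟨l, M, hl, hface⟩ := exists_support_of_isExposed (F.exposed p.castSucc) (F.nonempty _)
    have hdot : ∀ x ∈ P,
        homog ι x ⬝ᵥ (Fin.cons M fun k => -l (e (ι k)) : Fin (n + 1) → ℝ) = M - l x := by
      intro x hx
      rw [hP.map_eq_sum l hx]
      simp [homog, dotProduct, Fin.sum_univ_succ, sub_eq_add_neg]
    refine ⟨Fin.cons M fun k => -l (e (ι k)), fun i hi x hx => ?_, fun x hx hxi => ?_⟩
    · have hxp := F.strictMono.monotone (Fin.le_castSucc_iff.2 hi) hx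
      rw [hface] at hxp
      rw [hdot x hxp.1, hxp.2, sub_self]
    · rw [hdot x hx, sub_pos]
      refine (hl x hx).lt_of_ne fun h => hxi p.castSucc Fin.castSucc_lt_succ ?_
      exact hface ▸ ⟨hx, h⟩

/-- The dual vectors of the chain form a matrix that every transversal makes triangular. -/
theorem exists_det_mul_pos (hP : IsAntiBlockingAlong ι P) (F : FaceChain n P) :
    ∃ r : ℝ, ∀ c, F.IsTransversal c → 0 < (pointMatrix ι c).det * r := by
  choose y hzero hpos using F.exists_homog_dotProduct_pos hP
  let Y : Matrix (Fin (n + 1)) (Fin (n + 1)) ℝ := Matrix.of fun k j => y j k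
  refine ⟨Y.det, fun c hc => ?_⟩
  have hentry : ∀ i j, (pointMatrix ι c * Y) i j = homog ι (c i) ⬝ᵥ y j := fun i j => rfl
  have htri : (pointMatrix ι c * Y).BlockTriangular OrderDual.toDual := fun i j hij =>
    hzero j i hij _ ((hc i i).2 le_rfl)
  rw [← Matrix.det_mul, Matrix.det_of_isLowerTriangular _ htri]
  refine Finset.prod_pos fun j _ => ?_
  rw [hentry]
  exact hpos j _ (F.subset _ ((hc j j).2 le_rfl)) fun i hi h => hi.not_ge ((hc i j).1 h)

/-- The orientation of a chain: the sign of the determinant of the homogeneous coordinates of any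
transversal, see `orient_eq`. -/
noncomputable def orient (ι : Fin n → Fin d) (F : FaceChain n P) : ℤ :=
  (SignType.sign (pointMatrix ι F.exists_isTransversal.choose).det : SignType)

theorem orient_eq (hP : IsAntiBlockingAlong ι P) {c : Fin (n + 1) → E d}
    (hc : F.IsTransversal c) : F.orient ι = SignType.sign (pointMatrix ι c).det := by
  obtain ⟨r, hr⟩ := F.exists_det_mul_pos hP
  have hpos := mul_pos (hr _ F.exists_isTransversal.choose_spec) (hr c hc)
  rw [mul_mul_mul_comm] at hpos
  exact sign_cast_eq_of_mul_pos (pos_of_mul_pos_left hpos (mul_self_nonneg r))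

theorem orient_ne_zero (hP : IsAntiBlockingAlong ι P) (F : FaceChain n P) : F.orient ι ≠ 0 := by
  obtain ⟨r, hr⟩ := F.exists_det_mul_pos hP
  obtain ⟨c, hc⟩ := F.exists_isTransversal
  rw [orient_eq hP hc]
  exact sign_cast_ne_zero (left_ne_zero_of_mul (hr c hc).ne')

theorem abs_orient (hP : IsAntiBlockingAlong ι P) (F : FaceChain n P) : |F.orient ι| = 1 := by
  have hne := F.orient_ne_zero hP
  unfold orient at hne ⊢
  generalize SignType.sign (pointMatrix ι F.exists_isTransversal.choose).det = σ at hne ⊢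
  cases σ <;> simp_all

theorem orient_eq_neg_of_adjacent (hP : IsAntiBlockingAlong ι P)
    (hne : G.face m.castSucc ≠ F.face m.castSucc)
    (hFG : ∀ j ≠ m.castSucc, G.face j = F.face j) : G.orient ι = -F.orient ι := by
  have hdim := hP.affDim_eq.le
  obtain ⟨x, hxF, hxG⟩ := exists_mem_notMem_of_face_ne hdim hne.symm
  obtain ⟨y, hyG, hyF⟩ := exists_mem_notMem_of_face_ne hdim hne
  obtain ⟨c, hc⟩ := F.exists_isTransversal
  have hcF := isTransversal_update_midpoint hP.isPolyhedron.convex hFG (fun i _ j _ => hc i j)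
    hxF hxG hyG hyF
  have hcG := isTransversal_update_midpoint hP.isPolyhedron.convex
    (fun j hj => (hFG j hj).symm) (fun i hi j _ => by rw [hFG i hi, hc i j]) hyG hyF hxF hxG
  rw [midpoint_comm] at hcG
  rw [orient_eq hP hcF, orient_eq hP hcG, det_pointMatrix_update_eq_neg ι
    (Fin.castSucc_lt_succ (i := m)).ne' (Function.update_self ..), Left.sign_neg]
  simp

theorem eq_of_orient_eq (hP : IsAntiBlockingAlong ι P)
    (hFG : ∀ j ≠ m.castSucc, G.face j = F.face j) (h : G.orient ι = F.orient ι) : G = F := by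
  refine FaceChain.ext (funext fun j => ?_)
  rcases eq_or_ne j m.castSucc with rfl | hj
  · by_contra hne
    have hneg := orient_eq_neg_of_adjacent hP hne hFG
    have := F.orient_ne_zero hP
    omega
  · exact hFG j hj

/-- The chain adjacent to `F` that differs from `F` in the `m`-th face only. -/
noncomputable def swap (hP : IsAntiBlockingAlong ι P) (F : FaceChain n P) (m : Fin n) :
    FaceChain n P :=
  (F.exists_adjacent hP.isCompact hP.isPolyhedron m).choose

theorem swap_face_of_ne (hP : IsAntiBlockingAlong ι P) (F : FaceChain n P) (m : Fin n)
    {j : Fin (n + 1)} (hj : j ≠ m.castSucc) : (F.swap hP m).face j = F.face j :=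
  (F.exists_adjacent hP.isCompact hP.isPolyhedron m).choose_spec.2 j hj

theorem orient_swap (hP : IsAntiBlockingAlong ι P) (F : FaceChain n P) (m : Fin n) :
    (F.swap hP m).orient ι = -F.orient ι :=
  orient_eq_neg_of_adjacent hP (F.exists_adjacent hP.isCompact hP.isPolyhedron m).choose_spec.1
    fun _ hj => F.swap_face_of_ne hP m hj

theorem swap_ne (hP : IsAntiBlockingAlong ι P) (F : FaceChain n P) (m : Fin n) :
    F.swap hP m ≠ F := by
  intro h
  have hneg := h ▸ F.orient_swap hP m
  have := F.orient_ne_zero hP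
  omega

theorem swap_swap (hP : IsAntiBlockingAlong ι P) (F : FaceChain n P) (m : Fin n) :
    (F.swap hP m).swap hP m = F := by
  refine eq_of_orient_eq hP (m := m) (fun j hj => ?_) ?_
  · rw [swap_face_of_ne hP _ m hj, swap_face_of_ne hP _ m hj]
  · rw [orient_swap, orient_swap, neg_neg]

end Orientation

end FaceChain

section IntervalMatrix

/-- A matrix of zeros and ones in which the ones of every column are consecutive. -/
def IsIntervalMatrix {m n : ℕ} (A : Matrix (Fin m) (Fin n) ℤ) : Prop :=
  ∃ lo hi : Fin n → ℕ, ∀ i k, A i k = if lo k ≤ i ∧ (i : ℕ) < hi k then 1 else 0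

theorem abs_det_eq_of_row_zero_eq_single {n : ℕ} {A : Matrix (Fin (n + 1)) (Fin (n + 1)) ℤ}
    {k₀ : Fin (n + 1)} (hA : ∀ k, A 0 k = if k = k₀ then 1 else 0) :
    |A.det| = |(A.submatrix Fin.succ k₀.succAbove).det| := by
  have hsum := Matrix.det_succ_row_zero A
  rw [Finset.sum_eq_single k₀ (fun k _ hk => by simp [hA, hk]) (by simp), hA, if_pos rfl,
    mul_one] at hsum
  rw [hsum, abs_mul, abs_pow, abs_neg, abs_one, one_pow, one_mul]

/-- Subtracting the shortest of the columns that start in the first row from the other ones leaves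
an interval matrix whose first row has a single entry. -/
theorem IsIntervalMatrix.exists_abs_det_eq {n : ℕ} {A : Matrix (Fin (n + 1)) (Fin (n + 1)) ℤ}
    (hA : IsIntervalMatrix A) (hdet : A.det ≠ 0) :
    ∃ B : Matrix (Fin n) (Fin n) ℤ, IsIntervalMatrix B ∧ |A.det| = |B.det| := by
  classical
  obtain ⟨lo, hi, hA⟩ := hA
  let S := Finset.univ.filter fun k => lo k = 0 ∧ 0 < hi k
  have hS : S.Nonempty := by
    by_contra! hempty
    refine hdet (Matrix.det_eq_zero_of_row_eq_zero 0 fun k => ?_)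
    have hk : k ∉ S := by simp [hempty]
    simpa [hA, S] using hk
  obtain ⟨k₀, hk₀, hmin⟩ := S.exists_min_image hi hS
  simp only [S, Finset.mem_filter, Finset.mem_univ, true_and] at hk₀ hmin
  let coeff : Fin (n + 1) → ℤ := fun k => if k ≠ k₀ ∧ lo k = 0 ∧ 0 < hi k then -1 else 0
  let B : Matrix (Fin (n + 1)) (Fin (n + 1)) ℤ := Matrix.of fun m k => A m k + coeff k * A m k₀
  have hdetB : B.det = A.det := by
    rw [← Matrix.det_transpose B, ← Matrix.det_transpose A]
    exact Matrix.det_eq_of_forall_row_eq_smul_add_const coeff k₀ (by simp [coeff]) fun _ _ => rfl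
  have hrow : ∀ k, B 0 k = if k = k₀ then 1 else 0 := by
    intro k
    have hk : B 0 k = (if lo k = 0 ∧ 0 < hi k then 1 else 0) + coeff k := by
      simp [B, hA, hk₀]
    rw [hk]
    grind
  refine ⟨B.submatrix Fin.succ k₀.succAbove,
    ⟨fun j => if lo (k₀.succAbove j) = 0 ∧ 0 < hi (k₀.succAbove j) then hi k₀ - 1
      else lo (k₀.succAbove j) - 1, fun j => hi (k₀.succAbove j) - 1, fun i j => ?_⟩,
    hdetB ▸ abs_det_eq_of_row_zero_eq_single hrow⟩
  have hne := k₀.succAbove_ne j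
  have hle := hmin (k₀.succAbove j)
  simp only [Matrix.submatrix_apply, B, Matrix.of_apply, hA, coeff, Fin.val_succ, hne, ne_eq,
    not_false_eq_true, true_and]
  grind

theorem IsIntervalMatrix.abs_det_le_one {n : ℕ} {A : Matrix (Fin n) (Fin n) ℤ}
    (hA : IsIntervalMatrix A) : |A.det| ≤ 1 := by
  induction n with
  | zero => simp
  | succ n ih =>
    by_cases hdet : A.det = 0
    · simp [hdet]
    · obtain ⟨B, hB, heq⟩ := hA.exists_abs_det_eq hdet
      exact heq ▸ ih hB

theorem exists_forall_iff_lt {n : ℕ} {p : Fin n → Prop} (hp : Antitone p) :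
    ∃ r : ℕ, ∀ m : Fin n, p m ↔ (m : ℕ) < r := by
  classical
  have hex : ∃ r : ℕ, ∀ m : Fin n, r ≤ m → ¬p m := ⟨n, fun m hm => absurd m.is_lt hm.not_gt⟩
  refine ⟨Nat.find hex, fun m => ⟨fun h => ?_, fun h => ?_⟩⟩
  · by_contra! hle
    exact Nat.find_spec hex m hle h
  · obtain ⟨j, hj, hpj⟩ : ∃ j : Fin n, m ≤ j ∧ p j := by simpa using Nat.find_min hex h
    exact hp hj hpj

end IntervalMatrix

section Adjugate

variable {R ι : Type*} [CommRing R] [Fintype ι] [DecidableEq ι] {c q : ι} {τ s : R}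

theorem sum_adjugate_mul (A : Matrix ι ι R) (q k : ι) :
    ∑ m, A.adjugate q m * A m k = if q = k then A.det else 0 := by
  rw [← Matrix.mul_apply, A.adjugate_mul, Matrix.smul_apply, Matrix.one_apply, smul_eq_mul,
    mul_ite, mul_one, mul_zero]

theorem sum_adjugate_eq_zero [NoZeroDivisors R] {A : Matrix ι ι R} (hτ : τ ≠ 0)
    (hc : ∀ m, A m c = τ) (hcq : q ≠ c) : ∑ m, A.adjugate q m = 0 := by
  have hsum := sum_adjugate_mul A q c
  simp_rw [hc, ← Finset.sum_mul, if_neg hcq] at hsum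
  exact (mul_eq_zero.1 hsum).resolve_right hτ

/-- The numbers of further zeros in the column `q` are the multiplicities in which the sub-flags
occur in the signed count. They may be added as the rows of the adjugate sum to zero. -/
theorem det_eq_sum_adjugate [NoZeroDivisors R] [DecidableEq R] {A : Matrix ι ι R} (hτ : τ ≠ 0)
    (hc : ∀ m, A m c = τ) (hA : ∀ m, A m q ≠ 0 → A m q = s) :
    A.det = ∑ m, s * A.adjugate q m * (1 + ({j | j ≠ m ∧ A j q = 0} : Finset ι).card) := by
  let Z : Finset ι := {j | A j q = 0}
  have hterm : ∀ m, s * A.adjugate q m * (1 + ({j | j ≠ m ∧ A j q = 0} : Finset ι).card) =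
      s * Z.card * A.adjugate q m + A.adjugate q m * A m q := by
    intro m
    have herase : ({j | j ≠ m ∧ A j q = 0} : Finset ι) = Z.erase m := by
      ext j
      simp [Z]
    rw [herase]
    by_cases h : A m q = 0
    · rw [← Finset.card_erase_add_one (show m ∈ Z by simp [Z, h]), h]
      push_cast
      ring
    · rw [Finset.erase_eq_of_notMem (by simp [Z, h]), hA m h]
      ring
  have hzero : s * Z.card * ∑ m, A.adjugate q m = 0 := by
    rcases eq_or_ne q c with rfl | hqc
    · simp [Z, hc, hτ]
    · rw [sum_adjugate_eq_zero hτ hc hqc, mul_zero]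
  rw [Finset.sum_congr rfl fun m _ => hterm m, Finset.sum_add_distrib, ← Finset.mul_sum, hzero,
    zero_add, sum_adjugate_mul, if_pos rfl]

end Adjugate

theorem abs_faceSign_le {d : ℕ} (k : Fin d) (G : Set (E d)) : |faceSign k G| ≤ 1 := by
  by_cases h : faceSign k G = 0
  · simp [h]
  · exact (abs_eq_abs.2 (mul_self_eq_one_iff.1 (faceSign_mul_self h))).trans_le (by simp)

namespace FaceChain

section SignMatrix

variable {d n : ℕ} {P : Set (E d)} {ι : Fin n → Fin d}

/-- The matrix of the signs of the proper faces of a chain. -/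
noncomputable def signMatrix (ι : Fin n → Fin d) (F : FaceChain n P) : Matrix (Fin n) (Fin n) ℤ :=
  Matrix.of fun m k => faceSign (ι k) (F.face m.castSucc)

theorem signMatrix_apply (ι : Fin n → Fin d) (F : FaceChain n P) (m k : Fin n) :
    F.signMatrix ι m k = faceSign (ι k) (F.face m.castSucc) := rfl

theorem signMatrix_eq_of_ne_zero (hP : ∀ j, Set.MapsTo (coordProj j) P P) (F : FaceChain n P)
    {m m' k : Fin n} (h : F.signMatrix ι m k ≠ 0) (h' : F.signMatrix ι m' k ≠ 0) :
    F.signMatrix ι m k = F.signMatrix ι m' k := by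
  rcases le_total m m' with hle | hle
  · exact faceSign_eq_of_subset (hP _) (F.exposed _) (F.strictMono.monotone hle) h h'
  · exact (faceSign_eq_of_subset (hP _) (F.exposed _) (F.strictMono.monotone hle) h' h).symm

theorem exists_signMatrix_eq_of_ne_zero (hP : ∀ j, Set.MapsTo (coordProj j) P P)
    (F : FaceChain n P) (k : Fin n) :
    ∃ σ : ℤ, |σ| ≤ 1 ∧ ∀ m, F.signMatrix ι m k ≠ 0 → F.signMatrix ι m k = σ := by
  by_cases! h : ∃ m, F.signMatrix ι m k ≠ 0
  · obtain ⟨m, hm⟩ := h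
    exact ⟨F.signMatrix ι m k, abs_faceSign_le _ _, fun m' hm' =>
      F.signMatrix_eq_of_ne_zero hP hm' hm⟩
  · exact ⟨0, by simp, fun m hm => absurd (h m) hm⟩

/-- As the faces of the chain grow they first are low, then signed, and then high in any given
coordinate. -/
theorem exists_isIntervalMatrix_signMatrix (hP : ∀ j, Set.MapsTo (coordProj j) P P)
    (F : FaceChain n P) : ∃ (σ : Fin n → ℤ) (B : Matrix (Fin n) (Fin n) ℤ), (∀ k, |σ k| ≤ 1) ∧
      IsIntervalMatrix B ∧ F.signMatrix ι = Matrix.of fun m k => σ k * B m k := by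
  classical
  have hlo : ∀ k, ∃ r : ℕ, ∀ m : Fin n, IsLow (ι k) (F.face m.castSucc) ↔ (m : ℕ) < r := fun k =>
    exists_forall_iff_lt fun i j hij h => h.mono (F.strictMono.monotone hij)
  have hhi : ∀ k, ∃ r : ℕ, ∀ m : Fin n, ¬IsHigh (ι k) (F.face m.castSucc) ↔ (m : ℕ) < r :=
    fun k => exists_forall_iff_lt fun i j hij h h' => h (h'.mono (F.strictMono.monotone hij))
  choose lo hlo using hlo
  choose hi hhi using hhi
  choose σ hσ_le hσ using F.exists_signMatrix_eq_of_ne_zero (ι := ι) hP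
  refine ⟨σ, Matrix.of fun m k => if lo k ≤ m ∧ (m : ℕ) < hi k then 1 else 0, hσ_le,
    ⟨lo, hi, fun _ _ => rfl⟩, ?_⟩
  ext m k
  have hiff : F.signMatrix ι m k = 0 ↔ ¬(lo k ≤ m ∧ (m : ℕ) < hi k) := by
    rw [signMatrix_apply, faceSign_eq_zero_iff, hlo, ← hhi, ← not_lt]
    tauto
  simp only [Matrix.of_apply]
  split_ifs with h
  · rw [mul_one]
    exact hσ k m fun h0 => hiff.1 h0 h
  · rw [mul_zero]
    exact hiff.2 h

theorem abs_det_signMatrix_le (hP : ∀ j, Set.MapsTo (coordProj j) P P) (F : FaceChain n P) :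
    |(F.signMatrix ι).det| ≤ 1 := by
  obtain ⟨σ, B, hσ, hB, heq⟩ := F.exists_isIntervalMatrix_signMatrix (ι := ι) hP
  rw [heq, Matrix.det_mul_row, abs_mul, Finset.abs_prod]
  exact mul_le_one₀ (Finset.prod_le_one (fun _ _ => abs_nonneg _) fun k _ => hσ k)
    (abs_nonneg _) hB.abs_det_le_one

end SignMatrix

section LastSign

variable {d n : ℕ} {P : Set (E d)} {ι : Fin (n + 1) → Fin d}

theorem exists_support_pos (hP : IsAntiBlockingAlong ι P) (F : FaceChain (n + 1) P) :
    ∃ (l : StrongDual ℝ (E d)) (M : ℝ), 0 < M ∧ (∀ x ∈ P, l x ≤ M) ∧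
      F.face (Fin.last n).castSucc = {x ∈ P | l x = M} := by
  obtain ⟨l, M, hl, hface⟩ :=
    exists_support_of_isExposed (F.exposed (Fin.last n).castSucc) (F.nonempty _)
  exact ⟨l, M, hP.pos_of_ssubset hl (hface ▸ F.face_castSucc_ssubset_top _), hl, hface⟩

theorem signMatrix_eq_sign (hP : ∀ j, Set.MapsTo (coordProj j) P P) (F : FaceChain (n + 1) P)
    {v : E d} (hv : v ∈ F.face 0) {l : StrongDual ℝ (E d)} {M : ℝ}
    (hface : F.face (Fin.last n).castSucc = {x ∈ P | l x = M}) {c : Fin (n + 1)}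
    (hlc : l (e (ι c)) ≠ 0) (hvc : v (ι c) ≠ 0) (m : Fin (n + 1)) :
    F.signMatrix ι m c = SignType.sign (v (ι c)) := by
  have hle : m.castSucc ≤ (Fin.last n).castSucc := Fin.castSucc_le_castSucc_iff.2 (Fin.le_last m)
  refine faceSign_eq_sign (hP _) (F.exposed _) (fun h => hlc ?_)
    (F.strictMono.monotone (Fin.zero_le _) hv) hvc
  exact (hface ▸ h.mono (F.strictMono.monotone hle)).map_eq_zero

/-- Such a coordinate is found where both a vertex and the normal of a facet containing it do not
vanish. -/
theorem exists_signMatrix_eq_const (hP : IsAntiBlockingAlong ι P) (F : FaceChain (n + 1) P) :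
    ∃ c, ∃ τ : ℤ, τ ≠ 0 ∧ ∀ m, F.signMatrix ι m c = τ := by
  obtain ⟨v, hv⟩ := F.nonempty_zero
  obtain ⟨l, M, hM, -, hface⟩ := F.exists_support_pos hP
  have hv_facet : v ∈ F.face (Fin.last n).castSucc := F.strictMono.monotone (Fin.zero_le _) hv
  rw [hface] at hv_facet
  have hsum := hv_facet.2
  rw [hP.map_eq_sum l hv_facet.1] at hsum
  obtain ⟨c, -, hc⟩ := Finset.exists_ne_zero_of_sum_ne_zero (hsum.trans_ne hM.ne')
  have hvc : v (ι c) ≠ 0 := left_ne_zero_of_mul hc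
  exact ⟨c, _, sign_cast_ne_zero hvc,
    F.signMatrix_eq_sign hP.mapsTo_coordProj hv hface (right_ne_zero_of_mul hc) hvc⟩

open Classical in
/-- The common value of the non-zero signs of the faces of a chain in the last coordinate, and `0`
if there are none. -/
noncomputable def lastSign (ι : Fin (n + 1) → Fin d) (F : FaceChain (n + 1) P) : ℤ :=
  if h : ∃ m, F.signMatrix ι m (Fin.last n) ≠ 0 then F.signMatrix ι h.choose (Fin.last n) else 0

theorem lastSign_eq (hP : ∀ j, Set.MapsTo (coordProj j) P P) (F : FaceChain (n + 1) P)
    {m : Fin (n + 1)} (h : F.signMatrix ι m (Fin.last n) ≠ 0) :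
    F.lastSign ι = F.signMatrix ι m (Fin.last n) := by
  have hex : ∃ m, F.signMatrix ι m (Fin.last n) ≠ 0 := ⟨m, h⟩
  rw [lastSign, dif_pos hex]
  exact F.signMatrix_eq_of_ne_zero hP hex.choose_spec h

theorem lastSign_eq_zero (F : FaceChain (n + 1) P)
    (h : ∀ m, F.signMatrix ι m (Fin.last n) = 0) : F.lastSign ι = 0 :=
  dif_neg fun ⟨m, hm⟩ => hm (h m)

end LastSign

end FaceChain

section Sections

theorem isExposed_inter {V : Type*} [AddCommGroup V] [TopologicalSpace V] [Module ℝ V]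
    {P F : Set V} (hF : IsExposed ℝ P F) (Q : Set V) : IsExposed ℝ (P ∩ Q) (F ∩ Q) := by
  intro hne
  obtain ⟨l, M, hl, rfl⟩ := exists_support_of_isExposed hF (hne.mono Set.inter_subset_left)
  have heq : {x ∈ P | l x = M} ∩ Q = {x ∈ P ∩ Q | l x = M} := by
    ext x
    simp only [Set.mem_inter_iff, Set.mem_ofPred_eq]
    tauto
  rw [heq] at hne ⊢
  exact isExposed_of_forall_le l (fun x hx => hl x hx.1) hne

variable {d : ℕ} {P F : Set (E d)} {i k : Fin d}

theorem mapsTo_coordProj_of_faceSign_eq_zero (hP : Set.MapsTo (coordProj i) P P)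
    (hF : IsExposed ℝ P F) (hi : faceSign i F = 0) : Set.MapsTo (coordProj i) F F := by
  intro x hx
  rcases faceSign_eq_zero_iff.1 hi with h | h
  · exact (h.coordProj_mem_iff hF (hF.subset hx) (hP (hF.subset hx))).2 hx
  · rwa [coordProj_of_eq_zero (h x hx)]

theorem faceSign_inter (hP : ∀ j, Set.MapsTo (coordProj j) P P) (hF : IsExposed ℝ P F)
    (hi : faceSign i F = 0) (hk : k ≠ i) : faceSign k (F ∩ {x | x i = 0}) = faceSign k F := by
  have hproj : ∀ x ∈ F, coordProj i x ∈ F ∩ {x | x i = 0} := fun x hx =>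
    ⟨mapsTo_coordProj_of_faceSign_eq_zero (hP i) hF hi hx, coordProj_apply_self _ _⟩
  by_cases hhigh : IsHigh k F
  · obtain ⟨x, hx, hxk, hxF⟩ := id hhigh
    have hhigh' : IsHigh k (F ∩ {x | x i = 0}) :=
      ⟨_, hproj x hx, by rwa [coordProj_apply_of_ne hk], coordProj_comm k i x ▸ hproj _ hxF⟩
    rw [faceSign_of_isHigh hhigh, faceSign_of_isHigh hhigh']
  by_cases hlow : IsLow k F
  · rw [faceSign_of_isLow hlow, faceSign_of_isLow (hlow.mono Set.inter_subset_left)]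
  obtain ⟨x, hx, hxk⟩ : ∃ x ∈ F, x k ≠ 0 := by simpa [IsLow] using hlow
  have hxk' := coordProj_apply_of_ne hk x
  have hmaps : Set.MapsTo (coordProj k) (P ∩ {x | x i = 0}) (P ∩ {x | x i = 0}) := fun y hy =>
    ⟨hP k hy.1, (coordProj_apply_of_ne hk.symm y).trans hy.2⟩
  rw [faceSign_eq_sign (hP k) hF hhigh hx hxk, ← hxk']
  exact faceSign_eq_sign hmaps (isExposed_inter hF _)
    (fun h => hhigh (h.mono Set.inter_subset_left)) (hproj x hx) (hxk' ▸ hxk)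

end Sections

theorem det_pointMatrix_insertNth {d n : ℕ} (ι : Fin (n + 1) → Fin d) (i : Fin (n + 2)) (x : E d)
    {c : Fin (n + 1) → E d} (hc : ∀ a, c a (ι (Fin.last n)) = 0) :
    (pointMatrix ι (i.insertNth x c)).det = (-1) ^ ((i : ℕ) + (n + 1)) * x (ι (Fin.last n)) *
      (pointMatrix (ι ∘ Fin.castSucc) c).det := by
  have hlast : ∀ j, pointMatrix ι (i.insertNth x c) j (Fin.last (n + 1)) =
      (i.insertNth x c : Fin (n + 2) → E d) j (ι (Fin.last n)) := fun j => by
    rw [← Fin.succ_last]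
    rfl
  have hminor : (pointMatrix ι (i.insertNth x c)).submatrix i.succAbove
      (Fin.last (n + 1)).succAbove = pointMatrix (ι ∘ Fin.castSucc) c := by
    ext a b
    simp only [Matrix.submatrix_apply, pointMatrix, Matrix.of_apply, Fin.insertNth_apply_succAbove,
      Fin.succAbove_last]
    refine Fin.cases rfl (fun b => ?_) b
    rw [← Fin.succ_castSucc]
    rfl
  rw [Matrix.det_succ_column _ (Fin.last (n + 1)), Finset.sum_eq_single i, hlast, hminor,
    Fin.insertNth_apply_same, Fin.val_last]
  · intro j _ hj
    obtain ⟨a, rfl⟩ := Fin.exists_succAbove_eq hj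
    rw [hlast, Fin.insertNth_apply_succAbove, hc]
    simp
  · simp

namespace FaceChain

section Restrict

variable {d n : ℕ} {P : Set (E d)} {ι : Fin (n + 1) → Fin d} {F : FaceChain (n + 1) P}
  {m : Fin (n + 1)} {j : Fin (n + 2)}

/-- The `m`-th face is the only proper face of the chain with a non-zero sign in the last
coordinate. -/
def IsSole (ι : Fin (n + 1) → Fin d) (F : FaceChain (n + 1) P) (m : Fin (n + 1)) : Prop :=
  F.signMatrix ι m (Fin.last n) ≠ 0 ∧ ∀ j ≠ m, F.signMatrix ι j (Fin.last n) = 0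

theorem IsSole.not_isHigh (h : F.IsSole ι m) : ¬IsHigh (ι (Fin.last n)) (F.face m.castSucc) :=
  fun hhigh => h.1 (faceSign_of_isHigh hhigh)

theorem IsSole.faceSign_eq_zero (hP : IsAntiBlockingAlong ι P) (h : F.IsSole ι m)
    (hj : j ≠ m.castSucc) : faceSign (ι (Fin.last n)) (F.face j) = 0 := by
  induction j using Fin.lastCases with
  | last =>
    obtain ⟨x, hx, hpos⟩ := hP.exists_pos (Fin.last n)
    rw [F.face_last hP.affDim_eq.le]
    exact faceSign_of_isHigh ⟨x, hx, hpos.ne', hP.mapsTo_coordProj _ hx⟩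
  | cast j => exact h.2 j fun hjm => hj (hjm ▸ rfl)

theorem IsSole.isLow (hP : IsAntiBlockingAlong ι P) (h : F.IsSole ι m) (hj : j < m.castSucc) :
    IsLow (ι (Fin.last n)) (F.face j) :=
  (faceSign_eq_zero_iff.1 (h.faceSign_eq_zero hP hj.ne)).resolve_left fun hhigh =>
    h.not_isHigh (hhigh.mono (F.strictMono.monotone hj.le))

theorem IsSole.isHigh (hP : IsAntiBlockingAlong ι P) (h : F.IsSole ι m) (hj : m.castSucc < j) :
    IsHigh (ι (Fin.last n)) (F.face j) :=
  (faceSign_eq_zero_iff.1 (h.faceSign_eq_zero hP hj.ne')).resolve_right fun hlow =>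
    h.1 (faceSign_of_isLow (hlow.mono (F.strictMono.monotone hj.le)))

theorem IsSole.coordProj_mem (hP : IsAntiBlockingAlong ι P) (h : F.IsSole ι m)
    (hj : j ≠ m.castSucc) {x : E d} (hx : x ∈ F.face j) :
    coordProj (ι (Fin.last n)) x ∈ F.face j ∩ {x | x (ι (Fin.last n)) = 0} :=
  ⟨mapsTo_coordProj_of_faceSign_eq_zero (hP.mapsTo_coordProj _) (F.exposed j)
    (h.faceSign_eq_zero hP hj) hx, coordProj_apply_self _ _⟩

theorem IsSole.coordProj_mem_face_iff (hP : IsAntiBlockingAlong ι P) (h : F.IsSole ι m)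
    (hj : m.castSucc < j) {x : E d} (hx : x ∈ P) :
    coordProj (ι (Fin.last n)) x ∈ F.face j ↔ x ∈ F.face j :=
  (h.isHigh hP hj).coordProj_mem_iff (F.exposed j) hx (hP.mapsTo_coordProj _ hx)

theorem IsSole.exists_coordProj_mem_iff (hP : IsAntiBlockingAlong ι P) (h : F.IsSole ι m) :
    ∃ x ∈ F.face m.castSucc, x (ι (Fin.last n)) ≠ 0 ∧
      F.signMatrix ι m (Fin.last n) = SignType.sign (x (ι (Fin.last n))) ∧
      ∀ j, coordProj (ι (Fin.last n)) x ∈ F.face j ↔ m.castSucc < j := by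
  obtain ⟨x, hx, hx0, hsign, hhigh⟩ := exists_of_faceSign_ne_zero h.1
  refine ⟨x, hx, hx0, hsign, fun j => ⟨fun hxj => ?_, fun hj => ?_⟩⟩
  · by_contra! hj
    exact hhigh ⟨x, hx, hx0, F.strictMono.monotone hj hxj⟩
  · exact (h.coordProj_mem hP hj.ne' (F.strictMono.monotone hj.le hx)).1

theorem IsSole.inter_ssubset_inter (hP : IsAntiBlockingAlong ι P) (h : F.IsSole ι m)
    {p q : Fin (n + 2)} (hpq : p < q) (hp : p ≠ m.castSucc) (hq : q ≠ m.castSucc) :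
    F.face p ∩ {x | x (ι (Fin.last n)) = 0} ⊂ F.face q ∩ {x | x (ι (Fin.last n)) = 0} := by
  suffices hex : ∃ y ∈ F.face q, coordProj (ι (Fin.last n)) y ∉ F.face p by
    obtain ⟨y, hy, hyp⟩ := hex
    exact ⟨Set.inter_subset_inter_left _ (F.strictMono.monotone hpq.le),
      fun hle => hyp (hle (h.coordProj_mem hP hq hy)).1⟩
  obtain ⟨y, hy, hyp⟩ := Set.exists_of_ssubset (F.strictMono hpq)
  rcases lt_or_gt_of_ne hq with hqm | hmq
  · exact ⟨y, hy, by rwa [coordProj_of_eq_zero (h.isLow hP hqm y hy)]⟩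
  rcases lt_or_gt_of_ne hp with hpm | hmp
  · obtain ⟨x, hx, -, -, hiff⟩ := h.exists_coordProj_mem_iff hP
    exact ⟨x, F.strictMono.monotone hmq.le hx, fun hxp => hpm.not_gt ((hiff p).1 hxp)⟩
  · exact ⟨y, hy, fun hproj => hyp ((h.coordProj_mem_face_iff hP hmp (F.subset _ hy)).1 hproj)⟩

/-- The chain that `F` induces on the section with the last coordinate hyperplane: the `m`-th face
is dropped. -/
def restrict (hP : IsAntiBlockingAlong ι P) (F : FaceChain (n + 1) P) (m : Fin (n + 1))
    (h : F.IsSole ι m) : FaceChain n (P ∩ {x | x (ι (Fin.last n)) = 0}) where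
  face a := F.face (m.castSucc.succAbove a) ∩ {x | x (ι (Fin.last n)) = 0}
  exposed _ := isExposed_inter (F.exposed _) _
  nonempty_zero := by
    obtain ⟨x, hx⟩ := F.nonempty (m.castSucc.succAbove 0)
    exact ⟨_, h.coordProj_mem hP (Fin.succAbove_ne _ _) hx⟩
  strictMono _ _ hab := h.inter_ssubset_inter hP (Fin.strictMono_succAbove _ hab)
    (Fin.succAbove_ne _ _) (Fin.succAbove_ne _ _)

theorem restrict_face (hP : IsAntiBlockingAlong ι P) (h : F.IsSole ι m) (a : Fin (n + 1)) :
    (F.restrict hP m h).face a =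
      F.face (m.castSucc.succAbove a) ∩ {x | x (ι (Fin.last n)) = 0} := rfl

theorem signMatrix_restrict (hP : IsAntiBlockingAlong ι P) (h : F.IsSole ι m) :
    (F.restrict hP m h).signMatrix (ι ∘ Fin.castSucc) =
      (F.signMatrix ι).submatrix m.succAbove Fin.castSucc := by
  ext j k
  rw [Matrix.submatrix_apply, signMatrix_apply, signMatrix_apply, restrict_face,
    Fin.castSucc_succAbove_castSucc]
  exact faceSign_inter hP.mapsTo_coordProj (F.exposed _) (h.2 _ (Fin.succAbove_ne m j))
    fun hk => (Fin.castSucc_lt_last k).ne (hP.injective hk)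

/-- A transversal of the restriction is extended by a point `x` of the dropped face, after its
`m`-th point has been replaced by the projection of `x`. -/
theorem exists_isTransversal_restrict (hP : IsAntiBlockingAlong ι P) (h : F.IsSole ι m) :
    ∃ (x : E d) (c : Fin (n + 1) → E d),
      F.signMatrix ι m (Fin.last n) = SignType.sign (x (ι (Fin.last n))) ∧
      (F.restrict hP m h).IsTransversal c ∧ F.IsTransversal (m.castSucc.insertNth x c) := by
  obtain ⟨x, hx, hx0, hsign, hiff⟩ := h.exists_coordProj_mem_iff hP
  obtain ⟨c₀, hc₀⟩ := (F.restrict hP m h).exists_isTransversal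
  let c : Fin (n + 1) → E d := Function.update c₀ m (coordProj (ι (Fin.last n)) x)
  have hc : (F.restrict hP m h).IsTransversal c := by
    intro a b
    rcases eq_or_ne b m with rfl | hb
    · simp only [c, Function.update_self, restrict_face, Set.mem_inter_iff, hiff,
        Set.mem_ofPred_eq, coordProj_apply_self, and_true, Fin.lt_succAbove_iff_le_castSucc,
        Fin.castSucc_le_castSucc_iff]
    · simp only [c, Function.update_of_ne hb, hc₀ a b]
  have hc_face : ∀ a b, c b ∈ F.face (m.castSucc.succAbove a) ↔ b ≤ a := fun a b => by
    rw [← hc a b, restrict_face, Set.mem_inter_iff, and_iff_left ((hc b b).2 le_rfl).2]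
  have hc_sole : ∀ b, c b ∈ F.face m.castSucc ↔ m.castSucc.succAbove b ≤ m.castSucc := by
    intro b
    rcases eq_or_ne b m with rfl | hb
    · simp [c, hiff]
    refine ⟨fun hmem => ?_, fun hle => F.strictMono.monotone hle ((hc_face b b).2 le_rfl)⟩
    have hle : b ≤ m := (hc_face m b).1 <| by
      rw [Fin.succAbove_castSucc_self]
      exact (F.face_castSucc_ssubset m).subset hmem
    exact (Fin.succAbove_lt_iff_castSucc_lt _ _).2 (hle.lt_of_ne hb) |>.le
  refine ⟨x, c, hsign, hc, fun i j => ?_⟩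
  rcases Fin.eq_self_or_eq_succAbove m.castSucc j with rfl | ⟨b, rfl⟩
  · rw [Fin.insertNth_apply_same]
    refine ⟨fun hxi => ?_, fun hi => F.strictMono.monotone hi hx⟩
    by_contra! hi
    exact hx0 (h.isLow hP hi x hxi)
  · rw [Fin.insertNth_apply_succAbove]
    rcases Fin.eq_self_or_eq_succAbove m.castSucc i with rfl | ⟨a, rfl⟩
    · exact hc_sole b
    · rw [Fin.succAbove_le_succAbove_iff, hc_face]

theorem orient_restrict (hP : IsAntiBlockingAlong ι P) (h : F.IsSole ι m) :
    F.orient ι = (-1) ^ ((m : ℕ) + (n + 1)) * F.signMatrix ι m (Fin.last n) *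
      (F.restrict hP m h).orient (ι ∘ Fin.castSucc) := by
  obtain ⟨x, c, hsign, hc, hcF⟩ := exists_isTransversal_restrict hP h
  rw [orient_eq hP hcF, orient_eq hP.inter_coord hc, hsign,
    det_pointMatrix_insertNth ι _ x fun a => ((hc a a).2 le_rfl).2, sign_mul, sign_mul, sign_pow,
    Left.sign_neg, sign_one]
  simp

end Restrict

section Weight

variable {d n : ℕ} {P : Set (E d)}

/-- The signed contribution of a chain to the count `abs_sum_weight`. -/
noncomputable def weight (ι : Fin n → Fin d) (F : FaceChain n P) : ℤ :=
  F.orient ι * (F.signMatrix ι).det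

variable {ι : Fin (n + 1) → Fin d} {F : FaceChain (n + 1) P} {m : Fin (n + 1)}

/-- The summands in the expansion of `F.weight ι` given by `det_eq_sum_adjugate`. -/
noncomputable def weightTerm (ι : Fin (n + 1) → Fin d) (F : FaceChain (n + 1) P)
    (m : Fin (n + 1)) : ℤ :=
  F.orient ι * (F.lastSign ι * (F.signMatrix ι).adjugate (Fin.last n) m *
    (1 + ({j | j ≠ m ∧ F.signMatrix ι j (Fin.last n) = 0} : Finset (Fin (n + 1))).card))

theorem weight_eq_sum_weightTerm (hP : IsAntiBlockingAlong ι P) (F : FaceChain (n + 1) P) :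
    F.weight ι = ∑ m, F.weightTerm ι m := by
  obtain ⟨c, τ, hτ, hc⟩ := F.exists_signMatrix_eq_const hP
  simp only [weight, weightTerm, ← Finset.mul_sum]
  congr 1
  exact det_eq_sum_adjugate hτ hc fun m hm => (F.lastSign_eq hP.mapsTo_coordProj hm).symm

theorem weightTerm_of_isSole (hP : IsAntiBlockingAlong ι P) (h : F.IsSole ι m) :
    F.weightTerm ι m = -(n + 1) * (F.restrict hP m h).weight (ι ∘ Fin.castSucc) := by
  have hfilter : ({j | j ≠ m ∧ F.signMatrix ι j (Fin.last n) = 0} : Finset (Fin (n + 1))) =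
      Finset.univ.erase m := by
    ext j
    simpa using h.2 j
  have hsign : F.signMatrix ι m (Fin.last n) * F.signMatrix ι m (Fin.last n) = 1 :=
    faceSign_mul_self h.1
  have hpow : (-1 : ℤ) ^ ((m : ℕ) + (n + 1)) * (-1) ^ ((m : ℕ) + n) = -1 := by
    rw [← pow_add]
    exact Odd.neg_one_pow ⟨(m : ℕ) + n, by ring⟩
  rw [weightTerm, weight, hfilter, Finset.card_erase_of_mem (Finset.mem_univ _), Finset.card_univ,
    Fintype.card_fin, add_tsub_cancel_right, F.lastSign_eq hP.mapsTo_coordProj h.1,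
    orient_restrict hP h, signMatrix_restrict, Matrix.adjugate_fin_succ_eq_det_submatrix,
    Fin.succAbove_last, Fin.val_last]
  linear_combination (n + 1) * (F.restrict hP m h).orient (ι ∘ Fin.castSucc) *
    ((F.signMatrix ι).submatrix m.succAbove Fin.castSucc).det *
    ((-1) ^ ((m : ℕ) + (n + 1)) * (-1) ^ ((m : ℕ) + n) * hsign + hpow)

theorem weightTerm_eq_zero (h : ∀ j, F.signMatrix ι j (Fin.last n) = 0) : F.weightTerm ι m = 0 := by
  rw [weightTerm, F.lastSign_eq_zero h, zero_mul, zero_mul, mul_zero]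

theorem signMatrix_swap (hP : IsAntiBlockingAlong ι P) (F : FaceChain (n + 1) P)
    {j : Fin (n + 1)} (hj : j ≠ m) (k : Fin (n + 1)) :
    (F.swap hP m).signMatrix ι j k = F.signMatrix ι j k := by
  rw [signMatrix_apply, signMatrix_apply, F.swap_face_of_ne hP m
    fun h => hj (Fin.castSucc_injective _ h)]

theorem weightTerm_swap (hP : IsAntiBlockingAlong ι P) {j : Fin (n + 1)} (hj : j ≠ m)
    (hj0 : F.signMatrix ι j (Fin.last n) ≠ 0) :
    (F.swap hP m).weightTerm ι m = -F.weightTerm ι m := by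
  have hj0' : (F.swap hP m).signMatrix ι j (Fin.last n) ≠ 0 := by rwa [signMatrix_swap hP F hj]
  have hminor : ((F.swap hP m).signMatrix ι).submatrix m.succAbove (Fin.last n).succAbove =
      (F.signMatrix ι).submatrix m.succAbove (Fin.last n).succAbove := by
    ext a b
    exact signMatrix_swap hP F (Fin.succAbove_ne m a) _
  have hfilter : ({j | j ≠ m ∧ (F.swap hP m).signMatrix ι j (Fin.last n) = 0} :
      Finset (Fin (n + 1))) =
      ({j | j ≠ m ∧ F.signMatrix ι j (Fin.last n) = 0} : Finset (Fin (n + 1))) :=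
    Finset.filter_congr fun k _ => and_congr_right fun hk => by rw [signMatrix_swap hP F hk]
  rw [weightTerm, weightTerm, hfilter, orient_swap, F.lastSign_eq hP.mapsTo_coordProj hj0,
    (F.swap hP m).lastSign_eq hP.mapsTo_coordProj hj0', signMatrix_swap hP F hj,
    Matrix.adjugate_fin_succ_eq_det_submatrix, Matrix.adjugate_fin_succ_eq_det_submatrix, hminor,
    neg_mul]

open Classical in
theorem sum_weightTerm (hP : IsAntiBlockingAlong ι P) [Fintype (FaceChain (n + 1) P)]
    (m : Fin (n + 1)) : ∑ F : FaceChain (n + 1) P, F.weightTerm ι m =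
      ∑ F : FaceChain (n + 1) P, if F.IsSole ι m then F.weightTerm ι m else 0 := by
  rw [← sub_eq_zero, ← Finset.sum_sub_distrib]
  have hzero : ∀ F : FaceChain (n + 1) P, (∀ j ≠ m, F.signMatrix ι j (Fin.last n) = 0) →
      (F.weightTerm ι m - if F.IsSole ι m then F.weightTerm ι m else 0) = 0 := by
    intro F h
    split_ifs with hsole
    · exact sub_self _
    · have hm : F.signMatrix ι m (Fin.last n) = 0 := by
        by_contra hne
        exact hsole ⟨hne, h⟩
      rw [weightTerm_eq_zero fun j => (eq_or_ne j m).elim (fun hjm => hjm ▸ hm) (h j), sub_zero]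
  refine Finset.sum_involution (fun F _ => F.swap hP m) (fun F _ => ?_)
    (fun F _ _ => F.swap_ne hP m) (fun F _ => Finset.mem_univ _) (fun F _ => F.swap_swap hP m)
  by_cases! h : ∀ j ≠ m, F.signMatrix ι j (Fin.last n) = 0
  · rw [hzero F h, hzero _ fun j hj => (signMatrix_swap hP F hj _).trans (h j hj), add_zero]
  · obtain ⟨j, hj, hj0⟩ := h
    have hj0' := (signMatrix_swap hP F hj _).trans_ne hj0
    rw [if_neg fun hsole => hj0 (hsole.2 j hj), if_neg fun hsole => hj0' (hsole.2 j hj), sub_zero,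
      sub_zero, weightTerm_swap hP hj hj0, add_neg_cancel]

end Weight

end FaceChain

section ProjPreimage

variable {d : ℕ} {P A F G : Set (E d)} {k : Fin d} {σ : ℝ} {x z : E d}

/-- The part of `P` lying over a subset `F` of the section of `P` with the `k`-th coordinate
hyperplane. -/
def projPreimage (k : Fin d) (P F : Set (E d)) : Set (E d) := {x ∈ P | coordProj k x ∈ F}

theorem projPreimage_mono (h : F ⊆ G) : projPreimage k P F ⊆ projPreimage k P G :=
  fun _ hx => ⟨hx.1, h hx.2⟩

theorem subset_projPreimage (hF : F ⊆ P ∩ {x | x k = 0}) : F ⊆ projPreimage k P F :=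
  fun x hx => ⟨(hF hx).1, by rwa [coordProj_of_eq_zero (hF hx).2]⟩

theorem projPreimage_inter (hF : F ⊆ P ∩ {x | x k = 0}) :
    projPreimage k P F ∩ {x | x k = 0} = F := by
  refine subset_antisymm ?_ fun x hx => ⟨subset_projPreimage hF hx, (hF hx).2⟩
  rintro x ⟨hx, hx0⟩
  simpa only [coordProj_of_eq_zero hx0] using hx.2

theorem isExposed_projPreimage (hP : Set.MapsTo (coordProj k) P P)
    (hF : IsExposed ℝ (P ∩ {x | x k = 0}) F) : IsExposed ℝ P (projPreimage k P F) := by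
  rcases F.eq_empty_or_nonempty with rfl | hne
  · simpa [projPreimage] using isExposed_empty
  obtain ⟨l, M, hl, rfl⟩ := exists_support_of_isExposed hF hne
  let l' : StrongDual ℝ (E d) := l - l (e k) • EuclideanSpace.proj k
  have hl' : ∀ x, l' x = l (coordProj k x) := fun x => by simp [l', map_coordProj, mul_comm]
  have hsec : ∀ x ∈ P, coordProj k x ∈ P ∩ {x | x k = 0} := fun x hx =>
    ⟨hP hx, coordProj_apply_self k x⟩
  have heq : projPreimage k P {x ∈ P ∩ {x | x k = 0} | l x = M} = {x ∈ P | l' x = M} :=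
    Set.ext fun x => and_congr_right fun hx => by
      rw [hl', Set.mem_ofPred_eq, and_iff_right (hsec x hx)]
  exact heq ▸ isExposed_of_forall_le l' fun x hx => hl' x ▸ hl _ (hsec x hx)

theorem isExposed_of_forall_mul_nonpos (hP : IsPolyhedron P)
    (hproj : Set.MapsTo (coordProj k) P P) (hF : IsExposed ℝ (P ∩ {x | x k = 0}) F) (hσ : σ ≠ 0)
    (h : ∀ x ∈ projPreimage k P F, σ * x k ≤ 0) : IsExposed ℝ P F := by
  refine hP.isExposed_of_isExtreme ?_ (hF.convex (hP.inter_coord k).convex)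
  refine (isExposed_projPreimage hproj hF).isExtreme.trans ⟨subset_projPreimage hF.subset, ?_⟩
  rintro y hy z hz w hw ⟨α, β, hα, hβ, -, rfl⟩
  have hw0 : α * y k + β * z k = 0 := by simpa using (hF.subset hw).2
  have hαy : α * (σ * y k) ≤ 0 := mul_nonpos_of_nonneg_of_nonpos hα.le (h y hy)
  have hβz : β * (σ * z k) ≤ 0 := mul_nonpos_of_nonneg_of_nonpos hβ.le (h z hz)
  have hαy0 : α * (σ * y k) = 0 := hαy.antisymm (by linear_combination hβz - σ * hw0)
  have hyk : y k = 0 := by simpa [hα.ne', hσ] using hαy0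
  simpa only [coordProj_of_eq_zero hyk] using hy.2

theorem isFeasibleDir_smul_e (hz : 0 < σ * z k) (h : IsFeasibleDir P z (z - coordProj k z)) :
    IsFeasibleDir P z (σ • e k) := by
  obtain ⟨ε, hε, hmem⟩ := h
  have hσ : σ ≠ 0 := left_ne_zero_of_mul hz.ne'
  refine ⟨ε * (z k / σ), mul_pos hε ?_, ?_⟩
  · rwa [← mul_pos_iff_of_pos_left (mul_self_pos.2 hσ), mul_assoc, mul_div_cancel₀ _ hσ]
  · rwa [smul_smul, mul_assoc, div_mul_cancel₀ _ hσ, ← smul_smul, ← sub_sub_cancel z (z k • e k)]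

theorem not_isHigh_faceAt (hP : IsPolyhedron P) (hproj : Set.MapsTo (coordProj k) P P)
    (hzP : z ∈ P) (hz : 0 < σ * z k) (hdir : ¬ IsFeasibleDir P z (σ • e k)) :
    ¬ IsHigh k (faceAt P z) := fun hhigh =>
  hdir <| isFeasibleDir_smul_e hz <|
    ((hhigh.coordProj_mem_iff (hP.isExposed_faceAt hzP) hzP (hproj hzP)).2
      (mem_faceAt_self hzP)).2

theorem pos_of_forall_ray_le {s : ℝ} (hx : x ∈ P) (hxσ : 0 < σ * x k)
    (hmax : ∀ r : ℝ, coordProj k x + r • σ • e k ∈ P → r ≤ s) : 0 < s := by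
  have hσ : σ ≠ 0 := left_ne_zero_of_mul hxσ.ne'
  have hle : x k / σ ≤ s := hmax _ <| by
    rwa [smul_smul, div_mul_cancel₀ _ hσ, coordProj, sub_add_cancel]
  refine lt_of_lt_of_le ?_ hle
  rwa [← mul_pos_iff_of_pos_left (mul_self_pos.2 hσ), mul_assoc, mul_div_cancel₀ _ hσ]

theorem exists_mem_projPreimage_not_isFeasibleDir (hP : IsCompact P) (hF : F ⊆ P)
    (hx : x ∈ projPreimage k P F) (hxσ : 0 < σ * x k) :
    ∃ z ∈ projPreimage k P F, 0 < σ * z k ∧ ¬ IsFeasibleDir P z (σ • e k) := by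
  have hσ : σ ≠ 0 := left_ne_zero_of_mul hxσ.ne'
  have hb0 := coordProj_apply_self k x
  have hu : σ • (e k : E d) ≠ 0 := fun h => hσ <| by
    simpa [e_apply_self] using congrArg (fun w : E d => w k) h
  obtain ⟨s, -, hz, hmax⟩ := exists_last_on_ray hP (hF hx.2) hu
  refine ⟨_, ⟨hz, ?_⟩, ?_, fun ⟨ε, hε, hmem⟩ => ?_⟩
  · rw [smul_smul, coordProj_add_smul_e hb0]
    exact hx.2
  · have hs := pos_of_forall_ray_le hx.1 hxσ hmax
    calc 0 < s * (σ * σ) := mul_pos hs (mul_self_pos.2 hσ)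
      _ = _ := by simp only [PiLp.add_apply, PiLp.smul_apply, hb0, e_apply_self, smul_eq_mul]; ring
  · rw [add_assoc, ← add_smul] at hmem
    linarith [hmax _ hmem]

theorem exists_mem_projPreimage_not_isFeasibleDir_of_subset (hP : IsPolyhedron P)
    (hproj : Set.MapsTo (coordProj k) P P) (hF : IsExposed ℝ (P ∩ {x | x k = 0}) F)
    (hA : IsExposed ℝ (P ∩ {x | x k = 0}) A) (hne : A.Nonempty) (hAF : A ⊆ F)
    (hAσ : ∀ x ∈ projPreimage k P A, σ * x k ≤ 0) (hx : x ∈ projPreimage k P F)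
    (hxσ : 0 < σ * x k) :
    ∃ z ∈ projPreimage k P F, 0 < σ * z k ∧ ¬ IsFeasibleDir P z (σ • e k) ∧
      A ⊆ faceAt P z := by
  have hσ : σ ≠ 0 := left_ne_zero_of_mul hxσ.ne'
  obtain ⟨a, ha, hAa⟩ := hP.exists_eq_faceAt_of_isExposed
    (isExposed_of_forall_mul_nonpos hP hproj hA hσ hAσ) hne
  obtain ⟨haP, ha0 : a k = 0⟩ := hA.subset ha
  have hb0 := coordProj_apply_self k x
  have hdir : ¬ IsFeasibleDir P a (σ • e k) := fun ⟨ε, hε, hmem⟩ => by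
    have hle := hAσ _ ⟨hmem, by rwa [smul_smul, coordProj_add_smul_e ha0]⟩
    simp only [PiLp.add_apply, PiLp.smul_apply, ha0, e_apply_self, smul_eq_mul] at hle
    nlinarith [mul_pos hε (mul_self_pos.2 hσ)]
  obtain ⟨s, -, t, ht, z, hz, hzeq, hzdir, haz, hmax⟩ := hP.exists_ray_exit haP (hproj hx.1) hdir
  have hzk : z k = t * (s * σ) := by
    simp [hzeq, hb0, ha0, e_apply_self]
  refine ⟨z, ⟨hz, ?_⟩, ?_, hzdir, ?_⟩
  · obtain ⟨l, M, -, rfl⟩ := exists_support_of_isExposed hF ⟨a, hAF ha⟩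
    refine ⟨⟨hproj hz, coordProj_apply_self k z⟩, ?_⟩
    have hla : l a = M := (hAF ha).2
    have hlx : l (coordProj k x) = M := hx.2.2
    rw [map_coordProj, hzk, hzeq, map_add, map_smul, map_sub, map_add, map_smul, map_smul, hla,
      hlx]
    simp only [smul_eq_mul]
    ring
  · have hs := pos_of_forall_ray_le hx.1 hxσ hmax
    calc 0 < t * s * (σ * σ) := mul_pos (mul_pos ht hs) (mul_self_pos.2 hσ)
      _ = σ * z k := by rw [hzk]; ring
  · rw [hAa]
    exact faceAt_subset_of_isExtreme (hP.isExposed_faceAt hz).isExtreme haz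

end ProjPreimage

theorem mul_pos_of_sign_cast_eq {a b : ℝ} (ha : a ≠ 0) (hb : b ≠ 0)
    (h : (SignType.sign a : ℤ) = SignType.sign b) : 0 < a * b := by
  rcases lt_or_gt_of_ne ha with ha | ha <;> rcases lt_or_gt_of_ne hb with hb | hb
  · exact mul_pos_of_neg_of_neg ha hb
  · simp [ha, hb] at h
  · simp [ha, hb] at h
  · exact mul_pos ha hb

theorem strictMono_insertNth {α : Type*} [Preorder α] {n : ℕ} {f : Fin (n + 1) → α}
    (hf : StrictMono f) {w : α} {m : Fin (n + 1)} (hlt : ∀ a < m, f a < w) (hgt : w < f m) :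
    StrictMono (m.castSucc.insertNth w f : Fin (n + 2) → α) := by
  intro i j hij
  rcases Fin.eq_self_or_eq_succAbove m.castSucc i with rfl | ⟨a, rfl⟩
  · obtain ⟨b, rfl⟩ := Fin.exists_succAbove_eq hij.ne'
    rw [Fin.insertNth_apply_same, Fin.insertNth_apply_succAbove]
    rw [Fin.lt_succAbove_iff_le_castSucc, Fin.castSucc_le_castSucc_iff] at hij
    exact hgt.trans_le (hf.monotone hij)
  rcases Fin.eq_self_or_eq_succAbove m.castSucc j with rfl | ⟨b, rfl⟩
  · rw [Fin.insertNth_apply_same, Fin.insertNth_apply_succAbove]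
    rw [Fin.succAbove_lt_iff_castSucc_lt, Fin.castSucc_lt_castSucc_iff] at hij
    exact hlt a hij
  · rw [Fin.insertNth_apply_succAbove, Fin.insertNth_apply_succAbove]
    exact hf (Fin.succAbove_lt_succAbove_iff.1 hij)

namespace FaceChain

section Lift

variable {d n : ℕ} {P W : Set (E d)} {k : Fin d} {σ : ℝ} {m a : Fin (n + 1)}

/-- The faces of a chain of the section of `P` with the `k`-th coordinate hyperplane, those from the
`m`-th one on being replaced by the faces of `P` lying over them. -/
def liftFace (G : FaceChain n (P ∩ {x | x k = 0})) (m a : Fin (n + 1)) : Set (E d) :=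
  if a < m then G.face a else projPreimage k P (G.face a)

variable {G : FaceChain n (P ∩ {x | x k = 0})}

theorem liftFace_of_lt (h : a < m) : G.liftFace m a = G.face a := if_pos h

theorem liftFace_of_le (h : m ≤ a) : G.liftFace m a = projPreimage k P (G.face a) :=
  if_neg h.not_gt

theorem liftFace_inter : G.liftFace m a ∩ {x | x k = 0} = G.face a := by
  rcases lt_or_ge a m with h | h
  · rw [liftFace_of_lt h, Set.inter_eq_left]
    exact fun x hx => (G.subset a hx).2
  · rw [liftFace_of_le h, projPreimage_inter (G.subset a)]

theorem strictMono_liftFace : StrictMono (G.liftFace m) := by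
  refine Monotone.strictMono_of_injective (fun a b hab => ?_) fun a b hab =>
    G.strictMono.injective (by rw [← liftFace_inter (m := m), hab, liftFace_inter])
  have hG := G.strictMono.monotone hab
  rcases lt_or_ge b m with hb | hb
  · rwa [liftFace_of_lt hb, liftFace_of_lt (hab.trans_lt hb)]
  rw [liftFace_of_le hb]
  rcases lt_or_ge a m with ha | ha
  · rw [liftFace_of_lt ha]
    exact hG.trans (subset_projPreimage (G.subset b))
  · rw [liftFace_of_le ha]
    exact projPreimage_mono hG

/-- The chain obtained from a chain of the section of `P` with the `k`-th coordinate hyperplane by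
inserting a face `W` in position `m` and passing to the faces of `P` above `W`. -/
def lift (hP : Set.MapsTo (coordProj k) P P) (G : FaceChain n (P ∩ {x | x k = 0}))
    (m : Fin (n + 1)) (hlow : ∀ a < m, IsExposed ℝ P (G.face a)) (hW : IsExposed ℝ P W)
    (hne : W.Nonempty) (hlt : ∀ a < m, G.face a ⊂ W) (hgt : W ⊂ projPreimage k P (G.face m)) :
    FaceChain (n + 1) P where
  face := m.castSucc.insertNth W (G.liftFace m)
  exposed j := by
    rcases Fin.eq_self_or_eq_succAbove m.castSucc j with rfl | ⟨a, rfl⟩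
    · rwa [Fin.insertNth_apply_same]
    rw [Fin.insertNth_apply_succAbove]
    rcases lt_or_ge a m with ha | ha
    · exact liftFace_of_lt ha ▸ hlow a ha
    · exact liftFace_of_le ha ▸ isExposed_projPreimage hP (G.exposed a)
  nonempty_zero := by
    rcases Fin.eq_self_or_eq_succAbove m.castSucc 0 with h | ⟨a, h⟩
    · rwa [h, Fin.insertNth_apply_same]
    · rw [h, Fin.insertNth_apply_succAbove]
      exact (G.nonempty a).mono (liftFace_inter (G := G) ▸ Set.inter_subset_left)
  strictMono := strictMono_insertNth strictMono_liftFace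
    (fun a ha => (liftFace_of_lt ha).symm ▸ hlt a ha) ((liftFace_of_le le_rfl).symm ▸ hgt)

variable {hP : Set.MapsTo (coordProj k) P P} {hlow : ∀ a < m, IsExposed ℝ P (G.face a)}
  {hW : IsExposed ℝ P W} {hne : W.Nonempty} {hlt : ∀ a < m, G.face a ⊂ W}
  {hgt : W ⊂ projPreimage k P (G.face m)}

theorem lift_face_castSucc : (G.lift hP m hlow hW hne hlt hgt).face m.castSucc = W :=
  Fin.insertNth_apply_same (α := fun _ => Set (E d)) _ _ _

theorem lift_face_succAbove :
    (G.lift hP m hlow hW hne hlt hgt).face (m.castSucc.succAbove a) = G.liftFace m a :=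
  Fin.insertNth_apply_succAbove (α := fun _ => Set (E d)) _ _ _ _

theorem exists_mem_projPreimage_forall_subset_faceAt (hPc : IsCompact P) (hP : IsPolyhedron P)
    (hproj : Set.MapsTo (coordProj k) P P)
    (hlow : ∀ a < m, ∀ x ∈ projPreimage k P (G.face a), σ * x k ≤ 0) {x : E d}
    (hx : x ∈ projPreimage k P (G.face m)) (hxσ : 0 < σ * x k) :
    ∃ z ∈ projPreimage k P (G.face m), 0 < σ * z k ∧ ¬ IsFeasibleDir P z (σ • e k) ∧
      ∀ a < m, G.face a ⊆ faceAt P z := by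
  rcases Fin.eq_zero_or_eq_succ m with rfl | ⟨p, rfl⟩
  · obtain ⟨z, hz, hzσ, hdir⟩ := exists_mem_projPreimage_not_isFeasibleDir hPc
      ((G.subset 0).trans Set.inter_subset_left) hx hxσ
    exact ⟨z, hz, hzσ, hdir, fun a ha => absurd ha (Fin.not_lt_zero a)⟩
  · have hp : p.castSucc < p.succ := Fin.castSucc_lt_succ
    obtain ⟨z, hz, hzσ, hdir, hsub⟩ := exists_mem_projPreimage_not_isFeasibleDir_of_subset hP hproj
      (G.exposed _) (G.exposed _) (G.nonempty p.castSucc) (G.strictMono.monotone hp.le)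
      (hlow _ hp) hx hxσ
    exact ⟨z, hz, hzσ, hdir, fun a ha =>
      (G.strictMono.monotone (Fin.le_castSucc_iff.2 ha)).trans hsub⟩

end Lift

section RestrictBijection

variable {d n : ℕ} {P : Set (E d)} {ι : Fin (n + 1) → Fin d} {F F' : FaceChain (n + 1) P}
  {G : FaceChain n (P ∩ {x | x (ι (Fin.last n)) = 0})} {m m' : Fin (n + 1)} {σ : ℝ}

theorem exists_mul_pos_forall_mul_nonpos (hP : IsAntiBlockingAlong ι P)
    (G : FaceChain n (P ∩ {x | x (ι (Fin.last n)) = 0})) (hσ : σ ≠ 0) :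
    ∃ m, (∃ x ∈ projPreimage (ι (Fin.last n)) P (G.face m), 0 < σ * x (ι (Fin.last n))) ∧
      ∀ a < m, ∀ x ∈ projPreimage (ι (Fin.last n)) P (G.face a), σ * x (ι (Fin.last n)) ≤ 0 := by
  let S : Set (Fin (n + 1)) :=
    {a | ∃ x ∈ projPreimage (ι (Fin.last n)) P (G.face a), 0 < σ * x (ι (Fin.last n))}
  have hS : S.Nonempty := by
    have hmem : ∀ x ∈ P, x ∈ projPreimage (ι (Fin.last n)) P (G.face (Fin.last n)) := fun x hx => by
      rw [G.face_last hP.inter_coord.affDim_eq.le]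
      exact ⟨hx, hP.mapsTo_coordProj _ hx, coordProj_apply_self _ _⟩
    rcases lt_or_gt_of_ne hσ with h | h
    · obtain ⟨x, hx, hxi⟩ := hP.exists_neg (Fin.last n)
      exact ⟨_, x, hmem x hx, mul_pos_of_neg_of_neg h hxi⟩
    · obtain ⟨x, hx, hxi⟩ := hP.exists_pos (Fin.last n)
      exact ⟨_, x, hmem x hx, mul_pos h hxi⟩
  obtain ⟨m, hm, hmin⟩ := wellFounded_lt.has_min S hS
  exact ⟨m, hm, fun a ha x hx => not_lt.1 fun hlt => hmin a ⟨x, hx, hlt⟩ ha⟩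

theorem isSole_of_face_succAbove_eq_liftFace
    (hface : ∀ a, F.face (m.castSucc.succAbove a) = G.liftFace m a)
    (hhigh : IsHigh (ι (Fin.last n)) (projPreimage (ι (Fin.last n)) P (G.face m)))
    (h : F.signMatrix ι m (Fin.last n) ≠ 0) : F.IsSole ι m := by
  refine ⟨h, fun j hj => ?_⟩
  obtain ⟨a, rfl⟩ := Fin.exists_succAbove_eq hj
  rw [signMatrix_apply, ← Fin.castSucc_succAbove_castSucc, hface]
  rcases lt_or_ge a.castSucc m with ha | ha
  · exact liftFace_of_lt ha ▸ faceSign_of_isLow fun y hy => (G.subset _ hy).2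
  · exact liftFace_of_le ha ▸ faceSign_of_isHigh
      (hhigh.mono (projPreimage_mono (G.strictMono.monotone ha)))

/-- Insert the face of a point that lies over the first face allowing a displacement in the
direction `σ`, and that cannot itself be displaced further. -/
theorem exists_restrict_eq (hP : IsAntiBlockingAlong ι P)
    (G : FaceChain n (P ∩ {x | x (ι (Fin.last n)) = 0})) (hσ : σ ≠ 0) :
    ∃ (F : FaceChain (n + 1) P) (m : Fin (n + 1)) (h : F.IsSole ι m),
      F.restrict hP m h = G ∧ F.signMatrix ι m (Fin.last n) = SignType.sign σ := by
  have hproj := hP.mapsTo_coordProj (ι (Fin.last n))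
  obtain ⟨m, ⟨x, hx, hxσ⟩, hmin⟩ := exists_mul_pos_forall_mul_nonpos hP G hσ
  have hhigh : IsHigh (ι (Fin.last n)) (projPreimage (ι (Fin.last n)) P (G.face m)) :=
    ⟨x, hx, right_ne_zero_of_mul hxσ.ne', subset_projPreimage (G.subset m) hx.2⟩
  obtain ⟨z, hz, hzσ, hdir, hsub⟩ := exists_mem_projPreimage_forall_subset_faceAt hP.isCompact
    hP.isPolyhedron hproj hmin hx hxσ
  have hz0 : z (ι (Fin.last n)) ≠ 0 := right_ne_zero_of_mul hzσ.ne'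
  have hzW := mem_faceAt_self hz.1
  have hW := hP.isPolyhedron.isExposed_faceAt hz.1
  have hWhigh := not_isHigh_faceAt hP.isPolyhedron hproj hz.1 hzσ hdir
  have hlow : ∀ a < m, IsExposed ℝ P (G.face a) := fun a ha =>
    isExposed_of_forall_mul_nonpos hP.isPolyhedron hproj (G.exposed a) hσ (hmin a ha)
  have hlt : ∀ a < m, G.face a ⊂ faceAt P z := fun a ha =>
    (hsub a ha).ssubset_of_ne fun h => hz0 (G.subset a (h ▸ hzW)).2
  have hgt : faceAt P z ⊂ projPreimage (ι (Fin.last n)) P (G.face m) :=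
    (faceAt_subset_of_isExtreme (isExposed_projPreimage hproj (G.exposed m)).isExtreme
      hz).ssubset_of_ne fun h => hWhigh (h ▸ hhigh)
  obtain ⟨F, hFm, hFa⟩ : ∃ F : FaceChain (n + 1) P, F.face m.castSucc = faceAt P z ∧
      ∀ a, F.face (m.castSucc.succAbove a) = G.liftFace m a :=
    ⟨G.lift hproj m hlow hW ⟨z, hzW⟩ hlt hgt, lift_face_castSucc, fun _ => lift_face_succAbove⟩
  have hsign : F.signMatrix ι m (Fin.last n) = SignType.sign (z (ι (Fin.last n))) := by
    rw [signMatrix_apply, hFm]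
    exact faceSign_eq_sign hproj hW hWhigh hzW hz0
  refine ⟨F, m, isSole_of_face_succAbove_eq_liftFace hFa hhigh (hsign ▸ sign_cast_ne_zero hz0),
    FaceChain.ext (funext fun a => ?_), hsign.trans (sign_cast_eq_of_mul_pos hzσ).symm⟩
  rw [restrict_face, hFa, liftFace_inter]

theorem IsSole.le_of_restrict_eq (hP : IsAntiBlockingAlong ι P) (h : F.IsSole ι m)
    (h' : F'.IsSole ι m') (hr : F.restrict hP m h = F'.restrict hP m' h')
    (hs : F.signMatrix ι m (Fin.last n) = F'.signMatrix ι m' (Fin.last n)) : m' ≤ m := by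
  by_contra! hlt
  obtain ⟨x, hx, hx0, hxs, hxiff⟩ := h.exists_coordProj_mem_iff hP
  obtain ⟨z, hz, hz0, hzs, -⟩ := h'.exists_coordProj_mem_iff hP
  have hpos := mul_pos_of_sign_cast_eq hx0 hz0 (by rw [← hxs, ← hzs, hs])
  refine coordProj_notMem_of_mul_pos (hP.mapsTo_coordProj _) (F'.exposed _) h'.not_isHigh
    (F.subset _ hx) hz hpos ?_
  have hmem : coordProj (ι (Fin.last n)) x ∈ (F.restrict hP m h).face m := by
    rw [restrict_face, Fin.succAbove_castSucc_self]
    exact ⟨(hxiff _).2 Fin.castSucc_lt_succ, coordProj_apply_self _ _⟩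
  rw [hr, restrict_face, Fin.succAbove_castSucc_of_lt m' m hlt] at hmem
  exact F'.strictMono.monotone (Fin.castSucc_le_castSucc_iff.2 hlt.le) hmem.1

theorem IsSole.face_subset_of_restrict_eq (hP : IsAntiBlockingAlong ι P) (h : F.IsSole ι m)
    (h' : F'.IsSole ι m) (hr : F.restrict hP m h = F'.restrict hP m h') {j : Fin (n + 2)}
    (hj : j ≠ m.castSucc) : F.face j ⊆ F'.face j := by
  obtain ⟨a, rfl⟩ := Fin.exists_succAbove_eq hj
  have hface := congrFun (congrArg face hr) a
  rw [restrict_face, restrict_face] at hface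
  intro x hx
  have hproj := (hface ▸ h.coordProj_mem hP hj hx).1
  rcases lt_or_gt_of_ne hj with hlt | hlt
  · rwa [coordProj_of_eq_zero (h.isLow hP hlt x hx)] at hproj
  · exact (h'.coordProj_mem_face_iff hP hlt (F.subset _ hx)).1 hproj

theorem IsSole.eq_of_restrict_eq (hP : IsAntiBlockingAlong ι P) (h : F.IsSole ι m)
    (h' : F'.IsSole ι m') (hr : F.restrict hP m h = F'.restrict hP m' h')
    (hs : F.signMatrix ι m (Fin.last n) = F'.signMatrix ι m' (Fin.last n)) :
    F = F' ∧ m = m' := by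
  obtain rfl : m = m' :=
    le_antisymm (h'.le_of_restrict_eq hP h hr.symm hs.symm) (h.le_of_restrict_eq hP h' hr hs)
  refine ⟨FaceChain.eq_of_orient_eq hP (m := m) (fun j hj => ?_) ?_, rfl⟩
  · exact subset_antisymm (h.face_subset_of_restrict_eq hP h' hr hj)
      (h'.face_subset_of_restrict_eq hP h hr.symm hj)
  · rw [orient_restrict hP h, orient_restrict hP h', hr, hs]

end RestrictBijection

end FaceChain

namespace FaceChain

variable {d n : ℕ} {P : Set (E d)} {ι : Fin (n + 1) → Fin d}

/-- The restriction of a chain with a sole non-zero sign in the last coordinate, together with the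
information whether this sign is positive. -/
noncomputable def restrictSign (hP : IsAntiBlockingAlong ι P)
    (p : {p : FaceChain (n + 1) P × Fin (n + 1) // p.1.IsSole ι p.2}) :
    FaceChain n (P ∩ {x | x (ι (Fin.last n)) = 0}) × Bool :=
  (p.1.1.restrict hP p.1.2 p.2, decide (0 < p.1.1.signMatrix ι p.1.2 (Fin.last n)))

theorem restrictSign_bijective (hP : IsAntiBlockingAlong ι P) :
    Function.Bijective (restrictSign hP) := by
  constructor
  · rintro ⟨⟨F, m⟩, h⟩ ⟨⟨F', m'⟩, h'⟩ heq
    simp only [restrictSign, Prod.mk.injEq, decide_eq_decide] at heq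
    obtain ⟨hr, hpos⟩ := heq
    have hs : F.signMatrix ι m (Fin.last n) = F'.signMatrix ι m' (Fin.last n) := by
      rcases mul_self_eq_one_iff.1 (faceSign_mul_self h.1) with h1 | h1 <;>
        rcases mul_self_eq_one_iff.1 (faceSign_mul_self h'.1) with h2 | h2 <;>
        simp_all [signMatrix_apply]
    obtain ⟨rfl, rfl⟩ := h.eq_of_restrict_eq hP h' hr hs
    rfl
  · rintro ⟨G, b⟩
    obtain ⟨σ, hσ, hb⟩ : ∃ σ : ℝ, σ ≠ 0 ∧ decide (0 < (SignType.sign σ : ℤ)) = b := by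
      cases b
      · exact ⟨-1, by simp, by simp⟩
      · exact ⟨1, by simp, by simp⟩
    obtain ⟨F, m, h, hr, hs⟩ := exists_restrict_eq hP G hσ
    exact ⟨⟨(F, m), h⟩, Prod.ext hr (by simpa only [restrictSign, hs] using hb)⟩

theorem sum_weight_succ (hP : IsAntiBlockingAlong ι P) [Fintype (FaceChain (n + 1) P)]
    [Fintype (FaceChain n (P ∩ {x | x (ι (Fin.last n)) = 0}))] :
    ∑ F : FaceChain (n + 1) P, F.weight ι = -(2 * (n + 1)) *
      ∑ G : FaceChain n (P ∩ {x | x (ι (Fin.last n)) = 0}), G.weight (ι ∘ Fin.castSucc) := by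
  classical
  calc ∑ F : FaceChain (n + 1) P, F.weight ι
      = ∑ F : FaceChain (n + 1) P, ∑ m, if F.IsSole ι m then F.weightTerm ι m else 0 := by
        rw [Finset.sum_congr rfl fun F _ => F.weight_eq_sum_weightTerm hP, Finset.sum_comm,
          Finset.sum_congr rfl fun m _ => sum_weightTerm hP m, Finset.sum_comm]
    _ = ∑ p : {p : FaceChain (n + 1) P × Fin (n + 1) // p.1.IsSole ι p.2},
          p.1.1.weightTerm ι p.1.2 := by
        rw [← Fintype.sum_prod_type', ← Finset.sum_filter]
        exact Finset.sum_subtype _ (by simp) _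
    _ = ∑ q : FaceChain n (P ∩ {x | x (ι (Fin.last n)) = 0}) × Bool,
          -((n : ℤ) + 1) * q.1.weight (ι ∘ Fin.castSucc) :=
        Fintype.sum_bijective _ (restrictSign_bijective hP) _ _ fun p => weightTerm_of_isSole hP p.2
    _ = _ := by
        rw [Fintype.sum_prod_type, Finset.mul_sum]
        refine Finset.sum_congr rfl fun G _ => ?_
        rw [Fintype.sum_bool]
        ring

theorem abs_weight_le_one {n : ℕ} {ι : Fin n → Fin d} (hP : IsAntiBlockingAlong ι P)
    (F : FaceChain n P) : |F.weight ι| ≤ 1 := by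
  rw [weight, abs_mul, F.abs_orient hP, one_mul]
  exact F.abs_det_signMatrix_le hP.mapsTo_coordProj

end FaceChain

section Count

variable {d : ℕ}

theorem abs_sum_weight_zero {ι : Fin 0 → Fin d} {P : Set (E d)} (hP : IsAntiBlockingAlong ι P)
    [Fintype (FaceChain 0 P)] : |∑ F : FaceChain 0 P, F.weight ι| = 1 := by
  have hface : ∀ F G : FaceChain 0 P, F = G := fun F G => FaceChain.ext <| funext fun j => by
    rw [Subsingleton.elim (α := Fin 1) j (Fin.last 0), F.face_last hP.affDim_eq.le,
      G.face_last hP.affDim_eq.le]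
  let F₀ : FaceChain 0 P :=
    { face := fun _ => P
      exposed := fun _ => IsExposed.refl P
      nonempty_zero := hP.nonempty
      strictMono := Subsingleton.strictMono (α := Fin 1) _ }
  rw [Fintype.sum_eq_single F₀ fun F hF => absurd (hface F F₀) hF, FaceChain.weight, abs_mul,
    FaceChain.abs_orient hP, Matrix.det_isEmpty, abs_one, mul_one]

theorem abs_sum_weight {n : ℕ} {ι : Fin n → Fin d} {P : Set (E d)}
    (hP : IsAntiBlockingAlong ι P) [Fintype (FaceChain n P)] :
    |∑ F : FaceChain n P, F.weight ι| = 2 ^ n * (n.factorial : ℤ) := by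
  induction n generalizing P with
  | zero => simpa using abs_sum_weight_zero hP
  | succ n ih =>
    have := FaceChain.finite (n := n) hP.inter_coord.isPolyhedron
    have := Fintype.ofFinite (FaceChain n (P ∩ {x | x (ι (Fin.last n)) = 0}))
    rw [FaceChain.sum_weight_succ hP, abs_mul, ih hP.inter_coord, abs_neg,
      abs_of_nonneg (by positivity), Nat.factorial_succ, pow_succ]
    push_cast
    ring

/-- The sign matrices of all chains of `P` are invertible: the condition forced by a minimal number
of flags. -/
def IsNonsingular {n : ℕ} (ι : Fin n → Fin d) (P : Set (E d)) : Prop :=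
  ∀ F : FaceChain n P, (F.signMatrix ι).det ≠ 0

theorem isNonsingular_of_card_le {n : ℕ} {ι : Fin n → Fin d} {P : Set (E d)}
    (hP : IsAntiBlockingAlong ι P) (hcard : Nat.card (FaceChain n P) ≤ 2 ^ n * n.factorial) :
    IsNonsingular ι P := by
  classical
  intro F hdet
  have := FaceChain.finite (n := n) hP.isPolyhedron
  have := Fintype.ofFinite (FaceChain n P)
  rw [Nat.card_eq_fintype_card] at hcard
  have hweight : F.weight ι = 0 := by rw [FaceChain.weight, hdet, mul_zero]
  have hsum : |∑ G : FaceChain n P, G.weight ι| ≤ Fintype.card (FaceChain n P) - 1 := by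
    calc |∑ G : FaceChain n P, G.weight ι|
        = |∑ G ∈ Finset.univ.erase F, G.weight ι| := by rw [Finset.sum_erase _ hweight]
      _ ≤ ∑ G ∈ Finset.univ.erase F, |G.weight ι| := Finset.abs_sum_le_sum_abs _ _
      _ ≤ (Finset.univ.erase F).card • (1 : ℤ) :=
        Finset.sum_le_card_nsmul _ _ _ fun G _ => G.abs_weight_le_one hP
      _ = Fintype.card (FaceChain n P) - 1 := by
        rw [nsmul_eq_mul, mul_one, Finset.cast_card_erase_of_mem (Finset.mem_univ F),
          Finset.card_univ]
  rw [abs_sum_weight hP] at hsum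
  have : (Fintype.card (FaceChain n P) : ℤ) ≤ 2 ^ n * (n.factorial : ℤ) := mod_cast hcard
  linarith

theorem IsNonsingular.inter_coord {n : ℕ} {ι : Fin (n + 1) → Fin d} {P : Set (E d)}
    (hP : IsAntiBlockingAlong ι P) (hN : IsNonsingular ι P) :
    IsNonsingular (ι ∘ Fin.castSucc) (P ∩ {x | x (ι (Fin.last n)) = 0}) := by
  intro G hG
  obtain ⟨F, m, h, rfl, -⟩ := FaceChain.exists_restrict_eq hP G one_ne_zero
  apply hN F
  rw [FaceChain.signMatrix_restrict] at hG
  rw [Matrix.det_succ_column _ (Fin.last n), Finset.sum_eq_single m]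
  · rw [Fin.succAbove_last, hG, mul_zero]
  · intro j _ hj
    rw [h.2 j hj, mul_zero, zero_mul]
  · exact fun hm => absurd (Finset.mem_univ m) hm

end Count

section Nonsingular

variable {d n : ℕ} {P M : Set (E d)} {ι : Fin n → Fin d} {k : Fin d} {v p : E d}

theorem affDim_singleton (v : E d) : affDim {v} = 0 := by
  simp [affDim]

theorem IsAntiBlockingAlong.faceAt_ne (hP : IsAntiBlockingAlong ι P) {z u : E d}
    (hu : ∀ j, j ∉ Set.range ι → u j = 0) (hz : ¬ IsFeasibleDir P z u) : faceAt P z ≠ P := by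
  intro h
  obtain ⟨η, hη, hmem⟩ := hP.exists_smul_mem (w := -u) fun j hj => by simp [hu j hj]
  rw [← h] at hmem
  obtain ⟨-, δ, hδ, hmem⟩ := hmem
  refine hz ⟨(1 + δ)⁻¹ * (δ * η), by positivity, ?_⟩
  have hscaled := hP.isPolyhedron.convex.smul_mem_of_zero_mem hP.zero_mem hmem
    (t := (1 + δ)⁻¹) ⟨by positivity, inv_le_one_of_one_le₀ (by linarith)⟩
  convert hscaled using 1
  have hδ' : (1 + δ)⁻¹ * δ = 1 - (1 + δ)⁻¹ := by field_simp; ring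
  rw [smul_add, smul_smul, hδ', ← mul_assoc, hδ']
  module

theorem IsAntiBlockingAlong.exists_faceChain {ι : Fin (n + 1) → Fin d}
    (hP : IsAntiBlockingAlong ι P) (hv : IsExposed ℝ P {v}) (hM : IsExposed ℝ P M) (hMP : M ≠ P)
    (hvM : v ∈ M) :
    ∃ F : FaceChain (n + 1) P, F.face 0 = {v} ∧ M ⊆ F.face (Fin.last n).castSucc := by
  obtain ⟨W, hW, hMW, hWP, hdim⟩ := exists_isExposed_affDim_add_one hP.isPolyhedron
    (IsExposed.refl P) hM ⟨v, hvM⟩ (hM.subset.ssubset_of_ne hMP)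
  rw [hP.affDim_eq] at hdim
  obtain ⟨F, hF0, hFW⟩ := FaceChain.exists_face_zero_eq_face_last_eq hP.isPolyhedron hv
    (Set.singleton_nonempty v) n hW (Set.singleton_subset_iff.2 (hMW hvM))
    (by rw [affDim_singleton]; omega)
  refine ⟨F.snoc P (IsExposed.refl P) (hFW ▸ hWP), ?_, ?_⟩
  · rw [FaceChain.snoc_face_zero, hF0]
  · rwa [FaceChain.snoc_face_castSucc, hFW]

/-- Two coordinates shared by the vertex and the facet normal would give proportional columns of
the sign matrix. -/
theorem IsNonsingular.eq_of_ne_zero {ι : Fin (n + 1) → Fin d} (hP : IsAntiBlockingAlong ι P)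
    (hN : IsNonsingular ι P) (F : FaceChain (n + 1) P) (hv : v ∈ F.face 0)
    {l : StrongDual ℝ (E d)} {m : ℝ} (hface : F.face (Fin.last n).castSucc = {x ∈ P | l x = m})
    {c c' : Fin (n + 1)} (hc : v (ι c) * l (e (ι c)) ≠ 0) (hc' : v (ι c') * l (e (ι c')) ≠ 0) :
    c = c' := by
  by_contra hne
  apply hN F
  have hcol {b : Fin (n + 1)} (hb : v (ι b) * l (e (ι b)) ≠ 0) :
      ∃ τ : ℤ, τ ≠ 0 ∧ ∀ a, F.signMatrix ι a b = τ :=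
    ⟨_, sign_cast_ne_zero (left_ne_zero_of_mul hb), F.signMatrix_eq_sign hP.mapsTo_coordProj hv
      hface (right_ne_zero_of_mul hb) (left_ne_zero_of_mul hb)⟩
  obtain ⟨τ, -, hτ⟩ := hcol hc
  obtain ⟨τ', hτ'0, hτ'⟩ := hcol hc'
  rw [← Matrix.exists_mulVec_eq_zero_iff]
  refine ⟨τ' • Pi.single c 1 - τ • Pi.single c' 1, fun h => hτ'0 ?_, ?_⟩
  · simpa [Pi.single_eq_of_ne hne] using congrFun h c
  · ext a
    rw [Matrix.mulVec_sub, Matrix.mulVec_smul, Matrix.mulVec_smul, Matrix.mulVec_single_one,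
      Matrix.mulVec_single_one]
    simp [hτ, hτ', mul_comm]

theorem IsNonsingular.exists_support (hP : IsAntiBlockingAlong ι P) (hN : IsNonsingular ι P)
    (hv : IsExposed ℝ P {v}) (hM : IsExposed ℝ P M) (hMP : M ≠ P) (hvM : v ∈ M) :
    ∃ (l : StrongDual ℝ (E d)) (m : ℝ), 0 < m ∧ (∀ x ∈ M, l x = m) ∧
      {k | v k * l (e k) ≠ 0}.Subsingleton := by
  have hsupp {k} (hk : v k ≠ 0) : k ∈ Set.range ι := by
    by_contra hkι
    exact hk (hP.apply_eq_zero v (hv.subset rfl) k hkι)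
  cases n with
  | zero =>
    have hzero : ∀ x ∈ P, x = 0 := fun x hx => by
      ext j
      exact hP.apply_eq_zero x hx j (by simp)
    refine absurd (hM.subset.antisymm fun x hx => ?_) hMP
    rwa [hzero x hx, ← hzero v (hM.subset hvM)]
  | succ n =>
    obtain ⟨F, hF0, hMF⟩ := hP.exists_faceChain hv hM hMP hvM
    obtain ⟨l, m, hm, -, hface⟩ := F.exists_support_pos hP
    refine ⟨l, m, hm, fun x hx => (hface ▸ hMF hx).2, fun k hk k' hk' => ?_⟩
    obtain ⟨c, rfl⟩ := hsupp (left_ne_zero_of_mul hk)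
    obtain ⟨c', rfl⟩ := hsupp (left_ne_zero_of_mul hk')
    rw [hN.eq_of_ne_zero hP F (hF0 ▸ rfl) hface hk hk']

theorem add_smul_e_notMem (hP : Set.MapsTo (coordProj k) P P) (hv : IsExposed ℝ P {v}) {r : ℝ}
    (hr : 0 < v k * r) : v + r • e k ∉ P := by
  intro hmem
  have hvk : v k ≠ 0 := left_ne_zero_of_mul hr.ne'
  have hstep : v + (r / v k) • (v - coordProj k v) = v + r • e k := by
    rw [coordProj, sub_sub_cancel, smul_smul, div_mul_cancel₀ _ hvk]
  have hpos : 0 < r / v k := by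
    rw [← mul_div_mul_left r (v k) hvk]
    exact div_pos hr (mul_self_pos.2 hvk)
  have heq : coordProj k v = v := hv.isExtreme.left_mem_of_mem_openSegment
    (hP (hv.subset rfl)) (hstep ▸ hmem) rfl (mem_openSegment_add_smul_sub hpos)
  exact hvk (by rw [← heq, coordProj_apply_self])

theorem IsAntiBlockingAlong.not_isFeasibleDir_coordProj (hP : IsAntiBlockingAlong ι P)
    (hv : IsExposed ℝ P {v}) (hp : p ∈ P) (hlt : v k * v k < v k * p k) :
    ¬ IsFeasibleDir P v (coordProj k v) := by
  rintro ⟨ε, hε, hmem⟩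
  have heq : v k • e k = v := hv.isExtreme.left_mem_of_mem_openSegment
    (hP.smul_e_mem (hv.subset rfl) k) hmem rfl (mem_openSegment_add_smul_sub hε)
  refine add_smul_e_notMem (hP.mapsTo_coordProj k) hv (r := p k - v k)
    (by rw [mul_sub]; exact sub_pos.2 hlt) ?_
  convert hP.smul_e_mem hp k using 1
  nth_rewrite 1 [← heq]
  module

/-- The point `z` is where the ray from `v` towards a suitable point of the ray from `p k • e k` in
direction `coordProj k v` leaves `P`; it has `s < 1`, as otherwise `P` would contain a point
strictly beyond `v` in direction `e k`. -/
theorem IsAntiBlockingAlong.exists_exit_coordProj (hP : IsAntiBlockingAlong ι P)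
    (hv : IsExposed ℝ P {v}) (hp : p ∈ P) (hlt : v k * v k < v k * p k) :
    ∃ s < (1 : ℝ), ∃ t > (0 : ℝ), ∃ z ∈ P, z = v + t • (p k • e k + s • coordProj k v - v) ∧
      ¬ IsFeasibleDir P z (coordProj k v) ∧ v ∈ faceAt P z := by
  obtain ⟨s, -, t, ht, z, hz, hzeq, hzu, hvz, -⟩ := hP.isPolyhedron.exists_ray_exit
    (hv.subset rfl) (hP.smul_e_mem hp k) (hP.not_isFeasibleDir_coordProj hv hp hlt)
  refine ⟨s, ?_, t, ht, z, hz, hzeq, hzu, hvz⟩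
  by_contra! hs
  have hzk : z k = v k + t * (p k - v k) := by
    simp [hzeq, e_apply_self, coordProj_apply_self]
  have hκ : 1 ≤ 1 + t * (s - 1) := by nlinarith
  have hκ0 : 1 + t * (s - 1) ≠ 0 := by linarith
  refine add_smul_e_notMem (hP.mapsTo_coordProj k) hv (r := t * (p k - v k)) (by nlinarith) ?_
  have hmem := hP.isPolyhedron.convex hz (hP.smul_e_mem hz k) (a := (1 + t * (s - 1))⁻¹)
    (b := 1 - (1 + t * (s - 1))⁻¹) (by positivity) (sub_nonneg.2 (inv_le_one_of_one_le₀ hκ))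
    (by ring)
  convert hmem using 1
  have hz' : z = (1 + t * (s - 1)) • coordProj k v + z k • e k := by
    rw [hzk, hzeq, coordProj]
    module
  nth_rewrite 1 [hz']
  rw [smul_add, smul_smul, inv_mul_cancel₀ hκ0, hzk, coordProj]
  module

/-- If `p k` were beyond `v k`, then `v` would lie on a face whose normal shares with `v` the
coordinate `k` and also a coordinate other than `k`. -/
theorem IsNonsingular.vertex_mul_le (hP : IsAntiBlockingAlong ι P) (hN : IsNonsingular ι P)
    (hv : IsExposed ℝ P {v}) (hp : p ∈ P) (hvk : v k ≠ 0) : v k * p k ≤ v k * v k := by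
  by_contra! hlt
  have hvP : coordProj k v ∈ P := hP.mapsTo_coordProj k (hv.subset rfl)
  obtain ⟨s, hs, t, ht, z, hz, hzeq, hzu, hvz⟩ := hP.exists_exit_coordProj hv hp hlt
  obtain ⟨f, m, hm, hf, hsub⟩ := hN.exists_support hP hv (hP.isPolyhedron.isExposed_faceAt hz)
    (hP.faceAt_ne (hP.apply_eq_zero _ hvP) hzu) hvz
  have hfv : f (coordProj k v) + v k * f (e k) = m := by
    rw [← hf v hvz, ← smul_eq_mul, ← map_smul, ← map_add, coordProj, sub_add_cancel]
  have hrel : (p k - v k) * f (e k) = (1 - s) * f (coordProj k v) := by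
    have hfz := hf z (mem_faceAt_self hz)
    rw [hzeq, map_add, hf v hvz, add_eq_left, map_smul, smul_eq_zero_iff_right ht.ne', map_sub,
      map_add, map_smul, map_smul, hf v hvz, smul_eq_mul, smul_eq_mul] at hfz
    linarith
  have hpv : p k - v k ≠ 0 := sub_ne_zero.2 fun h => by simp [h] at hlt
  have hs' : 1 - s ≠ 0 := by linarith
  have hfk : f (e k) ≠ 0 := fun h => by
    have h0 : f (coordProj k v) = 0 := by simpa [h, hs'] using hrel.symm
    rw [h, h0] at hfv
    simp [← hfv] at hm
  have hfv0 : f (coordProj k v) ≠ 0 := fun h => by simp [h, hpv, hfk] at hrel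
  rw [hP.map_eq_sum f hvP] at hfv0
  obtain ⟨c, -, hc⟩ := Finset.exists_ne_zero_of_sum_ne_zero hfv0
  have hck : ι c ≠ k := fun h => by simp [h, coordProj_apply_self] at hc
  rw [coordProj_apply_of_ne hck] at hc
  exact hck (hsub hc (mul_ne_zero hvk hfk))

end Nonsingular

section CoordSubspace

variable {d : ℕ} {P : Set (E d)} {J K : Set (Fin d)} {x : E d} {i j : Fin d}

theorem mem_coordSubspace : x ∈ coordSubspace J ↔ ∀ k, k ∉ J → x k = 0 := by
  constructor
  · intro hx k hk
    induction hx using Submodule.span_induction with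
    | mem y hy =>
      obtain ⟨j, hj, rfl⟩ := hy
      exact e_apply_of_ne fun h => hk (h ▸ hj)
    | zero => rfl
    | add y z _ _ hy hz => simp [hy, hz]
    | smul a y _ hy => simp [hy]
  · intro h
    rw [eq_sum_smul_e x]
    refine Submodule.sum_mem _ fun k _ => ?_
    by_cases hk : k ∈ J
    · exact Submodule.smul_mem _ _ (Submodule.subset_span ⟨k, hk, rfl⟩)
    · rw [h k hk, zero_smul]
      exact Submodule.zero_mem _

theorem starProjection_compl_singleton (k : Fin d) (x : E d) :
    (coordSubspace {k}ᶜ).starProjection x = coordProj k x := by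
  refine Submodule.eq_starProjection_of_mem_of_inner_eq_zero (K := coordSubspace {k}ᶜ) ?_ ?_
  · rw [mem_coordSubspace]
    intro j hj
    rw [Set.notMem_compl_iff, Set.mem_singleton_iff] at hj
    rw [hj, coordProj_apply_self]
  · intro w hw
    rw [mem_coordSubspace] at hw
    rw [coordProj, sub_sub_cancel, inner_smul_left, inner_e_left, hw k (by simp), mul_zero]

/-- The section of `P` by the coordinate subspace `ℝ^K`. -/
def coordSection (P : Set (E d)) (K : Set (Fin d)) : Set (E d) :=
  P ∩ coordSubspace K

theorem mem_coordSection : x ∈ coordSection P K ↔ x ∈ P ∧ ∀ k, k ∉ K → x k = 0 :=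
  and_congr_right' mem_coordSubspace

theorem coordSection_univ : coordSection P Set.univ = P := by
  ext x
  simp [mem_coordSection]

theorem coordSection_inter_coord (i : Fin d) :
    coordSection P K ∩ {x | x i = 0} = coordSection P (K \ {i}) := by
  ext x
  simp only [Set.mem_inter_iff, mem_coordSection, Set.mem_ofPred_eq, Set.mem_sdiff,
    Set.mem_singleton_iff, not_and_or, not_not, or_imp, forall_and, forall_eq, and_assoc]

theorem mem_coordSection_pair (hij : i ≠ j) :
    x ∈ coordSection P {i, j} ↔ x ∈ P ∧ x = x i • e i + x j • e j := by
  rw [mem_coordSection]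
  refine and_congr_right' ⟨fun h => ?_, fun h k hk => ?_⟩
  · conv_lhs => rw [eq_sum_smul_e x]
    rw [← Finset.sum_pair hij (f := fun k => x k • (e k : E d))]
    refine (Finset.sum_subset (Finset.subset_univ _) fun k _ hk => ?_).symm
    rw [h k (by simpa using hk), zero_smul]
  · rw [h]
    simp only [Set.mem_insert_iff, Set.mem_singleton_iff, not_or] at hk
    simp [e_apply, hk.1, hk.2]

theorem sum_smul_e_apply (K : Finset (Fin d)) (w : Fin d → ℝ) (j : Fin d) :
    (∑ k ∈ K, w k • (e k : E d)) j = if j ∈ K then w j else 0 := by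
  simp [e_apply]

theorem inner_sum_smul_e (K : Finset (Fin d)) (w : Fin d → ℝ) (x : E d) :
    ⟪∑ k ∈ K, w k • e k, x⟫ = ∑ k ∈ K, w k * x k := by
  simp [sum_inner, inner_smul_left, inner_e_left]

end CoordSubspace

section Vertices

variable {d : ℕ} {P : Set (E d)}

theorem IsPolyhedron.subset_convexHull (hP : IsPolyhedron P) (hc : IsCompact P) :
    P ⊆ convexHull ℝ {v | IsExposed ℝ P {v}} := by
  have hfin : {v | IsExposed ℝ P {v}}.Finite :=
    hP.finite_isExposed.preimage Set.singleton_injective.injOn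
  have hsub : P.extremePoints ℝ ⊆ {v | IsExposed ℝ P {v}} := fun v hv =>
    hP.isExposed_of_isExtreme (isExtreme_singleton.2 hv) (convex_singleton v)
  calc P = closure (convexHull ℝ (P.extremePoints ℝ)) :=
        (closure_convexHull_extremePoints hc hP.convex).symm
    _ ⊆ convexHull ℝ {v | IsExposed ℝ P {v}} :=
        closure_minimal (convexHull_mono hsub) (hfin.isClosed_convexHull ℝ)

theorem IsPolyhedron.map_le_of_forall_isExposed (hP : IsPolyhedron P) (hc : IsCompact P)
    {l : StrongDual ℝ (E d)} {M : ℝ} (hl : ∀ v, IsExposed ℝ P {v} → l v ≤ M) {x : E d}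
    (hx : x ∈ P) : l x ≤ M :=
  convexHull_min (t := {y | l y ≤ M}) hl (convex_halfSpace_le l.toLinearMap.isLinear M)
    (hP.subset_convexHull hc hx)

end Vertices

section Permutation

variable {d n : ℕ} {ι : Fin n → Fin d} {P : Set (E d)}

theorem IsAntiBlockingAlong.comp_perm (hP : IsAntiBlockingAlong ι P) (σ : Equiv.Perm (Fin n)) :
    IsAntiBlockingAlong (ι ∘ σ) P where
  injective := hP.injective.comp σ.injective
  isCompact := hP.isCompact
  isPolyhedron := hP.isPolyhedron
  nonempty := hP.nonempty
  apply_eq_zero x hx j hj := hP.apply_eq_zero x hx j (by rwa [σ.surjective.range_comp] at hj)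
  mapsTo_coordProj := hP.mapsTo_coordProj
  exists_pos k := hP.exists_pos (σ k)
  exists_neg k := hP.exists_neg (σ k)

theorem IsNonsingular.comp_perm (hN : IsNonsingular ι P) (σ : Equiv.Perm (Fin n)) :
    IsNonsingular (ι ∘ σ) P := by
  intro F
  have hsub : F.signMatrix (ι ∘ σ) = (F.signMatrix ι).submatrix id σ := rfl
  rw [hsub, Matrix.det_permute']
  exact mul_ne_zero (by simp) (hN F)

end Permutation

/-- `P` is a locally anti-blocking polytope spanning the coordinate subspace with coordinates in
`K`, and its sign matrices are invertible. -/
def IsNonsingularOn {d : ℕ} (K : Set (Fin d)) (P : Set (E d)) : Prop :=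
  ∃ (n : ℕ) (ι : Fin n → Fin d), Set.range ι = K ∧ IsAntiBlockingAlong ι P ∧ IsNonsingular ι P

namespace IsNonsingularOn

variable {d : ℕ} {K : Set (Fin d)} {P M : Set (E d)} {v p x : E d} {i j k : Fin d}

theorem isCompact (h : IsNonsingularOn K P) : IsCompact P := by
  obtain ⟨n, ι, -, hP, -⟩ := h
  exact hP.isCompact

theorem isPolyhedron (h : IsNonsingularOn K P) : IsPolyhedron P := by
  obtain ⟨n, ι, -, hP, -⟩ := h
  exact hP.isPolyhedron

theorem zero_mem (h : IsNonsingularOn K P) : (0 : E d) ∈ P := by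
  obtain ⟨n, ι, -, hP, -⟩ := h
  exact hP.zero_mem

theorem sum_smul_e_mem (h : IsNonsingularOn K P) (hx : x ∈ P) (S : Finset (Fin d)) :
    ∑ k ∈ S, x k • e k ∈ P := by
  obtain ⟨n, ι, -, hP, -⟩ := h
  exact FlagPolytope.sum_smul_e_mem hP.mapsTo_coordProj hx S

theorem vertex_mul_le (h : IsNonsingularOn K P) (hv : IsExposed ℝ P {v}) (hp : p ∈ P)
    (hvk : v k ≠ 0) : v k * p k ≤ v k * v k := by
  obtain ⟨n, ι, -, hP, hN⟩ := h
  exact hN.vertex_mul_le hP hv hp hvk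

theorem exists_support (h : IsNonsingularOn K P) (hv : IsExposed ℝ P {v}) (hM : IsExposed ℝ P M)
    (hMP : M ≠ P) (hvM : v ∈ M) :
    ∃ (l : StrongDual ℝ (E d)) (m : ℝ), 0 < m ∧ (∀ x ∈ M, l x = m) ∧
      {k | v k * l (e k) ≠ 0}.Subsingleton := by
  obtain ⟨n, ι, -, hP, hN⟩ := h
  exact hN.exists_support hP hv hM hMP hvM

theorem inter_coord (h : IsNonsingularOn K P) (hi : i ∈ K) :
    IsNonsingularOn (K \ {i}) (P ∩ {x | x i = 0}) := by
  obtain ⟨n, ι, rfl, hP, hN⟩ := h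
  obtain ⟨c, rfl⟩ := hi
  cases n with
  | zero => exact c.elim0
  | succ n =>
    let σ : Equiv.Perm (Fin (n + 1)) := Equiv.swap (Fin.last n) c
    have hlast : (ι ∘ σ) (Fin.last n) = ι c := by simp [σ]
    have hPσ := hP.comp_perm σ
    have hNσ := (hN.comp_perm σ).inter_coord hPσ
    have hPσ' := hPσ.inter_coord
    rw [hlast] at hPσ' hNσ
    refine ⟨n, (ι ∘ σ) ∘ Fin.castSucc, ?_, hPσ', hNσ⟩
    have hinit : Set.range (Fin.castSucc : Fin n → Fin (n + 1)) = {Fin.last n}ᶜ := by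
      rw [← Fin.succAbove_last, Fin.range_succAbove]
    rw [Set.range_comp, hinit, Set.image_compl_eq_range_sdiff_image hPσ.injective,
      Set.image_singleton, hlast, σ.surjective.range_comp]

theorem coordSection (h : IsNonsingularOn Set.univ P) (K : Set (Fin d)) :
    IsNonsingularOn K (coordSection P K) := by
  suffices hcompl : ∀ S : Set (Fin d), S.Finite →
      IsNonsingularOn Sᶜ (FlagPolytope.coordSection P Sᶜ) by
    simpa using hcompl Kᶜ (Set.toFinite _)
  intro S hS
  induction S, hS using Set.Finite.induction_on with
  | empty => rwa [Set.compl_empty, coordSection_univ]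
  | @insert a S ha _ ih =>
    have hsdiff : (insert a S)ᶜ = Sᶜ \ {a} := by
      rw [← Set.union_singleton, Set.compl_union, Set.sdiff_eq]
    rw [hsdiff, ← coordSection_inter_coord]
    exact ih.inter_coord ha

/-- If `M` were high in the coordinate `j`, the sign matrix of a chain from `v` through `M` would
have a zero column. -/
theorem not_isHigh_of_pair (hij : i ≠ j) (h : IsNonsingularOn {i, j} P) (hv : IsExposed ℝ P {v})
    (hM : IsExposed ℝ P M) (hMP : M ≠ P) (hvM : v ∈ M) (hvj : v j = 0) : ¬ IsHigh j M := by
  intro hj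
  obtain ⟨n, ι, hι, hP, hN⟩ := h
  have hn : n = 1 + 1 := by
    have hcard := Set.ncard_pair hij
    rwa [← hι, ← Set.image_univ, Set.ncard_image_of_injective _ hP.injective, Set.ncard_univ,
      Nat.card_eq_fintype_card, Fintype.card_fin] at hcard
  subst hn
  obtain ⟨F, hF0, hMF⟩ := hP.exists_faceChain hv hM hMP hvM
  obtain ⟨c, rfl⟩ : j ∈ Set.range ι := hι ▸ by simp
  refine hN F (Matrix.det_eq_zero_of_column_eq_zero c fun m => ?_)
  rw [F.signMatrix_apply]
  induction m using Fin.lastCases with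
  | last => exact faceSign_of_isHigh (hj.mono hMF)
  | cast m =>
    have hFm : F.face m.castSucc.castSucc = {v} := by rwa [Subsingleton.elim (α := Fin 1) m 0]
    rw [hFm]
    refine faceSign_of_isLow fun x hx => ?_
    rw [Set.mem_singleton_iff.1 hx, hvj]

end IsNonsingularOn

section Flags

variable {d n : ℕ} {P F : Set (E d)}

theorem dim_of_nonempty (h : F.Nonempty) : dim F = affDim F := by
  rw [dim, if_neg h.ne_empty, affDim]

namespace FaceChain

/-- The flag of `P` that consists of the empty face and of the faces of a chain of maximal
length. -/
def toFlag (F : FaceChain n P) (hdim : dim P = n) (i : Set.Icc (-1 : ℤ) (dim P)) : Set (E d) :=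
  if (i : ℤ) = -1 then ∅ else F.face ⟨(i : ℤ).toNat, by have := i.2.2; omega⟩

theorem toFlag_mem_flags (F : FaceChain n P) (hdim : dim P = n) : F.toFlag hdim ∈ flags P := by
  have hP : affDim P ≤ n := by
    rw [← Nat.cast_le (α := ℤ), ← dim_of_nonempty ((F.nonempty 0).mono (F.subset 0)), hdim]
  refine ⟨fun i => ?_, fun i j hij => ?_⟩
  · have := i.2.1
    by_cases hi : (i : ℤ) = -1
    · simp only [toFlag, hi, if_true]
      exact ⟨isExposed_empty, by simp [dim]⟩
    · simp only [toFlag, hi, if_false]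
      refine ⟨F.exposed _, ?_⟩
      rw [dim_of_nonempty (F.nonempty _), F.affDim_face hP]
      simp only
      omega
  · have hij' : (i : ℤ) < j := hij
    have := i.2.1
    have hj : (j : ℤ) ≠ -1 := by omega
    by_cases hi : (i : ℤ) = -1
    · simp only [toFlag, hi, hj, if_true, if_false]
      exact Set.empty_ssubset.2 (F.nonempty _)
    · simp only [toFlag, hi, hj, if_false]
      exact F.strictMono (Fin.mk_lt_mk.2 (by omega))

theorem toFlag_injective (hdim : dim P = n) :
    Function.Injective fun F : FaceChain n P => F.toFlag hdim := by
  intro F G h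
  ext1
  funext j
  have hval := congrFun h ⟨(j : ℤ), by omega, by have := j.is_le; omega⟩
  have hj : ((j : ℕ) : ℤ) ≠ -1 := by omega
  simpa [toFlag, hj] using hval

theorem card_le_ncard_flags (hdim : dim P = n) (hfin : (flags P).Finite) :
    Nat.card (FaceChain n P) ≤ (flags P).ncard := by
  have := hfin.to_subtype
  exact Nat.card_le_card_of_injective
    (fun F => (⟨F.toFlag hdim, F.toFlag_mem_flags hdim⟩ : flags P))
    fun F G h => toFlag_injective hdim (congrArg Subtype.val h)

end FaceChain

end Flags

section Normalized

variable {d : ℕ} {P : Set (E d)}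

theorem inner_e_right (k : Fin d) (x : E d) : ⟪x, e k⟫ = x k := by
  rw [real_inner_comm, inner_e_left]

theorem IsNormalized.abs_apply_le (h : IsNormalized P) {x : E d} (hx : x ∈ P) (k : Fin d) :
    |x k| ≤ 1 := by
  have hpos := (h k).1.2 ⟨x, hx, rfl⟩
  have hneg := (h k).2.2 ⟨x, hx, rfl⟩
  simp only [inner_neg_right, inner_e_right] at hpos hneg
  exact abs_le.2 ⟨by linarith, hpos⟩

theorem IsNormalized.exists_apply_eq (h : IsNormalized P) {r : ℝ} (hr : |r| = 1) (k : Fin d) :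
    ∃ x ∈ P, x k = r := by
  rcases eq_or_eq_neg_of_abs_eq hr with rfl | rfl
  · obtain ⟨x, hx, hxk⟩ := (h k).1.1
    exact ⟨x, hx, (inner_e_right k x).symm.trans hxk⟩
  · obtain ⟨x, hx, hxk⟩ := (h k).2.1
    simp only [inner_neg_right, inner_e_right] at hxk
    exact ⟨x, hx, neg_eq_iff_eq_neg.1 hxk⟩

theorem isAntiBlockingAlong_id (hP : IsPolytope P) (hlab : IsLocallyAntiBlocking P)
    (hnorm : IsNormalized P) : IsAntiBlockingAlong (id : Fin d → Fin d) P where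
  injective := Function.injective_id
  isCompact := hP.isCompact
  isPolyhedron := hP.isPolyhedron
  nonempty := hP.nonempty
  apply_eq_zero x _ j hj := absurd ⟨j, rfl⟩ hj
  mapsTo_coordProj j x hx := by
    rw [← starProjection_compl_singleton]
    exact ((hlab {j}ᶜ).subset (Set.mem_image_of_mem _ hx)).1
  exists_pos k := by
    obtain ⟨x, hx, hxk⟩ := hnorm.exists_apply_eq abs_one k
    exact ⟨x, hx, by simp [hxk]⟩
  exists_neg k := by
    obtain ⟨x, hx, hxk⟩ := hnorm.exists_apply_eq (r := -1) (by simp) k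
    exact ⟨x, hx, by simp [hxk]⟩

/-- A nonsingular polytope in the cube `[-1, 1]^d` that contains all vectors `± e_k`. -/
structure IsUnitNonsingular (P : Set (E d)) : Prop where
  nonsingularOn : IsNonsingularOn Set.univ P
  abs_apply_le : ∀ x ∈ P, ∀ k, |x k| ≤ 1
  smul_e_mem : ∀ (k : Fin d) (r : ℝ), |r| = 1 → r • e k ∈ P

theorem isUnitNonsingular (hP : IsPolytope P) (hlab : IsLocallyAntiBlocking P)
    (hnorm : IsNormalized P) (hflag : IsFlagMinimizing P) : IsUnitNonsingular P where
  nonsingularOn := by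
    have hid := isAntiBlockingAlong_id hP hlab hnorm
    have hdim : dim P = d := by rw [dim_of_nonempty hP.nonempty, hid.affDim_eq]
    have hcard : (flags P).ncard = 2 ^ d * d.factorial := hflag
    exact ⟨d, id, Set.range_id, hid, isNonsingular_of_card_le hid <| hcard ▸
      FaceChain.card_le_ncard_flags hdim (Set.finite_of_ncard_ne_zero (by rw [hcard]; positivity))⟩
  abs_apply_le _ hx := hnorm.abs_apply_le hx
  smul_e_mem k r hr := by
    obtain ⟨x, hx, rfl⟩ := hnorm.exists_apply_eq hr k
    exact (isAntiBlockingAlong_id hP hlab hnorm).smul_e_mem hx k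

end Normalized

section SignSums

variable {d : ℕ} {Q : Set (E d)} {K S : Finset (Fin d)} {w : Fin d → ℝ}

theorem isExposed_sum_mul_eq {M : ℝ} (h : ∀ x ∈ Q, ∑ k ∈ K, w k * x k ≤ M) :
    IsExposed ℝ Q {x ∈ Q | ∑ k ∈ K, w k * x k = M} := by
  simp only [← inner_sum_smul_e] at h ⊢
  exact isExposed_of_forall_le (innerSL ℝ (∑ k ∈ K, w k • e k)) h

theorem sum_mul_sum_smul_e (hw : ∀ k ∈ S, |w k| = 1) (hSK : S ⊆ K) :
    ∑ k ∈ K, w k * (∑ j ∈ S, w j • e j : E d) k = S.card := by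
  have hsq : ∀ k ∈ S, w k * w k = 1 := fun k hk => by rw [← abs_mul_abs_self, hw k hk, one_mul]
  simp only [sum_smul_e_apply, mul_ite, mul_zero]
  rw [Finset.sum_ite_mem, Finset.inter_eq_right.2 hSK, Finset.sum_congr rfl hsq, Finset.sum_const,
    nsmul_one]

theorem sum_smul_e_mem_coordSection {P : Set (E d)} (h : ∑ k ∈ S, w k • e k ∈ P) (hSK : S ⊆ K) :
    ∑ k ∈ S, w k • e k ∈ coordSection P K :=
  mem_coordSection.2 ⟨h, fun k hk => by
    rw [sum_smul_e_apply, if_neg fun hkS => hk (hSK hkS)]⟩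

theorem eq_sum_smul_e_of_mem_coordSection {P : Set (E d)} {x : E d} (hx : x ∈ coordSection P K)
    (h : ∀ k ∈ K, x k = if k ∈ S then w k else 0) (hSK : S ⊆ K) : x = ∑ k ∈ S, w k • e k := by
  ext k
  rw [sum_smul_e_apply]
  by_cases hk : k ∈ K
  · exact h k hk
  · rw [(mem_coordSection.1 hx).2 k hk, if_neg fun hkS => hk (hSK hkS)]

end SignSums

namespace IsUnitNonsingular

variable {d : ℕ} {P : Set (E d)} {K : Finset (Fin d)} {w : Fin d → ℝ} {x v : E d} {i j k : Fin d}
  {r α β γ : ℝ}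

theorem convex (hP : IsUnitNonsingular P) : Convex ℝ P := hP.nonsingularOn.isPolyhedron.convex

theorem mul_apply_le_one (hP : IsUnitNonsingular P) (hr : |r| = 1) (hx : x ∈ P) (k : Fin d) :
    r * x k ≤ 1 := by
  calc r * x k ≤ |r * x k| := le_abs_self _
    _ = |x k| := by rw [abs_mul, hr, one_mul]
    _ ≤ 1 := hP.abs_apply_le x hx k

theorem sum_mul_le_card (hP : IsUnitNonsingular P) (hw : ∀ k ∈ K, |w k| = 1) (hx : x ∈ P) :
    ∑ k ∈ K, w k * x k ≤ K.card := by
  simpa using Finset.sum_le_card_nsmul K (fun k => w k * x k) 1 fun k hk =>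
    hP.mul_apply_le_one (hw k hk) hx k

theorem smul_e_mem_coordSection (hP : IsUnitNonsingular P) {K : Set (Fin d)} (hk : k ∈ K)
    (hr : |r| = 1) : r • e k ∈ coordSection P K := by
  refine mem_coordSection.2 ⟨hP.smul_e_mem k r hr, fun j hj => ?_⟩
  rw [PiLp.smul_apply, e_apply_of_ne (ne_of_mem_of_not_mem hk hj).symm, smul_zero]

theorem vertex_coordSection_apply (hP : IsUnitNonsingular P) {K : Set (Fin d)}
    (hv : IsExposed ℝ (coordSection P K) {v}) (k : Fin d) : v k = 0 ∨ |v k| = 1 := by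
  refine or_iff_not_imp_left.2 fun h0 => ?_
  obtain ⟨hvP, hvK⟩ := mem_coordSection.1 (hv.subset (Set.mem_singleton v))
  have hk : k ∈ K := not_imp_comm.1 (hvK k) h0
  have hle : ∀ r : ℝ, |r| = 1 → v k * r ≤ v k * v k := fun r hr => by
    simpa [e_apply_self] using (hP.nonsingularOn.coordSection K).vertex_mul_le hv
      (hP.smul_e_mem_coordSection hk hr) h0
  have hsq : 1 * |v k| ≤ |v k| * |v k| := by
    rw [one_mul, abs_mul_abs_self]
    exact abs_le'.2 ⟨by simpa using hle 1 abs_one, by simpa using hle (-1) (by simp)⟩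
  exact le_antisymm (hP.abs_apply_le v hvP k) (le_of_mul_le_mul_right hsq (abs_pos.2 h0))

theorem sum_mul_le_card_sub_one (hP : IsUnitNonsingular P) (hw : ∀ k ∈ K, |w k| = 1)
    (hwP : ∑ k ∈ K, w k • e k ∉ P) (hx : x ∈ coordSection P K) :
    ∑ k ∈ K, w k * x k ≤ K.card - 1 := by
  have hN := hP.nonsingularOn.coordSection K
  rw [← inner_sum_smul_e]
  refine hN.isPolyhedron.map_le_of_forall_isExposed hN.isCompact
    (l := innerSL ℝ (∑ k ∈ K, w k • e k)) (fun v hv => ?_) hx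
  rw [innerSL_apply_apply, inner_sum_smul_e]
  have hvK := hv.subset (Set.mem_singleton v)
  obtain ⟨i, hi, hvi⟩ : ∃ i ∈ K, v i ≠ w i := by
    by_contra! hvw
    refine hwP ?_
    rw [← eq_sum_smul_e_of_mem_coordSection hvK (fun k hk => by rw [hvw k hk, if_pos hk])
      subset_rfl]
    exact hvK.1
  have hvwi : w i * v i ≤ 0 := by
    rcases hP.vertex_coordSection_apply hv i with h0 | h1
    · rw [h0, mul_zero]
    · rw [(abs_eq_abs.1 (h1.trans (hw i hi).symm)).resolve_left hvi, mul_neg]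
      exact neg_nonpos.2 (mul_self_nonneg _)
  have herase := hP.sum_mul_le_card (fun k hk => hw k (Finset.mem_of_mem_erase hk))
    (K := K.erase i) hvK.1
  rw [Finset.cast_card_erase_of_mem hi] at herase
  rw [← Finset.add_sum_erase _ _ hi]
  linarith

theorem isExposed_sum_smul_e_erase (hP : IsUnitNonsingular P) (hw : ∀ k ∈ K, |w k| = 1)
    (hwP : ∑ k ∈ K, w k • e k ∉ P) (hi : i ∈ K) (hiP : ∑ k ∈ K.erase i, w k • e k ∈ P) :
    IsExposed ℝ (coordSection P K) {∑ k ∈ K.erase i, w k • e k} := by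
  have hwi : ∀ k ∈ K.erase i, |w k| = 1 := fun k hk => hw k (Finset.mem_of_mem_erase hk)
  have hsub := K.erase_subset i
  have hK := isExposed_sum_mul_eq fun x hx => hP.sum_mul_le_card_sub_one hw hwP hx
  have hKi := isExposed_sum_mul_eq fun x (hx : x ∈ coordSection P K) =>
    hP.sum_mul_le_card hwi hx.1
  suffices heq : {x ∈ coordSection P K | ∑ k ∈ K, w k * x k = K.card - 1} ∩
      {x ∈ coordSection P K | ∑ k ∈ K.erase i, w k * x k = (K.erase i).card} =
      {∑ k ∈ K.erase i, w k • e k} from heq ▸ hK.inter hKi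
  refine Set.eq_singleton_iff_unique_mem.2 ⟨?_, ?_⟩
  · have hmem := sum_smul_e_mem_coordSection hiP hsub
    refine ⟨⟨hmem, ?_⟩, hmem, sum_mul_sum_smul_e hwi subset_rfl⟩
    rw [sum_mul_sum_smul_e hwi hsub, Finset.cast_card_erase_of_mem hi]
  · rintro x ⟨⟨hx, hxK⟩, -, hxKi⟩
    have hxi : w i * x i = 0 := by
      rw [← Finset.add_sum_erase _ _ hi, hxKi, Finset.cast_card_erase_of_mem hi] at hxK
      linarith
    have hxk : ∀ k ∈ K.erase i, w k * x k = 1 := by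
      refine (Finset.sum_eq_sum_iff_of_le fun k hk => hP.mul_apply_le_one (hwi k hk) hx.1 k).1 ?_
      rw [hxKi, Finset.sum_const, nsmul_one]
    refine eq_sum_smul_e_of_mem_coordSection hx (fun k hk => ?_) hsub
    have hsq : w k * w k = 1 := by rw [← abs_mul_abs_self, hw k hk, one_mul]
    rcases eq_or_ne k i with rfl | hki
    · rw [if_neg (Finset.notMem_erase k K)]
      exact (mul_eq_zero.1 hxi).resolve_left (left_ne_zero_of_mul_eq_one hsq)
    · have hke := Finset.mem_erase.2 ⟨hki, hk⟩
      rw [if_pos hke]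
      exact mul_left_cancel₀ (left_ne_zero_of_mul_eq_one hsq) ((hxk k hke).trans hsq.symm)

theorem smul_e_add_smul_e_mem (hP : IsUnitNonsingular P) (hij : i ≠ j) (hα : |α| = 1)
    (hβ : |β| = 1) (hγ : |γ| = 1) (h : α • e i + β • e j ∈ P) : α • e i + γ • e j ∈ P := by
  by_contra hγP
  have hw : ∀ k ∈ ({i, j} : Finset (Fin d)), |if k = i then α else γ| = 1 := fun k _ => by
    split_ifs <;> assumption
  have hQ : IsNonsingularOn {i, j} (coordSection P {i, j}) := hP.nonsingularOn.coordSection _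
  have hαQ : α • e i ∈ coordSection P {i, j} := hP.smul_e_mem_coordSection (by simp) hα
  have herase : ({i, j} : Finset (Fin d)).erase j = {i} := by
    rw [Finset.pair_comm, Finset.erase_insert (by simpa using hij.symm)]
  have hv : IsExposed ℝ (coordSection P {i, j}) {α • e i} := by
    have := hP.isExposed_sum_smul_e_erase hw (i := j)
      (by rwa [Finset.sum_pair hij, if_pos rfl, if_neg hij.symm]) (by simp)
      (by rw [herase, Finset.sum_singleton, if_pos rfl]; exact hαQ.1)
    rwa [herase, Finset.sum_singleton, if_pos rfl, Finset.coe_pair] at this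
  have hM : IsExposed ℝ (coordSection P {i, j})
      {x ∈ coordSection P {i, j} | ∑ k ∈ {i}, α * x k = 1} :=
    isExposed_sum_mul_eq (w := fun _ => α) fun x hx => by
      simpa using hP.mul_apply_le_one hα hx.1 i
  have hαα : α * α = 1 := by rw [← abs_mul_abs_self, hα, one_mul]
  have hproj : coordProj j (α • e i + β • e j) = α • e i :=
    coordProj_add_smul_e (by simp [e_apply, hij.symm]) β
  have hvM : α • e i ∈ {x ∈ coordSection P {i, j} | ∑ k ∈ {i}, α * x k = 1} :=
    ⟨hαQ, by simp [e_apply, hαα]⟩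
  refine hQ.not_isHigh_of_pair hij hv hM (fun hMQ => ?_) hvM (by simp [e_apply, hij.symm])
    ⟨α • e i + β • e j, ⟨(mem_coordSection_pair hij).2 ⟨h, ?_⟩, ?_⟩, ?_, hproj.symm ▸ hvM⟩
  · simpa using (hMQ.ge hQ.zero_mem).2
  · simp [e_apply, hij, hij.symm]
  · simp [e_apply, hij, hαα]
  · simpa [e_apply, hij.symm] using abs_ne_zero.1 (hβ.trans_ne one_ne_zero)

end IsUnitNonsingular

section PlaneSections

variable {d : ℕ} {P : Set (E d)} {i j : Fin d} {α β r : ℝ}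

theorem add_smul_mem_of_abs_le {a b : E d} (hP : Convex ℝ P) (hadd : a + b ∈ P)
    (hsub : a - b ∈ P) (hr : |r| ≤ 1) : a + r • b ∈ P := by
  obtain ⟨hr₁, hr₂⟩ := abs_le.1 hr
  convert hP hadd hsub (a := (1 + r) / 2) (b := (1 - r) / 2) (by linarith) (by linarith) (by ring)
    using 1
  module

namespace IsUnitNonsingular

theorem corner_mem (hP : IsUnitNonsingular P) (hij : i ≠ j) (h : IsAxisAligned P i j)
    (hα : |α| = 1) (hβ : |β| = 1) : α • e i + β • e j ∈ P := by
  obtain ⟨a₁, b₁, a₂, b₂, -, -, -, -, h⟩ := h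
  change coordSection P {i, j} = _ at h
  have hαI : α ∈ Set.Icc a₁ b₁ := by
    obtain ⟨s, hs, t, -, hst⟩ := h.subset (hP.smul_e_mem_coordSection (k := i) (by simp) hα)
    have hαs : α = s := by simpa [e_apply, hij] using congrArg (fun x : E d => x i) hst
    rwa [hαs]
  have hβI : β ∈ Set.Icc a₂ b₂ := by
    obtain ⟨s, -, t, ht, hst⟩ := h.subset (hP.smul_e_mem_coordSection (k := j) (by simp) hβ)
    have hβt : β = t := by simpa [e_apply, hij.symm] using congrArg (fun x : E d => x j) hst
    rwa [hβt]
  exact (h.ge ⟨α, hαI, β, hβI, rfl⟩).1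

theorem isAxisAligned_of_corner (hP : IsUnitNonsingular P) (hij : i ≠ j) (hα : |α| = 1)
    (hβ : |β| = 1) (h : α • e i + β • e j ∈ P) : IsAxisAligned P i j := by
  have hcorner : ∀ {a b : ℝ}, |a| = 1 → |b| = 1 → a • e i + b • e j ∈ P := fun ha hb => by
    rw [add_comm]
    refine hP.smul_e_add_smul_e_mem hij.symm hb hα ha ?_
    rw [add_comm]
    exact hP.smul_e_add_smul_e_mem hij hα hβ hb h
  have hedge : ∀ {a t : ℝ}, |a| = 1 → |t| ≤ 1 → a • e i + t • e j ∈ P := fun ha ht =>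
    add_smul_mem_of_abs_le hP.convex (by simpa using hcorner ha abs_one)
      (by simpa [sub_eq_add_neg] using hcorner (b := -1) ha (by simp)) ht
  refine ⟨-1, 1, -1, 1, by norm_num, by norm_num, by norm_num, by norm_num, ?_⟩
  change coordSection P {i, j} = _
  ext x
  rw [mem_coordSection_pair hij]
  constructor
  · rintro ⟨hx, hxe⟩
    exact ⟨x i, abs_le.1 (hP.abs_apply_le x hx i), x j, abs_le.1 (hP.abs_apply_le x hx j), hxe⟩
  · rintro ⟨s, hs, t, ht, rfl⟩
    refine ⟨?_, by simp [e_apply, hij, hij.symm]⟩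
    rw [add_comm]
    refine add_smul_mem_of_abs_le hP.convex ?_ ?_ (abs_le.2 hs)
    · simpa [add_comm] using hedge abs_one (abs_le.2 ht)
    · simpa [sub_eq_add_neg, add_comm] using hedge (a := -1) (by simp) (abs_le.2 ht)

theorem isDiamond_of_no_corner (hP : IsUnitNonsingular P) (hij : i ≠ j)
    (h : ∀ α β : ℝ, |α| = 1 → |β| = 1 → α • e i + β • e j ∉ P) : IsDiamond P i j := by
  refine ⟨-1, 1, -1, 1, by norm_num, by norm_num, by norm_num, by norm_num, ?_⟩
  change coordSection P {i, j} = _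
  have hN := hP.nonsingularOn.coordSection {i, j}
  have hsegment : ∀ k ∈ ({i, j} : Set (Fin d)), ∀ s ∈ Set.Icc (-1 : ℝ) 1,
      s • e k ∈ coordSection P {i, j} := fun k hk s hs => by
    have hone := hP.smul_e_mem_coordSection hk abs_one
    have hneg := hP.smul_e_mem_coordSection (r := -1) hk (by simp)
    simpa using add_smul_mem_of_abs_le (a := 0) (b := e k) hN.isPolyhedron.convex
      (by simpa using hone) (by simpa using hneg) (abs_le.2 hs)
  refine Set.Subset.antisymm ?_ (convexHull_min ?_ hN.isPolyhedron.convex)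
  · refine (hN.isPolyhedron.subset_convexHull hN.isCompact).trans (convexHull_mono fun v hv => ?_)
    obtain ⟨hvP, hve⟩ := (mem_coordSection_pair hij).1 (hv.subset (Set.mem_singleton v))
    rcases hP.vertex_coordSection_apply hv i with hi | hi
    · rw [hi, zero_smul, zero_add] at hve
      exact Or.inr ⟨v j, abs_le.1 (hP.abs_apply_le v hvP j), hve⟩
    rcases hP.vertex_coordSection_apply hv j with hj | hj
    · rw [hj, zero_smul, add_zero] at hve
      exact Or.inl ⟨v i, abs_le.1 (hP.abs_apply_le v hvP i), hve⟩
    · exact absurd (hve ▸ hvP) (h _ _ hi hj)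
  · rintro _ (⟨s, hs, rfl⟩ | ⟨t, ht, rfl⟩)
    · exact hsegment i (by simp) s hs
    · exact hsegment j (by simp) t ht

theorem hasGraph (hP : IsUnitNonsingular P) : HasGraph P := by
  intro i j hij
  by_cases h : ∃ α β : ℝ, |α| = 1 ∧ |β| = 1 ∧ α • e i + β • e j ∈ P
  · obtain ⟨α, β, hα, hβ, h⟩ := h
    exact Or.inl (hP.isAxisAligned_of_corner hij hα hβ h)
  · push Not at h
    exact Or.inr (hP.isDiamond_of_no_corner hij h)

end IsUnitNonsingular

end PlaneSections

section Cliques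

variable {d : ℕ} {P : Set (E d)} {K : Finset (Fin d)} {w : Fin d → ℝ}

namespace IsUnitNonsingular

/-- If the sum were not in `P`, the sums over the sets `K.erase a` would lie on a common proper
face. A functional `l` that is constant on this face takes the same nonzero value at all
`w a • e a`, so it cannot vanish on all but one coordinate of a vertex `∑ k ∈ K.erase i, w k • e k`,
which has at least two. -/
theorem sum_smul_e_mem_of_erase (hP : IsUnitNonsingular P) (hcard : 2 < K.card)
    (hw : ∀ k ∈ K, |w k| = 1) (herase : ∀ a ∈ K, ∑ k ∈ K.erase a, w k • e k ∈ P) :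
    ∑ k ∈ K, w k • e k ∈ P := by
  by_contra hwP
  have hN := hP.nonsingularOn.coordSection K
  have hM := isExposed_sum_mul_eq fun x hx => hP.sum_mul_le_card_sub_one hw hwP hx
  have hmem : ∀ a ∈ K, ∑ k ∈ K.erase a, w k • e k ∈
      {x ∈ coordSection P K | ∑ k ∈ K, w k * x k = K.card - 1} := fun a ha => by
    refine ⟨sum_smul_e_mem_coordSection (herase a ha) (K.erase_subset a), ?_⟩
    rw [sum_mul_sum_smul_e (fun k hk => hw k (Finset.mem_of_mem_erase hk)) (K.erase_subset a),
      Finset.cast_card_erase_of_mem ha]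
  have hne : {x ∈ coordSection P K | ∑ k ∈ K, w k * x k = K.card - 1} ≠ coordSection P K := by
    intro h
    have h0 := (h.ge hN.zero_mem).2
    have : (2 : ℝ) < K.card := mod_cast hcard
    simp only [PiLp.zero_apply, mul_zero, Finset.sum_const_zero] at h0
    linarith
  obtain ⟨i, j, k, hi, hj, hk, hij, hik, hjk⟩ := Finset.two_lt_card_iff.1 hcard
  obtain ⟨l, m, hm, hl, hsubsingleton⟩ := hN.exists_support
    (hP.isExposed_sum_smul_e_erase hw hwP hi (herase i hi)) hM hne (hmem i hi)
  have hconst : ∀ a ∈ K, w a * l (e a) = ∑ k ∈ K, w k * l (e k) - m := fun a ha => by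
    rw [← hl _ (hmem a ha), map_sum, ← Finset.add_sum_erase _ _ ha]
    simp only [map_smul, smul_eq_mul, add_sub_cancel_right]
  have hnonzero : ∀ a ∈ K, w a * l (e a) ≠ 0 := by
    intro a ha h0
    have hzero : ∀ b ∈ K, w b * l (e b) = 0 := fun b hb => by rw [hconst b hb, ← hconst a ha, h0]
    have := hconst a ha
    rw [Finset.sum_eq_zero hzero] at this
    linarith
  have hsupport : ∀ a ∈ K, a ≠ i → (∑ k ∈ K.erase i, w k • e k : E d) a * l (e a) ≠ 0 :=
    fun a ha hai => by
      rw [sum_smul_e_apply, if_pos (Finset.mem_erase.2 ⟨hai, ha⟩)]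
      exact hnonzero a ha
  exact hjk (hsubsingleton (hsupport j hj hij.symm) (hsupport k hk hik.symm))

theorem sum_smul_e_mem_of_isClique (hP : IsUnitNonsingular P) (hK : (graph P).IsClique K)
    (hw : ∀ k ∈ K, |w k| = 1) : ∑ k ∈ K, w k • e k ∈ P := by
  induction K using Finset.strongInduction with
  | H K ih =>
    rcases lt_or_ge 2 K.card with hcard | hcard
    · exact hP.sum_smul_e_mem_of_erase hcard hw fun a ha =>
        ih _ (Finset.erase_ssubset ha) (hK.subset (K.erase_subset a)) fun k hk =>
          hw k (Finset.mem_of_mem_erase hk)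
    · interval_cases hc : K.card
      · rw [Finset.card_eq_zero.1 hc, Finset.sum_empty]
        exact hP.nonsingularOn.zero_mem
      · obtain ⟨i, rfl⟩ := Finset.card_eq_one.1 hc
        rw [Finset.sum_singleton]
        exact hP.smul_e_mem i _ (hw i (by simp))
      · obtain ⟨i, j, hij, rfl⟩ := Finset.card_eq_two.1 hc
        rw [Finset.sum_pair hij]
        have hadj : (graph P).Adj i j := hK (by simp) (by simp) hij
        exact hP.corner_mem hij hadj.2 (hw i (by simp)) (hw j (by simp))

end IsUnitNonsingular

theorem oneVec_apply (s : Fin d → SignType) (k : Fin d) : oneVec s k = (s k : ℝ) := by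
  simp [oneVec, e_apply]

theorem abs_signType_cast {t : SignType} (ht : t ≠ 0) : |(t : ℝ)| = 1 := by
  cases t <;> simp at ht ⊢

theorem orthantCone_subset_coordSubspace {s : Fin d → SignType} {J : Set (Fin d)} :
    (orthantCone s : Set (E d)) ⊆ coordSubspace J ↔ ∀ k, s k ≠ 0 → k ∈ J := by
  constructor
  · intro h k hk
    by_contra hkJ
    have hmem : (s k : ℝ) • e k ∈ coordSubspace J := h (PointedCone.subset_hull ⟨k, hk, rfl⟩)
    have hzero : (s k : ℝ) = 0 := by simpa [e_apply_self] using mem_coordSubspace.1 hmem k hkJ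
    simpa [hzero] using abs_signType_cast hk
  · intro h x hx
    refine Submodule.span_le.2 ?_ (PointedCone.hull_le_span (R := ℝ) _ hx)
    rintro _ ⟨k, hk, rfl⟩
    exact Submodule.smul_mem _ _ (Submodule.subset_span ⟨k, h k hk, rfl⟩)

namespace IsUnitNonsingular

theorem vertex_apply (hP : IsUnitNonsingular P) {v : E d} (hv : IsExposed ℝ P {v}) (k : Fin d) :
    v k = 0 ∨ |v k| = 1 :=
  hP.vertex_coordSection_apply (K := Set.univ) (by rwa [coordSection_univ]) k

theorem cliqueHull_subset (hP : IsUnitNonsingular P) : cliqueHull (graph P) ⊆ P := by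
  refine convexHull_min ?_ hP.convex
  rintro _ ⟨s, ⟨J, hJ, hs⟩, rfl⟩
  rw [orthantCone_subset_coordSubspace] at hs
  have hsum : oneVec s = ∑ k with s k ≠ 0, (s k : ℝ) • e k :=
    (Finset.sum_filter_of_ne (p := fun k => s k ≠ 0) fun k _ hk h0 => hk (by simp [h0])).symm
  rw [hsum]
  exact hP.sum_smul_e_mem_of_isClique (hJ.subset fun k hk => hs k (by simpa using hk))
    fun k hk => abs_signType_cast (by simpa using hk)

theorem subset_cliqueHull (hP : IsUnitNonsingular P) : P ⊆ cliqueHull (graph P) := by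
  refine (hP.nonsingularOn.isPolyhedron.subset_convexHull hP.nonsingularOn.isCompact).trans
    (convexHull_mono fun v hv => ?_)
  have hvP : v ∈ P := hv.subset (Set.mem_singleton v)
  refine ⟨fun k => SignType.sign (v k), ⟨{k | v k ≠ 0}, fun i hi j hj hij => ⟨hij, ?_⟩, ?_⟩, ?_⟩
  · refine hP.isAxisAligned_of_corner hij ((hP.vertex_apply hv i).resolve_left hi)
      ((hP.vertex_apply hv j).resolve_left hj) ?_
    rw [← Finset.sum_pair hij (f := fun k => v k • e k)]
    exact hP.nonsingularOn.sum_smul_e_mem hvP _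
  · rw [orthantCone_subset_coordSubspace]
    exact fun k hk h => hk (by simp [h])
  · ext k
    rw [oneVec_apply]
    rcases hP.vertex_apply hv k with h | h
    · simp [h]
    · rcases eq_or_eq_neg_of_abs_eq h with h | h <;> simp [h]

theorem eq_cliqueHull (hP : IsUnitNonsingular P) : P = cliqueHull (graph P) :=
  hP.subset_cliqueHull.antisymm hP.cliqueHull_subset

end IsUnitNonsingular

end Cliques

end FlagPolytope

theorem mainTheorem5 (d : ℕ) (P : Set (FlagPolytope.E d))
    (hP : FlagPolytope.IsPolytope P)
    (hlab : FlagPolytope.IsLocallyAntiBlocking P)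
    (hnorm : FlagPolytope.IsNormalized P)
    (hflag : FlagPolytope.IsFlagMinimizing P) :
    FlagPolytope.HasGraph P ∧
    P = FlagPolytope.cliqueHull (FlagPolytope.graph P) ∧
    (∀ Q : Set (FlagPolytope.E d),
      FlagPolytope.IsPolytope Q → FlagPolytope.IsLocallyAntiBlocking Q →
      FlagPolytope.IsNormalized Q → FlagPolytope.IsFlagMinimizing Q →
      FlagPolytope.graph Q = FlagPolytope.graph P → Q = P) ∧
    (∀ v ∈ FlagPolytope.vertices P, ∀ i : Fin d, v i = 0 ∨ v i = 1 ∨ v i = -1) := by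
  have hU := FlagPolytope.isUnitNonsingular hP hlab hnorm hflag
  refine ⟨hU.hasGraph, hU.eq_cliqueHull, fun Q hQ hQlab hQnorm hQflag hG => ?_, fun v hv i => ?_⟩
  · have hQU := FlagPolytope.isUnitNonsingular hQ hQlab hQnorm hQflag
    rw [hU.eq_cliqueHull, ← hG]
    exact hQU.eq_cliqueHull
  · exact (hU.vertex_apply hv.1 i).imp_right eq_or_eq_neg_of_abs_eq
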